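/- Let $P\subset\mathbb{C}$ be a finite set of points in general position (no three distinct points of $P$ are collinear). For finite $A\subset\mathbb C$ let $\mathrm{Conv}(A)$ be its convex hull; a point of $A$ is called internal to $A$ if it lies in the topological interior of $\mathrm{Conv}(A)$, and $A$ is called convex if it has no internal points. Assume that $P$ satisfies Property $\Delta_2$: for every convex subset $A\subseteq P$ with $|A|\ge 3$, the interior of $\mathrm{Conv}(A)$ contains at most $(|A|-3)+2$ points of $P$. A partition of a finite set $Q\subset\mathbb C$ is noncrossing if the convex hulls of its blocks are pairwise disjoint. Let $\mathrm{NC}(Q)$ be the set of noncrossing partitions of $Q$, partially ordered by refinement, with minimum $\hat 0$ (all blocks are singletons), maximum $\hat 1$ (at most one block), and rank function $\rho(\pi)=|Q|-(\text{number of blocks of }\pi)$. An interval $[\alpha,\beta]$ of $\mathrm{NC}(Q)$ is called rank-symmetric if, with $r=\rho(\beta)-\rho(\alpha)$, for every $0\le k\le r$ the number of $\pi\in[\alpha,\beta]$ with $\rho(\pi)-\rho(\alpha)=k$ equals the number of those with $\rho(\pi)-\rho(\alpha)=r-k$; and $\mathrm{NC}(Q)$ is called rank-symmetric if this holds for $[\hat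 0,\hat 1]$. Let $\ell$ be a boundary line of $P$, that is, the line through two distinct points $u,v\in P$ such that the segment from $u$ to $v$ is an edge of the boundary of $\mathrm{Conv}(P)$, and let $\pi_\ell\in \mathrm{NC}(P)$ be the partition in which $\{u,v\}$ is a block and all other blocks are singletons. Suppose that 1. $P$ satisfies Property $\Delta_1$ relative to $\ell$: every subset $B\subseteq P$ with $u,v\in B$ has at most $\left\lfloor \frac{|B|-2}{2}\right\rfloor$ internal points; and 2. $\mathrm{NC}(Q)$ is rank-symmetric for every proper subset $Q\subsetneq P$. Then the interval $\mathrm{NC}_\ell(P)=[\pi_\ell,\hat 1]$ of $\mathrm{NC}(P)$ is rank-symmetric. -/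

import Mathlib

/-! Noncrossing partitions of finite planar configurations `P ⊂ ℂ`.
Partitions of `P` are `Finpartition P`, ordered by refinement (`⊥` is the partition into
singletons, `⊤` the partition with a single block). -/

noncomputable section

namespace NCConfig

/-- `P` is in general position: no three distinct points of `P` are collinear. -/
def GeneralPosition (P : Finset ℂ) : Prop :=
  ∀ a ∈ P, ∀ b ∈ P, ∀ c ∈ P, a ≠ b → a ≠ c → b ≠ c → ¬ Collinear ℝ ({a, b, c} : Set ℂ)

open Classical in
/-- `int(A)` relative to `P`: the points of `P` in the topological interior of `Conv(A)`. -/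
def interiorPoints (P A : Finset ℂ) : Finset ℂ :=
  P.filter (fun p => p ∈ interior (convexHull ℝ (A : Set ℂ)))

/-- A finite set `A` is convex if no point of `A` lies in the interior of `Conv(A)`. -/
def IsConvexSubset (A : Finset ℂ) : Prop := interiorPoints A A = ∅

/-- Property `Δ_k`: `P` is in general position, and every convex subset `A` of `P` has at most
`(|A| - 3) + k` points of `P` in its interior. Only the `A` with at least three points
matter: the convex hull of a smaller set has empty interior, and no condition is meant there. -/
def PropertyDelta (k : ℕ) (P : Finset ℂ) : Prop :=
  GeneralPosition P ∧
    ∀ A : Finset ℂ, A ⊆ P → 3 ≤ A.card → IsConvexSubset A →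
      (interiorPoints P A).card ≤ (A.card - 3) + k

/-- The line through `u` and `v` is a boundary line of `P`: `u` and `v` are distinct points of
`P`, and the segment between them is an edge of the boundary of `Conv(P)`. -/
structure IsBoundaryLine (P : Finset ℂ) (u v : ℂ) : Prop where
  left_mem : u ∈ P
  right_mem : v ∈ P
  ne : u ≠ v
  edge : segment ℝ u v ⊆ frontier (convexHull ℝ (P : Set ℂ))

/-- Property `Δ₁` relative to the line through `u` and `v`: each `B ⊆ P` that contains `u`
and `v` has at most `⌊(|B| - 2) / 2⌋` internal points. -/
def PropertyDeltaOneRel (P : Finset ℂ) (u v : ℂ) : Prop :=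
  ∀ B : Finset ℂ, B ⊆ P → u ∈ B → v ∈ B → (interiorPoints B B).card ≤ (B.card - 2) / 2

/-- A partition is noncrossing if the convex hulls of distinct blocks are disjoint. -/
def IsNoncrossing {P : Finset ℂ} (π : Finpartition P) : Prop :=
  ∀ A ∈ π.parts, ∀ B ∈ π.parts, A ≠ B →
    Disjoint (convexHull ℝ (A : Set ℂ)) (convexHull ℝ (B : Set ℂ))

/-- `NC(P)`, as a subset of the lattice of all partitions of `P`. -/
def NC (P : Finset ℂ) : Set (Finpartition P) := {π | IsNoncrossing π}

/-- The interval `[a, b]` of `NC(P)`. -/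
def NCIcc {P : Finset ℂ} (a b : Finpartition P) : Set (Finpartition P) := NC P ∩ Set.Icc a b

/-- The rank function `ρ(π) = |P| - bl(π)`. -/
def rank {P : Finset ℂ} (π : Finpartition P) : ℕ := P.card - π.parts.card

/-- The number of elements of rank `k` in the interval `[a, b]` of `NC(P)`, ranks within the
interval being counted from its minimum `a`. -/
def rankNumber {P : Finset ℂ} (a b : Finpartition P) (k : ℕ) : ℕ :=
  {π ∈ NCIcc a b | rank π = rank a + k}.ncard

/-- The interval `[a, b]` of `NC(P)`, which has rank `r = ρ(b) - ρ(a)`, is rank-symmetric: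
for all `k ≤ r` it has as many elements of rank `k` as of rank `r - k`. -/
def IntervalRankSymmetric {P : Finset ℂ} (a b : Finpartition P) : Prop :=
  ∀ k ≤ rank b - rank a, rankNumber a b k = rankNumber a b (rank b - rank a - k)

/-- `NC(P) = [0̂, 1̂]` is rank-symmetric. -/
def NCRankSymmetric (P : Finset ℂ) : Prop :=
  IntervalRankSymmetric (⊥ : Finpartition P) ⊤

/-- The partition `π_ℓ` for the line `ℓ` through the points `u`, `v` of `P`: one block is
`{u, v}`, and all other blocks are singletons. -/
def linePartition {P : Finset ℂ} {u v : ℂ} (hu : u ∈ P) (hv : v ∈ P) : Finpartition P :=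
  (⊥ : Finpartition (P \ {u, v})).extend (b := {u, v}) (c := P)
    (Finset.insert_ne_empty u {v}) Finset.sdiff_disjoint
    (Finset.sdiff_union_of_subset
      (Finset.insert_subset hu (Finset.singleton_subset_iff.mpr hv)))

theorem mem_linePartition {P : Finset ℂ} {u v : ℂ} (hu : u ∈ P) (hv : v ∈ P) (A : Finset ℂ) :
    A ∈ (linePartition hu hv).parts ↔ A = {u, v} ∨ ∃ w ∈ P, w ≠ u ∧ w ≠ v ∧ A = {w} := by
  simp only [linePartition, Finpartition.extend_parts, Finset.mem_insert,
    Finpartition.mem_bot_iff, Finset.mem_sdiff, Finset.mem_singleton, not_or]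
  grind

/-- In general position `π_ℓ` is noncrossing, so that `[π_ℓ, 1̂]` is an interval of `NC(P)`. -/
theorem linePartition_mem_NC {P : Finset ℂ} {u v : ℂ} (hP : GeneralPosition P) (huv : u ≠ v)
    (hu : u ∈ P) (hv : v ∈ P) : linePartition hu hv ∈ NC P := by
  have key : ∀ w ∈ P, w ≠ u → w ≠ v → w ∉ convexHull ℝ ({u, v} : Set ℂ) := by
    intro w hw hwu hwv h
    rw [convexHull_pair] at h
    refine hP u hu w hw v hv hwu.symm huv hwv ?_
    exact (mem_segment_iff_wbtw.mp h).collinear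
  intro A hA B hB hAB
  rw [mem_linePartition] at hA hB
  rcases hA with rfl | ⟨w, hw, hwu, hwv, rfl⟩ <;> rcases hB with rfl | ⟨x, hx, hxu, hxv, rfl⟩
  · exact absurd rfl hAB
  · simpa using key x hx hxu hxv
  · simpa using key w hw hwu hwv
  · simpa using fun h => hAB (by rw [h])

end NCConfig

end

/-! Call a family of partitions symmetric about `N` if the block counts `#π` and `N - #π` are
equally distributed over it. With `n = |P|`, the goal is symmetry about `n` for the partitions
joining `u` and `v`.

Orient the edge so that the other points lie to the left of `u → v`. Deleting `u` preserves the
number of blocks and identifies the partitions joining `u` and `v` with those `σ ∈ NC(P \ u)` in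
which `u` can be put back into the block of `v`. By hypothesis `NC(P \ u)` is symmetric about `(n -
1) + 1 = n`, so it suffices that the bad `σ` are symmetric about `n` too. Let `w` be the first point
of the block of `v` met when turning about `v` away from `u`. By `Δ₁`, `σ` is bad exactly when the
triangle `u v w` has a point `x` of `P` in its interior (`disjoint_insert`, `bijOn_erase`), and the
bad `σ` are classified by `w`.

To count them, send the line `uv` to infinity by a projective chart in which `v` is the downward
direction; "below the segment `pq`" then means "inside the triangle `p q v`". The condition `Δ₁`
enters through saturated sets `B`, which attain its bound: adding `T` to `B` makes at most `|T \ B|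
/ 2` new points internal (`two_mul_card_le`). Hence one added point makes none internal, and three
make at most one. The set `{u, v, w, x}` is saturated.

Let `X` and `Z` be the points before and after the vertical line through `w`, with `w`, `v` in `Z`.
A block meeting both cannot cross the segment `wv`, so it passes over `e = w`. The partitions
without such a block form a product: a partition of `X`, symmetric about `|X| + 1`, and one of `Z`
joining `w` and `v`, symmetric about `|Z|` by the theorem for fewer points, as `Z` inherits `Δ₁`
relative to `wv`. Otherwise take the connection `pq` that is lowest over `e`. Its block lies above
`pq`. Move the points of `Z` above `pq` to `X`, remember that `p` and `q` are joined from above (a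
pin), and replace `B` by `B ∪ {p, q}`, which has two more points and one more internal point, `e`,
and is again saturated. All connections between the new parts pass over `q`, so the situation
reproduces itself with a smaller `Z` (`IsGlue.step`, `exists_split`, `split_unique`).

The pins collected in `X` form a chain, and the partitions of `X` respecting it are again a glued
family, cut at the last pin added (`IsChain.pinnedFamilies_eq`). Induction on `|X| + |Z|`, and
within it on `|Z|`, gives `blockSymmetric_gluedFamilies`. -/

noncomputable section

namespace NCConfig

/-! ### Orientation of triples of points -/

/-- The orientation determinant of the triple `p, q, r`. -/
def orient (p q r : ℂ) : ℝ :=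
  (q.re - p.re) * (r.im - p.im) - (q.im - p.im) * (r.re - p.re)

theorem orient_rotate (p q r : ℂ) : orient q r p = orient p q r := by
  unfold orient; ring

theorem orient_swap_right (p q r : ℂ) : orient p r q = -orient p q r := by
  unfold orient; ring

theorem orient_swap_left (p q r : ℂ) : orient q p r = -orient p q r := by
  unfold orient; ring

@[simp] theorem orient_self_left (p r : ℂ) : orient p p r = 0 := by
  unfold orient; ring

@[simp] theorem orient_self_right (p r : ℂ) : orient p r r = 0 := by
  unfold orient; ring

@[simp] theorem orient_self_outer (p r : ℂ) : orient p r p = 0 := by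
  unfold orient; ring

theorem orient_combo (p q x y : ℂ) (s t : ℝ) (h : s + t = 1) :
    orient p q (s • x + t • y) = s * orient p q x + t * orient p q y := by
  obtain rfl : s = 1 - t := by linarith
  simp only [orient, Complex.add_re, Complex.add_im, Complex.real_smul, Complex.mul_re,
    Complex.mul_im, Complex.ofReal_re, Complex.ofReal_im]
  ring

theorem continuous_orient (p q : ℂ) : Continuous (orient p q) := by
  unfold orient
  fun_prop

theorem convex_orient_nonneg (p q : ℂ) : Convex ℝ {z | 0 ≤ orient p q z} := by
  intro x hx y hy s t hs ht hst
  simp only [Set.mem_ofPred_eq] at *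
  rw [orient_combo _ _ _ _ _ _ hst]
  positivity

theorem convex_orient_neg (p q : ℂ) : Convex ℝ {z | orient p q z < 0} := by
  intro x hx y hy s t hs ht hst
  simp only [Set.mem_ofPred_eq] at *
  rw [orient_combo _ _ _ _ _ _ hst]
  rcases hs.eq_or_lt with rfl | hs
  · obtain rfl : t = 1 := by linarith
    linarith
  · nlinarith [mul_pos hs (neg_pos.2 hx), mul_nonneg ht (neg_pos.2 hy).le]

theorem disjoint_convexHull_of_orient {p q : ℂ} {s t : Set ℂ}
    (hs : ∀ z ∈ s, 0 ≤ orient p q z) (ht : ∀ z ∈ t, orient p q z < 0) :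
    Disjoint (convexHull ℝ s) (convexHull ℝ t) := by
  rw [Set.disjoint_left]
  intro z hz hz'
  have h1 := convexHull_min (t := {z | 0 ≤ orient p q z}) hs (convex_orient_nonneg p q) hz
  have h2 := convexHull_min (t := {z | orient p q z < 0}) ht (convex_orient_neg p q) hz'
  simp only [Set.mem_ofPred_eq] at h1 h2
  linarith

/-- The three strict inequalities define an open set, and the orientations divided by their sum are
barycentric coordinates of each of its points. -/
theorem mem_interior_triangle {p q r z : ℂ} {s : Set ℂ} (hp : p ∈ s) (hq : q ∈ s) (hr : r ∈ s)
    (h1 : 0 < orient p q z) (h2 : 0 < orient q r z) (h3 : 0 < orient r p z) :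
    z ∈ interior (convexHull ℝ s) := by
  have ho : IsOpen ({y | 0 < orient p q y} ∩ {y | 0 < orient q r y} ∩ {y | 0 < orient r p y}) :=
    ((isOpen_lt continuous_const (continuous_orient _ _)).inter
      (isOpen_lt continuous_const (continuous_orient _ _))).inter
      (isOpen_lt continuous_const (continuous_orient _ _))
  refine interior_maximal ?_ ho ⟨⟨h1, h2⟩, h3⟩
  rintro y ⟨⟨h1, h2⟩, h3⟩
  simp only [Set.mem_ofPred_eq] at h1 h2 h3
  set d := orient q r y + orient r p y + orient p q y with hd
  have hd0 : 0 < d := by positivity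
  have hy : y = (orient q r y / d) • p + (orient r p y / d) • q + (orient p q y / d) • r := by
    apply Complex.ext <;>
      simp only [Complex.add_re, Complex.add_im, Complex.real_smul, Complex.mul_re,
        Complex.mul_im, Complex.ofReal_re, Complex.ofReal_im] <;> field_simp <;>
      simp only [hd, orient] <;> ring
  rw [hy]
  have hc := convex_convexHull ℝ s
  have := hc.sum_mem (t := Finset.univ) (w := ![orient q r y / d, orient r p y / d, orient p q y / d])
    (z := ![p, q, r]) (by intro i _; fin_cases i <;> simp <;> positivity)
    (by simp [Fin.sum_univ_three]; field_simp; exact hd.symm)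
    (by intro i _; fin_cases i <;> simp <;> apply subset_convexHull <;> assumption)
  simpa [Fin.sum_univ_three] using this

/-- The segment from `r` to `s` crosses the one from `p` to `q`, from right to left. -/
def Crosses (p q r s : ℂ) : Prop :=
  orient p q r < 0 ∧ 0 < orient p q s ∧ orient r s p * orient r s q < 0

theorem not_disjoint_of_crosses {p q r s : ℂ} (h : Crosses p q r s) {A B : Set ℂ}
    (hp : p ∈ A) (hq : q ∈ A) (hr : r ∈ B) (hs : s ∈ B) :
    ¬ Disjoint (convexHull ℝ A) (convexHull ℝ B) := by
  obtain ⟨h1, h2, h3⟩ := h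
  rw [Set.not_disjoint_iff]
  -- This difference is positive, which decides which factor of the negative product is positive;
  -- the common point is then the intersection of the two segments.
  have e1 : orient r s p - orient r s q = orient p q s - orient p q r := by
    unfold orient; ring
  set d := orient p q s - orient p q r with hd
  have hd0 : 0 < d := by linarith
  have hpq : 0 < orient r s p ∧ orient r s q < 0 := by
    constructor <;> nlinarith
  refine ⟨(orient p q s / d) • r + (-orient p q r / d) • s, ?_, ?_⟩
  · have : (orient p q s / d) • r + (-orient p q r / d) • s
        = (-orient r s q / d) • p + (orient r s p / d) • q := by
      apply Complex.ext <;>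
        simp only [Complex.add_re, Complex.add_im, Complex.real_smul, Complex.mul_re,
          Complex.mul_im, Complex.ofReal_re, Complex.ofReal_im] <;> field_simp <;>
        simp only [orient] <;> ring
    rw [this]
    refine convex_convexHull ℝ A (subset_convexHull ℝ A hp) (subset_convexHull ℝ A hq) ?_ ?_ ?_
    · apply div_nonneg <;> linarith
    · apply div_nonneg <;> linarith
    · field_simp; linarith
  · refine convex_convexHull ℝ B (subset_convexHull ℝ B hr) (subset_convexHull ℝ B hs) ?_ ?_ ?_
    · apply div_nonneg <;> linarith
    · apply div_nonneg <;> linarith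
    · field_simp; linarith

theorem GeneralPosition.mono {P Q : Finset ℂ} (hP : GeneralPosition P) (h : Q ⊆ P) :
    GeneralPosition Q :=
  fun a ha b hb c hc => hP a (h ha) b (h hb) c (h hc)

theorem GeneralPosition.orient_ne_zero {P : Finset ℂ} (hP : GeneralPosition P) {p q r : ℂ}
    (hp : p ∈ P) (hq : q ∈ P) (hr : r ∈ P) (hpq : p ≠ q) (hpr : p ≠ r) (hqr : q ≠ r) :
    orient p q r ≠ 0 := by
  intro h
  refine hP p hp q hq r hr hpq hpr hqr ?_
  rw [collinear_iff_of_mem (p₀ := p) (by simp)]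
  refine ⟨q - p, ?_⟩
  have hn : (q.re - p.re) ^ 2 + (q.im - p.im) ^ 2 ≠ 0 := by
    intro h0
    apply hpq
    apply Complex.ext <;> nlinarith [sq_nonneg (q.re - p.re), sq_nonneg (q.im - p.im)]
  intro x hx
  simp only [Set.mem_insert_iff, Set.mem_singleton_iff] at hx
  rcases hx with rfl | rfl | rfl
  · exact ⟨0, by simp⟩
  · exact ⟨1, by simp⟩
  · refine ⟨((q.re - p.re) * (x.re - p.re) + (q.im - p.im) * (x.im - p.im)) /
      ((q.re - p.re) ^ 2 + (q.im - p.im) ^ 2), ?_⟩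
    unfold orient at h
    apply Complex.ext
    · simp only [vadd_eq_add, Complex.add_re, Complex.real_smul, Complex.mul_re, Complex.ofReal_re,
        Complex.ofReal_im, Complex.sub_re, Complex.sub_im]
      field_simp
      linear_combination (q.im - p.im) * (-h)
    · simp only [vadd_eq_add, Complex.add_im, Complex.real_smul, Complex.mul_im, Complex.ofReal_re,
        Complex.ofReal_im, Complex.sub_re, Complex.sub_im]
      field_simp
      linear_combination (q.re - p.re) * h

/-! ### Projective coordinates with the line through `u` and `v` at infinity -/

section Coordinates

variable (u v : ℂ)

/-- The abscissa: it orders points by their angle as seen from `v`. -/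
def absc (z : ℂ) : ℝ :=
  ((v.re - u.re) * (z.re - v.re) + (v.im - u.im) * (z.im - v.im)) / orient u v z

/-- The ordinate in the projective chart in which `v` is the downward direction. -/
def ordi (z : ℂ) : ℝ := -1 / orient u v z

/-- The ordinate at abscissa `t` of the line through `p` and `q`. -/
def lineHeight (p q : ℂ) (t : ℝ) : ℝ :=
  ordi u v p + (ordi u v q - ordi u v p) / (absc u v q - absc u v p) * (t - absc u v p)

variable {u v}

/-- The chart is projective, with the line `uv` at infinity: to the left of that line it preserves
orientations up to positive factors, so sides of lines may be read off in the chart. -/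
theorem normSq_mul_orient {p q r : ℂ} (hp : 0 < orient u v p) (hq : 0 < orient u v q)
    (hr : 0 < orient u v r) :
    ((v.re - u.re) ^ 2 + (v.im - u.im) ^ 2) * orient p q r =
      orient u v p * orient u v q * orient u v r *
        ((absc u v q - absc u v p) * (ordi u v r - ordi u v p) -
          (absc u v r - absc u v p) * (ordi u v q - ordi u v p)) := by
  unfold absc ordi
  field_simp
  unfold orient
  ring

/-- As `v` is the vertical point at infinity, its side of the line `pq` depends only on the order of
the abscissae. -/
theorem normSq_mul_orient_right {p q : ℂ} (hp : 0 < orient u v p) (hq : 0 < orient u v q) :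
    ((v.re - u.re) ^ 2 + (v.im - u.im) ^ 2) * orient p q v =
      orient u v p * orient u v q * (absc u v p - absc u v q) := by
  unfold absc
  field_simp
  unfold orient
  ring

theorem normSq_pos_of_orient {p : ℂ} (hp : 0 < orient u v p) :
    0 < (v.re - u.re) ^ 2 + (v.im - u.im) ^ 2 := by
  by_contra h
  have h1 : v.re - u.re = 0 := by nlinarith [sq_nonneg (v.re - u.re), sq_nonneg (v.im - u.im)]
  have h2 : v.im - u.im = 0 := by nlinarith [sq_nonneg (v.re - u.re), sq_nonneg (v.im - u.im)]
  unfold orient at hp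
  rw [h1, h2] at hp
  simp at hp

theorem orient_right_neg_iff {p q : ℂ} (hp : 0 < orient u v p) (hq : 0 < orient u v q) :
    orient p q v < 0 ↔ absc u v p < absc u v q := by
  have h := normSq_mul_orient_right hp hq
  have hn := normSq_pos_of_orient hp
  have hpq := mul_pos hp hq
  constructor <;> intro h' <;> by_contra h'' <;> push Not at h''
  · nlinarith [mul_nonneg hpq.le (sub_nonneg.2 h''), mul_pos hn (neg_pos.2 h')]
  · nlinarith [mul_pos hpq (sub_pos.2 h'), mul_nonneg hn.le h'']

/-- The line through two points with different abscissae as the graph of an affine function. -/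
theorem exists_line {p q : ℂ} (hp : 0 < orient u v p) (hq : 0 < orient u v q)
    (h : absc u v p < absc u v q) :
    ∃ m k : ℝ, (∀ t, lineHeight u v p q t = m * t + k) ∧
      ordi u v p = m * absc u v p + k ∧ ordi u v q = m * absc u v q + k ∧
      ∀ z, 0 < orient u v z →
        (orient p q z < 0 ↔ ordi u v z < m * absc u v z + k) ∧
        (0 < orient p q z ↔ m * absc u v z + k < ordi u v z) := by
  set m := (ordi u v q - ordi u v p) / (absc u v q - absc u v p) with hm
  have hd : 0 < absc u v q - absc u v p := sub_pos.2 h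
  have hm' : m * (absc u v q - absc u v p) = ordi u v q - ordi u v p := by
    rw [hm]; field_simp
  refine ⟨m, ordi u v p - m * absc u v p, fun t => ?_, by ring, by linarith, ?_⟩
  · unfold lineHeight
    ring
  intro z hz
  have key := normSq_mul_orient hp hq hz
  have e : (absc u v q - absc u v p) * (ordi u v z - ordi u v p) -
      (absc u v z - absc u v p) * (ordi u v q - ordi u v p) =
      (absc u v q - absc u v p) *
        (ordi u v z - (m * absc u v z + (ordi u v p - m * absc u v p))) := by
    rw [← hm']; ring
  rw [e, ← mul_assoc] at key
  have hn := normSq_pos_of_orient hp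
  have hc : 0 < orient u v p * orient u v q * orient u v z * (absc u v q - absc u v p) := by
    positivity
  set C := orient u v p * orient u v q * orient u v z * (absc u v q - absc u v p)
  set N := (v.re - u.re) ^ 2 + (v.im - u.im) ^ 2
  set t := ordi u v z - (m * absc u v z + (ordi u v p - m * absc u v p)) with ht
  have h1 : orient p q z < 0 ↔ t < 0 := by
    rw [← neg_pos, ← mul_pos_iff_of_pos_left hn, mul_neg, key, ← mul_neg,
      mul_pos_iff_of_pos_left hc, neg_pos]
  have h2 : 0 < orient p q z ↔ 0 < t := by
    rw [← mul_pos_iff_of_pos_left hn, key, mul_pos_iff_of_pos_left hc]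
  rw [h1, h2, ht, sub_neg, sub_pos]
  exact ⟨Iff.rfl, Iff.rfl⟩

end Coordinates

end NCConfig

end

/-! ### Signs of affine functions, applied to differences of two lines, and plane geometry in the
chart -/

noncomputable section

namespace NCConfig

section Affine

variable {m k s t x : ℝ}

theorem affine_pos_left (hs : 0 < m * s + k) (ht : 0 ≤ m * t + k) (h1 : s ≤ x) (h2 : x < t) :
    0 < m * x + k := by
  nlinarith [mul_pos hs (sub_pos.2 h2), mul_nonneg ht (sub_nonneg.2 h1)]

theorem affine_pos_right (hs : 0 ≤ m * s + k) (ht : 0 < m * t + k) (h1 : s < x) (h2 : x ≤ t) :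
    0 < m * x + k := by
  nlinarith [mul_pos ht (sub_pos.2 h1), mul_nonneg hs (sub_nonneg.2 h2)]

theorem affine_nonneg (hs : 0 ≤ m * s + k) (ht : 0 ≤ m * t + k) (h1 : s < x) (h2 : x < t) :
    0 ≤ m * x + k := by
  nlinarith [mul_nonneg ht (sub_pos.2 h1).le, mul_nonneg hs (sub_pos.2 h2).le]

theorem affine_pos_of_le (hs : m * s + k ≤ 0) (ht : 0 < m * t + k) (h1 : s < t) (h2 : t ≤ x) :
    0 < m * x + k := by
  nlinarith [mul_nonneg ht.le (sub_nonneg.2 h2), mul_nonneg (neg_nonneg.2 hs) (sub_nonneg.2 h2),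
    mul_pos ht (sub_pos.2 h1)]

theorem affine_pos_of_ge (hs : 0 < m * s + k) (ht : m * t + k ≤ 0) (h1 : s < t) (h2 : x ≤ s) :
    0 < m * x + k := by
  nlinarith [mul_nonneg hs.le (sub_nonneg.2 h2), mul_nonneg (neg_nonneg.2 ht) (sub_nonneg.2 h2),
    mul_pos hs (sub_pos.2 h1)]

end Affine

section Plane

variable {u v p q r s e b z : ℂ}

local notation "a" => absc u v

/-- In the chart the triangle `p q v` is the vertical half-strip below the segment `pq`. -/
theorem mem_interior_of_below (hp : 0 < orient u v p) (hq : 0 < orient u v q)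
    (hz : 0 < orient u v z) (h1 : a p < a z) (h2 : a z < a q) (h : orient p q z < 0)
    {A : Set ℂ} (hpA : p ∈ A) (hqA : q ∈ A) (hvA : v ∈ A) : z ∈ interior (convexHull ℝ A) := by
  rw [← orient_right_neg_iff hp hz] at h1
  rw [← orient_right_neg_iff hz hq] at h2
  refine mem_interior_triangle hpA hvA hqA ?_ ?_ ?_
  · rw [orient_swap_right]; linarith
  · rw [← orient_rotate, ← orient_rotate, orient_swap_left] at h2
    rw [orient_swap_left] at *
    linarith [orient_rotate z q v, orient_rotate q v z, orient_swap_right v q z,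
      orient_swap_left v q z]
  · rw [orient_swap_left]; linarith

/-- The lines `bq` and `pq` meet at `q`, so `bq` stays above `pq` on the whole side of `q` that
contains `b`. -/
theorem below_of_above_left (hp : 0 < orient u v p) (hq : 0 < orient u v q)
    (hb : 0 < orient u v b) (he : 0 < orient u v e) (hpq : a p < a q) (h1 : a b < a e)
    (h2 : a e < a q) (hab : 0 < orient p q b) (hae : orient p q e < 0) : orient b q e < 0 := by
  obtain ⟨m, k, -, ep, eq, hl⟩ := exists_line hp hq hpq
  obtain ⟨m', k', -, eb, eq', hl'⟩ := exists_line hb hq (h1.trans h2)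
  rw [(hl b hb).2] at hab
  rw [(hl e he).1] at hae
  rw [(hl' e he).1]
  have := affine_pos_left (m := m' - m) (k := k' - k) (s := a b) (t := a q) (x := a e)
    (by linarith) (by linarith) h1.le h2
  linarith

theorem below_of_above_right (hp : 0 < orient u v p) (hq : 0 < orient u v q)
    (hb : 0 < orient u v b) (he : 0 < orient u v e) (hpq : a p < a q) (h1 : a p < a e)
    (h2 : a e < a b) (hab : 0 < orient p q b) (hae : orient p q e < 0) : orient p b e < 0 := by
  obtain ⟨m, k, -, ep, eq, hl⟩ := exists_line hp hq hpq
  obtain ⟨m', k', -, eb, eq', hl'⟩ := exists_line hp hb (h1.trans h2)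
  rw [(hl b hb).2] at hab
  rw [(hl e he).1] at hae
  rw [(hl' e he).1]
  have := affine_pos_right (m := m' - m) (k := k' - k) (s := a p) (t := a b) (x := a e)
    (by linarith) (by linarith) h1 h2.le
  linarith

/-- The line `rs` is below `pq` at `p` and above it at `s`, hence still above it at `q`. The next
lemmas follow the same pattern: two known signs of an affine difference determine a third. -/
theorem crosses_of_left (hp : 0 < orient u v p) (hq : 0 < orient u v q)
    (hr : 0 < orient u v r) (hs : 0 < orient u v s) (h1 : a r < a p) (h2 : a p < a s)
    (h3 : a s < a q) (hbr : orient p q r < 0) (has : 0 < orient p q s)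
    (hap : 0 < orient r s p) : Crosses p q r s := by
  refine ⟨hbr, has, mul_neg_of_pos_of_neg hap ?_⟩
  obtain ⟨m, k, -, ep, eq, hl⟩ := exists_line hp hq (h2.trans h3)
  obtain ⟨m', k', -, er, es, hl'⟩ := exists_line hr hs (h1.trans h2)
  rw [(hl s hs).2] at has
  rw [(hl' p hp).2] at hap
  rw [(hl' q hq).1]
  have := affine_pos_of_le (m := m' - m) (k := k' - k) (s := a p) (t := a s) (x := a q)
    (by linarith) (by linarith) h2 h3.le
  linarith

theorem crosses_of_right (hp : 0 < orient u v p) (hq : 0 < orient u v q)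
    (hr : 0 < orient u v r) (hs : 0 < orient u v s) (h1 : a p < a s) (h2 : a s < a q)
    (h3 : a q < a r) (hbr : orient p q r < 0) (has : 0 < orient p q s)
    (haq : 0 < orient s r q) : Crosses p q r s := by
  have hsr : orient r s q < 0 := by rw [orient_swap_left]; linarith
  refine ⟨hbr, has, mul_neg_of_pos_of_neg ?_ hsr⟩
  obtain ⟨m, k, -, ep, eq, hl⟩ := exists_line hp hq (h1.trans h2)
  obtain ⟨m', k', -, er, es, hl'⟩ := exists_line hs hr (h2.trans h3)
  rw [(hl s hs).2] at has
  rw [(hl' q hq).2] at haq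
  have : orient s r p < 0 := by
    rw [(hl' p hp).1]
    have := affine_pos_of_ge (m := m' - m) (k := k' - k) (s := a s) (t := a q) (x := a p)
      (by linarith) (by linarith) h2 h1.le
    linarith
  rw [orient_swap_left]; linarith

theorem crosses_of_between (hp : 0 < orient u v p) (hq : 0 < orient u v q)
    (hr : 0 < orient u v r) (hs : 0 < orient u v s) (hpr : a p < a r) (hrq : a r < a q)
    (hps : a p < a s) (hsq : a s < a q) (hne : a r ≠ a s) (hbr : orient p q r < 0)
    (has : 0 < orient p q s) : Crosses p q r s := by
  have hbr' := hbr
  have has' := has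
  refine ⟨hbr, has, ?_⟩
  obtain ⟨m, k, -, ep, eq, hl⟩ := exists_line hp hq (hpr.trans hrq)
  rw [(hl s hs).2] at has
  rw [(hl r hr).1] at hbr
  rcases lt_or_gt_of_ne hne with h | h
  · obtain ⟨m', k', -, er, es, hl'⟩ := exists_line hr hs h
    refine mul_neg_of_pos_of_neg ?_ ?_
    · rw [(hl' p hp).2]
      have := affine_pos_of_ge (m := m - m') (k := k - k') (s := a r) (t := a s) (x := a p)
        (by linarith) (by linarith) h hpr.le
      linarith
    · rw [(hl' q hq).1]
      have := affine_pos_of_le (m := m' - m) (k := k' - k) (s := a r) (t := a s) (x := a q)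
        (by linarith) (by linarith) h hsq.le
      linarith
  · obtain ⟨m', k', -, er, es, hl'⟩ := exists_line hs hr h
    have h1 : orient s r p < 0 := by
      rw [(hl' p hp).1]
      have := affine_pos_of_ge (m := m' - m) (k := k' - k) (s := a s) (t := a r) (x := a p)
        (by linarith) (by linarith) h hps.le
      linarith
    have h2 : 0 < orient s r q := by
      rw [(hl' q hq).2]
      have := affine_pos_of_le (m := m - m') (k := k - k') (s := a s) (t := a r) (x := a q)
        (by linarith) (by linarith) h hrq.le
      linarith
    rw [orient_swap_left s r p, orient_swap_left s r q]
    nlinarith [mul_pos (neg_pos.2 h1) h2]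

/-- The line `rs` is not below `pq` at `e` but is below it at `q`, so it is above it everywhere to
the left of `e`, in particular at `r` and `p`. This is how minimality of the connection `pq` is
used. -/
theorem crosses_of_lineHeight_le (hp : 0 < orient u v p) (hq : 0 < orient u v q)
    (hr : 0 < orient u v r) (hs : 0 < orient u v s) (hpe : a p < a e) (heq : a e < a q)
    (hre : a r < a e) (hqs : a q < a s) (hbs : orient p q s < 0) (haq : 0 < orient r s q)
    (hh : lineHeight u v p q (a e) ≤ lineHeight u v r s (a e)) : Crosses p q s r := by
  obtain ⟨m, k, hk, ep, eq, hl⟩ := exists_line hp hq (hpe.trans heq)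
  obtain ⟨m', k', hk', er, es, hl'⟩ := exists_line hr hs (hre.trans (heq.trans hqs))
  rw [hk, hk'] at hh
  have haq' := haq
  rw [(hl' q hq).2] at haq
  have g : ∀ x, x < a e → 0 < (m' - m) * x + (k' - k) := fun x hx => by
    have h1 : 0 < (m' - m) * x + (k' - k) ∨ (m' - m) * x + (k' - k) ≤ 0 := lt_or_ge _ _
    rcases h1 with h1 | h1
    · exact h1
    · exfalso
      have := affine_pos_right (m := m - m') (k := k - k') (s := x) (t := a q) (x := a e)
        (by linarith) (by linarith) hx heq.le
      linarith
  have g1 := g _ hre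
  have g2 := g _ hpe
  have h3 : orient r s p < 0 := by rw [(hl' p hp).1]; linarith
  refine ⟨hbs, by rw [(hl r hr).2]; linarith, ?_⟩
  rw [orient_swap_left r s p, orient_swap_left r s q]
  nlinarith [mul_pos (neg_pos.2 h3) haq']

theorem crosses_of_above_vertex (hp : 0 < orient u v p) (hq : 0 < orient u v q)
    (hr : 0 < orient u v r) (hs : 0 < orient u v s) (he : 0 < orient u v e) (hpe : a p < a e)
    (hre : a r ≤ a e) (hes : a e < a s) (hsq : a s < a q) (hae : 0 ≤ orient r s e)
    (hbe : orient p q e < 0) (hbr : orient p q r < 0) (has : 0 < orient p q s) :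
    Crosses p q r s := by
  refine ⟨hbr, has, ?_⟩
  obtain ⟨m, k, -, ep, eq, hl⟩ := exists_line hp hq (hpe.trans (hes.trans hsq))
  obtain ⟨m', k', -, er, es, hl'⟩ := exists_line hr hs (hre.trans_lt hes)
  rw [(hl s hs).2] at has
  rw [(hl e he).1] at hbe
  rw [← not_lt, (hl' e he).1, not_lt] at hae
  refine mul_neg_of_pos_of_neg ?_ ?_
  · rw [(hl' p hp).2]
    have := affine_pos_of_ge (m := m - m') (k := k - k') (s := a e) (t := a s) (x := a p)
      (by linarith) (by linarith) hes hpe.le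
    linarith
  · rw [(hl' q hq).1]
    have := affine_pos_of_le (m := m' - m) (k := k' - k) (s := a e) (t := a s) (x := a q)
      (by linarith) (by linarith) hes hsq.le
    linarith

theorem below_of_line_above (hp : 0 < orient u v p) (hq : 0 < orient u v q)
    (hr : 0 < orient u v r) (hs : 0 < orient u v s) (he : 0 < orient u v e)
    (hrp : a r < a p) (hpe : a p < a e) (hes : a e < a s) (hpq : a p < a q)
    (hbp : orient r s p < 0) (has : 0 < orient p q s) (hbe : orient p q e < 0) :
    orient r s e < 0 := by
  obtain ⟨m, k, -, ep, eq, hl⟩ := exists_line hp hq hpq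
  obtain ⟨m', k', -, er, es, hl'⟩ := exists_line hr hs (hrp.trans (hpe.trans hes))
  rw [(hl s hs).2] at has
  rw [(hl e he).1] at hbe
  rw [(hl' p hp).1] at hbp
  rw [(hl' e he).1]
  have := affine_pos_right (m := m' - m) (k := k' - k) (s := a p) (t := a s) (x := a e)
    (by linarith) (by linarith) hpe hes.le
  linarith

theorem above_of_line_below (hp : 0 < orient u v p) (hq : 0 < orient u v q)
    (hr : 0 < orient u v r) (hz : 0 < orient u v z) (he : 0 < orient u v e)
    (hpe : a p < a e) (heq : a e < a q) (hqz : a q < a z) (hre : a r ≤ a e)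
    (hae : 0 ≤ orient r z e) (hbe : orient p q e < 0) (hbz : orient p q z < 0) :
    0 < orient r z q := by
  obtain ⟨m, k, -, ep, eq, hl⟩ := exists_line hp hq (hpe.trans heq)
  obtain ⟨m', k', -, er, es, hl'⟩ := exists_line hr hz (hre.trans_lt (heq.trans hqz))
  rw [(hl z hz).1] at hbz
  rw [(hl e he).1] at hbe
  rw [← not_lt, (hl' e he).1, not_lt] at hae
  rw [(hl' q hq).2]
  have := affine_pos_right (m := m - m') (k := k - k') (s := a e) (t := a z) (x := a q)
    (by linarith) (by linarith) heq hqz.le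
  linarith

theorem below_of_ends_above (hp : 0 < orient u v p) (hq : 0 < orient u v q)
    (hr : 0 < orient u v r) (hs : 0 < orient u v s) (he : 0 < orient u v e) (hpq : a p < a q)
    (hre : a r < a e) (hes : a e < a s) (har : 0 ≤ orient p q r) (has : 0 ≤ orient p q s)
    (hbe : orient p q e < 0) : orient r s e < 0 := by
  obtain ⟨m, k, -, ep, eq, hl⟩ := exists_line hp hq hpq
  obtain ⟨m', k', -, er, es, hl'⟩ := exists_line hr hs (hre.trans hes)
  rw [← not_lt, (hl r hr).1, not_lt] at har
  rw [← not_lt, (hl s hs).1, not_lt] at has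
  rw [(hl e he).1] at hbe
  rw [(hl' e he).1]
  have := affine_nonneg (m := m' - m) (k := k' - k) (s := a r) (t := a s) (x := a e)
    (by linarith) (by linarith) hre hes
  linarith

theorem below_of_left_above (hp : 0 < orient u v p) (hq : 0 < orient u v q)
    (hr : 0 < orient u v r) (hs : 0 < orient u v s) (he : 0 < orient u v e) (hpq : a p < a q)
    (hre : a r < a e) (heq : a e < a q) (hqs : a q < a s) (har : 0 ≤ orient p q r)
    (hbq : orient r s q < 0) (hbe : orient p q e < 0) : orient r s e < 0 := by
  obtain ⟨m, k, -, ep, eq, hl⟩ := exists_line hp hq hpq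
  obtain ⟨m', k', -, er, es, hl'⟩ := exists_line hr hs (hre.trans (heq.trans hqs))
  rw [← not_lt, (hl r hr).1, not_lt] at har
  rw [(hl e he).1] at hbe
  rw [(hl' q hq).1] at hbq
  rw [(hl' e he).1]
  have := affine_pos_right (m := m' - m) (k := k' - k) (s := a r) (t := a q) (x := a e)
    (by linarith) (by linarith) hre heq.le
  linarith

theorem above_of_left_below (hp : 0 < orient u v p) (hq : 0 < orient u v q)
    (hr : 0 < orient u v r) (hs : 0 < orient u v s) (hpq : a p < a q)
    (hrq : a r < a q) (hqs : a q < a s) (hbr : orient p q r < 0)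
    (hbq : orient r s q < 0) : 0 < orient p q s := by
  obtain ⟨m, k, -, ep, eq, hl⟩ := exists_line hp hq hpq
  obtain ⟨m', k', -, er, es, hl'⟩ := exists_line hr hs (hrq.trans hqs)
  rw [(hl r hr).1] at hbr
  rw [(hl' q hq).1] at hbq
  rw [(hl s hs).2]
  have := affine_pos_of_le (m := m' - m) (k := k' - k) (s := a r) (t := a q) (x := a s)
    (by linarith) (by linarith) hrq hqs.le
  linarith

theorem lineHeight_lt_left (hp : 0 < orient u v p) (hq : 0 < orient u v q)
    (hr : 0 < orient u v r) (hs : 0 < orient u v s) (hpq : a p < a q)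
    (hre : a r < a e) (hes : a e < a s) (har : 0 < orient p q r) (has : 0 ≤ orient p q s) :
    lineHeight u v p q (a e) < lineHeight u v r s (a e) := by
  obtain ⟨m, k, hk, ep, eq, hl⟩ := exists_line hp hq hpq
  obtain ⟨m', k', hk', er, es, hl'⟩ := exists_line hr hs (hre.trans hes)
  rw [(hl r hr).2] at har
  rw [← not_lt, (hl s hs).1, not_lt] at has
  rw [hk, hk']
  have := affine_pos_left (m := m' - m) (k := k' - k) (s := a r) (t := a s) (x := a e)
    (by linarith) (by linarith) hre.le hes
  linarith

theorem lineHeight_lt_right (hp : 0 < orient u v p) (hq : 0 < orient u v q)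
    (hr : 0 < orient u v r) (hs : 0 < orient u v s) (hpq : a p < a q)
    (hre : a r < a e) (hes : a e < a s) (har : 0 ≤ orient p q r) (has : 0 < orient p q s) :
    lineHeight u v p q (a e) < lineHeight u v r s (a e) := by
  obtain ⟨m, k, hk, ep, eq, hl⟩ := exists_line hp hq hpq
  obtain ⟨m', k', hk', er, es, hl'⟩ := exists_line hr hs (hre.trans hes)
  rw [(hl s hs).2] at has
  rw [← not_lt, (hl r hr).1, not_lt] at har
  rw [hk, hk']
  have := affine_pos_right (m := m' - m) (k := k' - k) (s := a r) (t := a s) (x := a e)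
    (by linarith) (by linarith) hre hes.le
  linarith

theorem lineHeight_lt_of_below (hp : 0 < orient u v p) (hq : 0 < orient u v q)
    (hr : 0 < orient u v r) (hs : 0 < orient u v s) (hpq : a p < a q)
    (hre : a r < a e) (heq : a e < a q) (hqs : a q < a s) (har : 0 < orient p q r)
    (hbq : orient r s q < 0) :
    lineHeight u v p q (a e) < lineHeight u v r s (a e) := by
  obtain ⟨m, k, hk, ep, eq, hl⟩ := exists_line hp hq hpq
  obtain ⟨m', k', hk', er, es, hl'⟩ := exists_line hr hs (hre.trans (heq.trans hqs))
  rw [(hl r hr).2] at har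
  rw [(hl' q hq).1] at hbq
  rw [hk, hk']
  have := affine_pos_left (m := m' - m) (k := k' - k) (s := a r) (t := a q) (x := a e)
    (by linarith) (by linarith) hre.le heq
  linarith

theorem lineHeight_lt_replace_left (hp : 0 < orient u v p) (hq : 0 < orient u v q)
    (hz : 0 < orient u v z) (hpq : a p < a q) (hze : a z < a e) (heq : a e < a q)
    (hbz : orient p q z < 0) : lineHeight u v z q (a e) < lineHeight u v p q (a e) := by
  obtain ⟨m, k, hk, ep, eq, hl⟩ := exists_line hp hq hpq
  obtain ⟨m', k', hk', er, es, hl'⟩ := exists_line hz hq (hze.trans heq)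
  rw [(hl z hz).1] at hbz
  rw [hk, hk']
  have := affine_pos_left (m := m - m') (k := k - k') (s := a z) (t := a q) (x := a e)
    (by linarith) (by linarith) hze.le heq
  linarith

theorem lineHeight_lt_replace_right (hp : 0 < orient u v p) (hq : 0 < orient u v q)
    (hz : 0 < orient u v z) (hpq : a p < a q) (hpe : a p < a e) (hez : a e < a z)
    (hbz : orient p q z < 0) : lineHeight u v p z (a e) < lineHeight u v p q (a e) := by
  obtain ⟨m, k, hk, ep, eq, hl⟩ := exists_line hp hq hpq
  obtain ⟨m', k', hk', er, es, hl'⟩ := exists_line hp hz (hpe.trans hez)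
  rw [(hl z hz).1] at hbz
  rw [hk, hk']
  have := affine_pos_right (m := m - m') (k := k - k') (s := a p) (t := a z) (x := a e)
    (by linarith) (by linarith) hpe hez.le
  linarith

end Plane

end NCConfig

end

noncomputable section

namespace NCConfig

/-! ### Noncrossing partitions as families of finsets -/

/-- The family `π` is a noncrossing partition of `X`. -/
structure IsNCFamily (X : Finset ℂ) (π : Finset (Finset ℂ)) : Prop where
  nonempty : ∀ E ∈ π, E.Nonempty
  subset : ∀ E ∈ π, E ⊆ X
  cover : ∀ z ∈ X, ∃ E ∈ π, z ∈ E
  disjoint : ∀ E ∈ π, ∀ E' ∈ π, E ≠ E' →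
    Disjoint (convexHull ℝ (E : Set ℂ)) (convexHull ℝ (E' : Set ℂ))

theorem IsNCFamily.eq_of_mem {X : Finset ℂ} {π : Finset (Finset ℂ)} (h : IsNCFamily X π)
    {E E' : Finset ℂ} (hE : E ∈ π) (hE' : E' ∈ π) {z : ℂ} (hz : z ∈ E) (hz' : z ∈ E') :
    E = E' := by
  by_contra hne
  exact Set.disjoint_left.1 (h.disjoint E hE E' hE' hne)
    (subset_convexHull ℝ _ hz) (subset_convexHull ℝ _ hz')

theorem IsNCFamily.not_crosses {X : Finset ℂ} {π : Finset (Finset ℂ)} (h : IsNCFamily X π)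
    {E E' : Finset ℂ} (hE : E ∈ π) (hE' : E' ∈ π) (hne : E ≠ E') {p q r s : ℂ} (hp : p ∈ E)
    (hq : q ∈ E) (hr : r ∈ E') (hs : s ∈ E') : ¬ Crosses p q r s := fun hc =>
  not_disjoint_of_crosses hc (A := (E : Set ℂ)) (B := (E' : Set ℂ)) hp hq hr hs
    (h.disjoint E hE E' hE' hne)

open Classical in
/-- All noncrossing partitions of `X`. -/
def ncFamilies (X : Finset ℂ) : Finset (Finset (Finset ℂ)) :=
  X.powerset.powerset.filter (IsNCFamily X)

theorem mem_ncFamilies {X : Finset ℂ} {π : Finset (Finset ℂ)} :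
    π ∈ ncFamilies X ↔ IsNCFamily X π := by
  classical
  simp only [ncFamilies, Finset.mem_filter, Finset.mem_powerset, and_iff_right_iff_imp]
  intro h E hE
  exact Finset.mem_powerset.2 (h.subset E hE)

/-- The traces on `Y` of the members of `π`. -/
def trace (π : Finset (Finset ℂ)) (Y : Finset ℂ) : Finset (Finset ℂ) :=
  (π.image (· ∩ Y)).erase ∅

theorem mem_trace {π : Finset (Finset ℂ)} {Y A : Finset ℂ} :
    A ∈ trace π Y ↔ A.Nonempty ∧ ∃ E ∈ π, E ∩ Y = A := by
  simp only [trace, Finset.mem_erase, Finset.mem_image, Finset.nonempty_iff_ne_empty]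

theorem IsNCFamily.trace {X Y : Finset ℂ} {π : Finset (Finset ℂ)} (h : IsNCFamily X π)
    (hY : Y ⊆ X) : IsNCFamily Y (trace π Y) := by
  refine ⟨fun A hA => (mem_trace.1 hA).1, fun A hA => ?_, fun z hz => ?_, ?_⟩
  · obtain ⟨-, E, -, rfl⟩ := mem_trace.1 hA
    exact Finset.inter_subset_right
  · obtain ⟨E, hE, hzE⟩ := h.cover z (hY hz)
    exact ⟨E ∩ Y, mem_trace.2 ⟨⟨z, by simp [hzE, hz]⟩, E, hE, rfl⟩, by simp [hzE, hz]⟩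
  · intro A hA A' hA' hne
    obtain ⟨-, E, hE, rfl⟩ := mem_trace.1 hA
    obtain ⟨-, E', hE', rfl⟩ := mem_trace.1 hA'
    have : E ≠ E' := fun h => hne (by rw [h])
    exact (h.disjoint E hE E' hE' this).mono
      (convexHull_mono (by simp)) (convexHull_mono (by simp))

/-- Some block contains both points of the pair `k` and lies to the left of it. -/
def Pinned (π : Finset (Finset ℂ)) (k : ℂ × ℂ) : Prop :=
  ∃ E ∈ π, k.1 ∈ E ∧ k.2 ∈ E ∧ ∀ z ∈ E, 0 ≤ orient k.1 k.2 z

open Classical in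
/-- The noncrossing partitions of `X` that are pinned at all pairs of the list `K`. -/
def pinnedFamilies (X : Finset ℂ) (K : List (ℂ × ℂ)) : Finset (Finset (Finset ℂ)) :=
  (ncFamilies X).filter fun π => ∀ k ∈ K, Pinned π k

theorem mem_pinnedFamilies {X : Finset ℂ} {K : List (ℂ × ℂ)} {π : Finset (Finset ℂ)} :
    π ∈ pinnedFamilies X K ↔ IsNCFamily X π ∧ ∀ k ∈ K, Pinned π k := by
  simp [pinnedFamilies, mem_ncFamilies]

@[simp] theorem pinnedFamilies_nil (X : Finset ℂ) : pinnedFamilies X [] = ncFamilies X := by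
  ext π
  simp [mem_pinnedFamilies, mem_ncFamilies]

/-! ### Families with a symmetric distribution of the number of blocks -/

/-- The distributions of `#π` and of `N - #π` over the family agree. -/
def BlockSymmetric (𝒜 : Finset (Finset (Finset ℂ))) (N : ℤ) : Prop :=
  ∀ f : ℤ → ℤ, ∑ π ∈ 𝒜, f π.card = ∑ π ∈ 𝒜, f (N - π.card)

theorem BlockSymmetric.union {𝒜 ℬ : Finset (Finset (Finset ℂ))} {N : ℤ}
    (hA : BlockSymmetric 𝒜 N) (hB : BlockSymmetric ℬ N) (h : Disjoint 𝒜 ℬ) :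
    BlockSymmetric (𝒜 ∪ ℬ) N := fun f => by
  rw [Finset.sum_union h, Finset.sum_union h, hA f, hB f]

theorem BlockSymmetric.biUnion {ι : Type*} [DecidableEq ι] {I : Finset ι}
    {𝒜 : ι → Finset (Finset (Finset ℂ))} {N : ℤ} (h : ∀ i ∈ I, BlockSymmetric (𝒜 i) N)
    (hd : (I : Set ι).PairwiseDisjoint 𝒜) : BlockSymmetric (I.biUnion 𝒜) N := fun f => by
  rw [Finset.sum_biUnion hd, Finset.sum_biUnion hd]
  exact Finset.sum_congr rfl fun i hi => h i hi f

theorem BlockSymmetric.sdiff {𝒜 ℬ : Finset (Finset (Finset ℂ))} {N : ℤ}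
    (hA : BlockSymmetric 𝒜 N) (hB : BlockSymmetric ℬ N) (h : ℬ ⊆ 𝒜) :
    BlockSymmetric (𝒜 \ ℬ) N := fun f => by
  have h1 := Finset.sum_sdiff (f := fun π => f (π.card : ℤ)) h
  have h2 := Finset.sum_sdiff (f := fun π => f (N - π.card : ℤ)) h
  have h3 := hA f
  have h4 := hB f
  linarith

theorem BlockSymmetric.of_bijOn {𝒜 ℬ : Finset (Finset (Finset ℂ))} {N : ℤ}
    (hB : BlockSymmetric ℬ N) (i : Finset (Finset ℂ) → Finset (Finset ℂ))
    (hi : Set.BijOn i 𝒜 ℬ) (hc : ∀ π ∈ 𝒜, (i π).card = π.card) : BlockSymmetric 𝒜 N := fun f => by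
  have key : ∀ g : ℤ → ℤ, ∑ π ∈ 𝒜, g π.card = ∑ π ∈ ℬ, g π.card := fun g =>
    Finset.sum_bij (fun π _ => i π) (fun π h => hi.mapsTo h) (fun π h π' h' e => hi.injOn h h' e)
      (fun σ h => by
        obtain ⟨π, h1, h2⟩ := hi.surjOn h
        exact ⟨π, h1, h2⟩) (fun π h => by rw [hc π h])
  rw [key f, key fun x => f (N - x)]
  exact hB f

/-- As `X` and `Z` are disjoint, the two factors can be recovered from their union and block counts
add. Reflecting one count at a time adds the centres. -/
theorem BlockSymmetric.product {X Z : Finset ℂ} (hXZ : Disjoint X Z)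
    {𝒜 ℬ 𝒞 : Finset (Finset (Finset ℂ))} {N M : ℤ} (hA : BlockSymmetric 𝒜 N)
    (hB : BlockSymmetric ℬ M) (hAX : ∀ π ∈ 𝒜, IsNCFamily X π) (hBZ : ∀ π ∈ ℬ, IsNCFamily Z π)
    (hC : ∀ π, π ∈ 𝒞 ↔ ∃ α ∈ 𝒜, ∃ β ∈ ℬ, π = α ∪ β) : BlockSymmetric 𝒞 (N + M) := by
  have hd : ∀ α ∈ 𝒜, ∀ β ∈ ℬ, ∀ E ∈ α, E ∉ β := by
    intro α hα β hβ E h1 h2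
    obtain ⟨z, hz⟩ := (hAX α hα).nonempty E h1
    exact Finset.disjoint_left.1 hXZ ((hAX α hα).subset E h1 hz) ((hBZ β hβ).subset E h2 hz)
  have hcr : ∀ α ∈ 𝒜, ∀ β ∈ ℬ, ∀ E, E ∈ α ↔ E ∈ α ∪ β ∧ E ⊆ X := by
    intro α hα β hβ E
    refine ⟨fun h => ⟨Finset.mem_union_left _ h, (hAX α hα).subset E h⟩, fun ⟨h, hX⟩ => ?_⟩
    refine (Finset.mem_union.1 h).resolve_right fun h2 => ?_
    obtain ⟨z, hz⟩ := (hBZ β hβ).nonempty E h2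
    exact Finset.disjoint_left.1 hXZ (hX hz) ((hBZ β hβ).subset E h2 hz)
  have hcr' : ∀ α ∈ 𝒜, ∀ β ∈ ℬ, ∀ E, E ∈ β ↔ E ∈ α ∪ β ∧ E ⊆ Z := by
    intro α hα β hβ E
    refine ⟨fun h => ⟨Finset.mem_union_right _ h, (hBZ β hβ).subset E h⟩, fun ⟨h, hX⟩ => ?_⟩
    refine (Finset.mem_union.1 h).resolve_left fun h2 => ?_
    obtain ⟨z, hz⟩ := (hAX α hα).nonempty E h2
    exact Finset.disjoint_left.1 hXZ ((hAX α hα).subset E h2 hz) (hX hz)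
  have key : ∀ g : ℤ → ℤ,
      ∑ π ∈ 𝒞, g π.card = ∑ α ∈ 𝒜, ∑ β ∈ ℬ, g ((α.card : ℤ) + β.card) := by
    intro g
    rw [← Finset.sum_product']
    symm
    refine Finset.sum_bij (fun x _ => x.1 ∪ x.2) ?_ ?_ ?_ ?_
    · rintro ⟨α, β⟩ h
      rw [Finset.mem_product] at h
      exact (hC _).2 ⟨α, h.1, β, h.2, rfl⟩
    · rintro ⟨α, β⟩ h ⟨α', β'⟩ h' e
      rw [Finset.mem_product] at h h'
      simp only at e h h'
      ext E
      · simp only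
        rw [hcr α h.1 β h.2, hcr α' h'.1 β' h'.2, e]
      · simp only
        rw [hcr' α h.1 β h.2, hcr' α' h'.1 β' h'.2, e]
    · intro π hπ
      obtain ⟨α, hα, β, hβ, rfl⟩ := (hC π).1 hπ
      exact ⟨(α, β), Finset.mem_product.2 ⟨hα, hβ⟩, rfl⟩
    · rintro ⟨α, β⟩ h
      rw [Finset.mem_product] at h
      rw [Finset.card_union_of_disjoint (Finset.disjoint_left.2 (hd α h.1 β h.2))]
      push_cast
      rfl
  intro f
  rw [key f, key fun x => f (N + M - x)]
  calc ∑ α ∈ 𝒜, ∑ β ∈ ℬ, f ((α.card : ℤ) + β.card)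
      = ∑ β ∈ ℬ, ∑ α ∈ 𝒜, f ((α.card : ℤ) + β.card) := Finset.sum_comm
    _ = ∑ β ∈ ℬ, ∑ α ∈ 𝒜, f (N - α.card + β.card) :=
        Finset.sum_congr rfl fun β _ => hA fun x => f (x + β.card)
    _ = ∑ α ∈ 𝒜, ∑ β ∈ ℬ, f (N - α.card + β.card) := Finset.sum_comm
    _ = ∑ α ∈ 𝒜, ∑ β ∈ ℬ, f (N + M - (α.card + β.card)) :=
        Finset.sum_congr rfl fun α _ => by
          rw [hB fun x => f (N - α.card + x)]
          exact Finset.sum_congr rfl fun β _ => by congr 1; ring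

/-- Test with the indicator function of `i`. -/
theorem BlockSymmetric.card_eq {𝒜 : Finset (Finset (Finset ℂ))} {N : ℤ}
    (h : BlockSymmetric 𝒜 N) {i j : ℕ} (hij : (i : ℤ) + j = N) :
    (𝒜.filter fun π => π.card = i).card = (𝒜.filter fun π => π.card = j).card := by
  have := h fun x => if x = i then 1 else 0
  rw [Finset.sum_boole, Finset.sum_boole] at this
  have e1 : (𝒜.filter fun π => (π.card : ℤ) = i) = 𝒜.filter fun π => π.card = i :=
    Finset.filter_congr fun π _ => by norm_cast
  have e2 : (𝒜.filter fun π => N - (π.card : ℤ) = i) = 𝒜.filter fun π => π.card = j :=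
    Finset.filter_congr fun π _ => by omega
  rw [e1, e2] at this
  exact_mod_cast this

theorem blockSymmetric_of_card_eq {𝒜 : Finset (Finset (Finset ℂ))} {n : ℕ}
    (h1 : ∀ π ∈ 𝒜, 1 ≤ π.card ∧ π.card ≤ n)
    (h : ∀ i, 1 ≤ i → i ≤ n → (𝒜.filter fun π => π.card = i).card =
      (𝒜.filter fun π => π.card = n + 1 - i).card) : BlockSymmetric 𝒜 (n + 1) := by
  have key : ∀ g : ℤ → ℤ, ∑ π ∈ 𝒜, g π.card =
      ∑ i ∈ Finset.Icc 1 n, ((𝒜.filter fun π => π.card = i).card : ℤ) * g i := by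
    intro g
    rw [← Finset.sum_fiberwise_of_maps_to (s := 𝒜) (t := Finset.Icc 1 n) (g := Finset.card)
      fun π hπ => Finset.mem_Icc.2 (h1 π hπ)]
    refine Finset.sum_congr rfl fun i _ => ?_
    rw [Finset.sum_congr rfl (g := fun _ => g i), Finset.sum_const, nsmul_eq_mul]
    intro π hπ
    rw [(Finset.mem_filter.1 hπ).2]
  intro f
  rw [key f, key fun x => f (n + 1 - x)]
  refine Finset.sum_nbij' (fun i => n + 1 - i) (fun i => n + 1 - i) ?_ ?_ ?_ ?_ ?_
  · intro i hi; simp only [Finset.mem_Icc] at *; omega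
  · intro i hi; simp only [Finset.mem_Icc] at *; omega
  · intro i hi; simp only [Finset.mem_Icc] at *; omega
  · intro i hi; simp only [Finset.mem_Icc] at *; omega
  · intro i hi
    simp only [Finset.mem_Icc] at hi
    rw [h i hi.1 hi.2]
    congr 2
    omega

/-! ### Comparison with `Finpartition` -/

theorem isNCFamily_parts {P : Finset ℂ} {π : Finpartition P} (h : IsNoncrossing π) :
    IsNCFamily P π.parts :=
  ⟨fun _ hE => π.nonempty_of_mem_parts hE, fun _ hE => π.subset hE, fun _ hz => π.exists_mem hz, h⟩

theorem IsNCFamily.exists_finpartition {P : Finset ℂ} {σ : Finset (Finset ℂ)}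
    (h : IsNCFamily P σ) : ∃ π : Finpartition P, IsNoncrossing π ∧ π.parts = σ := by
  let π : Finpartition P := Finpartition.ofExistsUnique σ h.subset
    (fun z hz => by
      obtain ⟨E, hE, hzE⟩ := h.cover z hz
      exact ⟨E, ⟨hE, hzE⟩, fun E' hE' => h.eq_of_mem hE'.1 hE hE'.2 hzE⟩)
    (fun he => by simpa using h.nonempty ∅ he)
  exact ⟨π, h.disjoint, rfl⟩

theorem rankNumber_eq_card {P : Finset ℂ} {x y : Finpartition P} {k : ℕ} (hk : rank x + k ≤ P.card)
    {𝒜 : Finset (Finset (Finset ℂ))}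
    (h𝒜 : ∀ σ, σ ∈ 𝒜 ↔ ∃ π ∈ NCIcc x y, π.parts = σ) :
    rankNumber x y k = (𝒜.filter fun σ => σ.card = P.card - (rank x + k)).card := by
  unfold rankNumber
  rw [← Set.ncard_image_of_injective (f := Finpartition.parts) _ (fun a b h => Finpartition.ext h),
    ← Set.ncard_coe_finset]
  congr 1
  ext σ
  simp only [Set.mem_image, Set.mem_sep_iff, Finset.coe_filter, h𝒜]
  constructor
  · rintro ⟨π, ⟨h1, h2⟩, rfl⟩
    have := π.card_parts_le_card
    unfold rank at h2
    exact ⟨⟨π, h1, rfl⟩, by unfold rank; omega⟩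
  · rintro ⟨⟨π, h1, rfl⟩, h2⟩
    have := π.card_parts_le_card
    refine ⟨π, ⟨h1, ?_⟩, rfl⟩
    rw [show rank π = P.card - π.parts.card from rfl]
    omega

theorem card_parts_top {P : Finset ℂ} (hP : P.Nonempty) :
    (⊤ : Finpartition P).parts.card = 1 := by
  have h1 := Finset.card_le_card (Finpartition.parts_top_subset P)
  have h2 := (Finpartition.parts_nonempty (⊤ : Finpartition P) hP.ne_empty).card_pos
  simp at h1
  omega

/-- Ranks `k` and `|Q| - 1 - k` correspond to block counts with sum `|Q| + 1`. The empty set has to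
be excluded: its only partition has no block. -/
theorem NCRankSymmetric.blockSymmetric {Q : Finset ℂ} (hQ : Q.Nonempty) (h : NCRankSymmetric Q) :
    BlockSymmetric (ncFamilies Q) (Q.card + 1) := by
  have hr0 : rank (⊥ : Finpartition Q) = 0 := by simp [rank]
  have hr1 : rank (⊤ : Finpartition Q) = Q.card - 1 := by simp [rank, card_parts_top hQ]
  have hm : ∀ σ, σ ∈ ncFamilies Q ↔
      ∃ π ∈ NCIcc (⊥ : Finpartition Q) ⊤, π.parts = σ := by
    intro σ
    rw [mem_ncFamilies]
    constructor
    · intro hσ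
      obtain ⟨π, h1, h2⟩ := hσ.exists_finpartition
      exact ⟨π, ⟨h1, bot_le, le_top⟩, h2⟩
    · rintro ⟨π, ⟨h1, -⟩, rfl⟩
      exact isNCFamily_parts h1
  have hc := hQ.card_pos
  apply blockSymmetric_of_card_eq
  · intro σ hσ
    obtain ⟨π, -, rfl⟩ := (hm σ).1 hσ
    exact ⟨(π.parts_nonempty hQ.ne_empty).card_pos, π.card_parts_le_card⟩
  · intro i h1 h2
    have := h (i - 1) (by rw [hr0, hr1]; omega)
    rw [rankNumber_eq_card (by rw [hr0]; omega) hm,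
      rankNumber_eq_card (by rw [hr0, hr1]; omega) hm, hr0, hr1] at this
    rw [show Q.card + 1 - i = Q.card - (0 + (i - 1)) by omega, this]
    congr 2
    ext σ
    omega

theorem linePartition_le_iff {P : Finset ℂ} {u v : ℂ} (hu : u ∈ P) (hv : v ∈ P)
    (π : Finpartition P) : linePartition hu hv ≤ π ↔ ∃ E ∈ π.parts, u ∈ E ∧ v ∈ E := by
  constructor
  · intro h
    obtain ⟨E, hE, hs⟩ := h ((mem_linePartition hu hv _).2 (Or.inl rfl))
    exact ⟨E, hE, hs (by simp), hs (by simp)⟩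
  · rintro ⟨E, hE, h1, h2⟩ A hA
    rcases (mem_linePartition hu hv _).1 hA with rfl | ⟨w, hw, -, -, rfl⟩
    · exact ⟨E, hE, by simp [Finset.insert_subset_iff, h1, h2]⟩
    · obtain ⟨B, hB, hwB⟩ := π.exists_mem hw
      exact ⟨B, hB, by simpa using hwB⟩

theorem rank_linePartition {P : Finset ℂ} {u v : ℂ} (hu : u ∈ P) (hv : v ∈ P) (huv : u ≠ v) :
    rank (linePartition hu hv) = 1 := by
  have h1 : (P \ {u, v}).card = P.card - 2 := by
    rw [Finset.card_sdiff_of_subset (by simp [Finset.insert_subset_iff, hu, hv]),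
      Finset.card_pair huv]
  have h2 : 2 ≤ P.card := by
    rw [← Finset.card_pair huv]
    exact Finset.card_le_card (by simp [Finset.insert_subset_iff, hu, hv])
  unfold rank linePartition
  rw [Finpartition.card_extend, Finpartition.card_bot, h1]
  omega

/-- The interval starts at rank 1 and has length `|P| - 2`; its elements of relative ranks `k` and
`|P| - 2 - k` have `|P| - 1 - k` and `k + 1` blocks, with sum `|P|`. -/
theorem intervalRankSymmetric_of_blockSymmetric {P : Finset ℂ} {u v : ℂ} (hu : u ∈ P) (hv : v ∈ P)
    (huv : u ≠ v) {𝒜 : Finset (Finset (Finset ℂ))}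
    (h𝒜 : ∀ σ, σ ∈ 𝒜 ↔ IsNCFamily P σ ∧ ∃ E ∈ σ, u ∈ E ∧ v ∈ E)
    (h : BlockSymmetric 𝒜 P.card) :
    IntervalRankSymmetric (linePartition hu hv) (⊤ : Finpartition P) := by
  have h2 : 2 ≤ P.card := by
    rw [← Finset.card_pair huv]
    exact Finset.card_le_card (by simp [Finset.insert_subset_iff, hu, hv])
  have hr0 := rank_linePartition hu hv huv
  have hr1 : rank (⊤ : Finpartition P) = P.card - 1 := by simp [rank, card_parts_top ⟨u, hu⟩]
  have hm : ∀ σ, σ ∈ 𝒜 ↔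
      ∃ π ∈ NCIcc (linePartition hu hv) (⊤ : Finpartition P), π.parts = σ := by
    intro σ
    rw [h𝒜]
    constructor
    · rintro ⟨hσ, hE⟩
      obtain ⟨π, h1, rfl⟩ := hσ.exists_finpartition
      exact ⟨π, ⟨h1, (linePartition_le_iff hu hv π).2 hE, le_top⟩, rfl⟩
    · rintro ⟨π, ⟨h1, h2, -⟩, rfl⟩
      exact ⟨isNCFamily_parts h1, (linePartition_le_iff hu hv π).1 h2⟩
  intro k hk
  rw [hr0, hr1] at hk
  rw [rankNumber_eq_card (by rw [hr0]; omega) hm,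
    rankNumber_eq_card (by rw [hr0, hr1]; omega) hm, hr0, hr1]
  apply h.card_eq
  omega

end NCConfig

end

/-! ### Anchored configurations, saturated sets and covering segments -/

noncomputable section

namespace NCConfig

/-- A configuration in general position, to the left of the directed line from `u` to `v`, in
which every subset containing `u` and `v` has few internal points. -/
structure IsAnchored (P : Finset ℂ) (u v : ℂ) : Prop where
  gp : GeneralPosition P
  left_mem : u ∈ P
  right_mem : v ∈ P
  ne : u ≠ v
  pos : ∀ z ∈ P, z ≠ u → z ≠ v → 0 < orient u v z
  rel : PropertyDeltaOneRel P u v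

/-- The points of `P` off the line through `u` and `v`. -/
def chartPoints (P : Finset ℂ) (u v : ℂ) : Finset ℂ := P.filter fun z => 0 < orient u v z

theorem mem_chartPoints {P : Finset ℂ} {u v z : ℂ} :
    z ∈ chartPoints P u v ↔ z ∈ P ∧ 0 < orient u v z := by
  simp [chartPoints]

theorem mem_interiorPoints {P A : Finset ℂ} {z : ℂ} :
    z ∈ interiorPoints P A ↔ z ∈ P ∧ z ∈ interior (convexHull ℝ (A : Set ℂ)) := by
  simp [interiorPoints]

theorem interior_convexHull_mono {A B : Finset ℂ} (h : A ⊆ B) :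
    interior (convexHull ℝ (A : Set ℂ)) ⊆ interior (convexHull ℝ (B : Set ℂ)) :=
  interior_mono (convexHull_mono (by exact_mod_cast h))

/-- `B` attains the bound of Property `Δ₁` relative to the line through `u` and `v`. -/
structure IsSaturated (P : Finset ℂ) (u v : ℂ) (B : Finset ℂ) : Prop where
  subset : B ⊆ P
  left_mem : u ∈ B
  right_mem : v ∈ B
  card_eq : 2 * (interiorPoints B B).card + 2 = B.card

/-- `e` lies below the segment from `x` to `y` in the chart. -/
structure Covers (u v x y e : ℂ) : Prop where
  pos : 0 < orient u v y
  lt_left : absc u v x < absc u v e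
  lt_right : absc u v e < absc u v y
  below : orient x y e < 0

section

variable {P B : Finset ℂ} {u v : ℂ}

theorem IsAnchored.mem_chart (hP : IsAnchored P u v) {z : ℂ} (hz : z ∈ P) (hu : z ≠ u)
    (hv : z ≠ v) : z ∈ chartPoints P u v :=
  mem_chartPoints.2 ⟨hz, hP.pos z hz hu hv⟩

theorem ne_of_mem_chartPoints {z : ℂ} (hz : z ∈ chartPoints P u v) : z ≠ u ∧ z ≠ v := by
  have := (mem_chartPoints.1 hz).2
  constructor <;> rintro rfl <;> simp at this

theorem IsAnchored.orient_ne_zero (hP : IsAnchored P u v) {p q r : ℂ} (hp : p ∈ chartPoints P u v)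
    (hq : q ∈ chartPoints P u v) (hr : r ∈ chartPoints P u v) (hpq : p ≠ q) (hpr : p ≠ r)
    (hqr : q ≠ r) : orient p q r ≠ 0 :=
  hP.gp.orient_ne_zero (mem_chartPoints.1 hp).1 (mem_chartPoints.1 hq).1 (mem_chartPoints.1 hr).1
    hpq hpr hqr

theorem IsAnchored.absc_ne (hP : IsAnchored P u v) {p q : ℂ} (hp : p ∈ chartPoints P u v)
    (hq : q ∈ chartPoints P u v) (hpq : p ≠ q) : absc u v p ≠ absc u v q := by
  intro h
  have hp' := mem_chartPoints.1 hp
  have hq' := mem_chartPoints.1 hq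
  have h1 := (orient_right_neg_iff hp'.2 hq'.2).not.2 h.not_lt
  have h2 := (orient_right_neg_iff hq'.2 hp'.2).not.2 h.symm.not_lt
  rw [orient_swap_left] at h2
  exact hP.gp.orient_ne_zero hp'.1 hq'.1 hP.right_mem hpq (ne_of_mem_chartPoints hp).2
    (ne_of_mem_chartPoints hq).2 (by linarith)

/-- Adding a set `T` to a saturated set creates at most `#T / 2` new internal points. -/
theorem IsSaturated.two_mul_card_le (hP : IsAnchored P u v) (hB : IsSaturated P u v B)
    {T I : Finset ℂ} (hT : T ⊆ P) (hI : I ⊆ B ∪ T)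
    (hint : ∀ i ∈ I, i ∈ interior (convexHull ℝ ((B ∪ T : Finset ℂ) : Set ℂ)))
    (hnew : ∀ i ∈ I, i ∉ interiorPoints B B) : 2 * I.card ≤ (T \ B).card := by
  have h1 := hP.rel (B ∪ T) (Finset.union_subset hB.subset hT)
    (Finset.mem_union_left _ hB.left_mem) (Finset.mem_union_left _ hB.right_mem)
  have h2 : interiorPoints B B ∪ I ⊆ interiorPoints (B ∪ T) (B ∪ T) := by
    refine Finset.union_subset (fun z hz => ?_) fun z hz => mem_interiorPoints.2 ⟨hI hz, hint z hz⟩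
    rw [mem_interiorPoints] at hz ⊢
    exact ⟨Finset.mem_union_left _ hz.1,
      interior_convexHull_mono Finset.subset_union_left hz.2⟩
  have h3 := Finset.card_le_card h2
  rw [Finset.card_union_of_disjoint
    (Finset.disjoint_right.2 hnew)] at h3
  have h4 : (B ∪ T).card = B.card + (T \ B).card := by
    rw [← Finset.card_union_of_disjoint Finset.disjoint_sdiff, Finset.union_sdiff_self_eq_union]
  have h5 := hB.card_eq
  omega

/-- Two new internal points would need four added points. Most geometric claims below are proved by
exhibiting two such points after adding only three. -/
theorem IsSaturated.not_two_interior (hP : IsAnchored P u v) (hB : IsSaturated P u v B)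
    {T : Finset ℂ} (hT : T ⊆ P) (hc : T.card ≤ 3) {i j : ℂ} (hij : i ≠ j)
    (hi : i ∈ B ∪ T) (hj : j ∈ B ∪ T)
    (hi' : i ∉ interiorPoints B B) (hj' : j ∉ interiorPoints B B)
    (hii : i ∈ interior (convexHull ℝ ((B ∪ T : Finset ℂ) : Set ℂ)))
    (hjj : j ∈ interior (convexHull ℝ ((B ∪ T : Finset ℂ) : Set ℂ))) : False := by
  have := hB.two_mul_card_le hP hT (I := {i, j}) (by simp [Finset.insert_subset_iff, hi, hj])
    (by
      intro k hk
      rcases Finset.mem_insert.1 hk with rfl | hk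
      · exact hii
      · rwa [Finset.mem_singleton.1 hk]) (by simp [hi', hj'])
  rw [Finset.card_pair hij] at this
  have h2 := Finset.card_le_card (Finset.sdiff_subset (s := T) (t := B))
  omega

theorem IsSaturated.not_interior_insert (hP : IsAnchored P u v) (hB : IsSaturated P u v B)
    {t c : ℂ} (ht : t ∈ P) (hc : c ∈ B) (hc' : c ∉ interiorPoints B B) :
    c ∉ interior (convexHull ℝ ((B ∪ {t} : Finset ℂ) : Set ℂ)) := by
  intro h
  have := hB.two_mul_card_le hP (T := {t}) (I := {c}) (by simpa using ht) (by simp [hc])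
    (by simpa using h) (by simpa using hc')
  have h2 := Finset.card_le_card (Finset.sdiff_subset (s := {t}) (t := B))
  simp at this h2
  omega

/-- No vertex of a saturated set is covered by a segment from one of its points. -/
theorem IsSaturated.not_covers (hP : IsAnchored P u v) (hB : IsSaturated P u v B)
    {x y c : ℂ} (hx : x ∈ chartPoints P u v) (hy : y ∈ P) (hxy : x ∈ B ∨ y ∈ B) (hc : c ∈ B)
    (hc' : c ∉ interiorPoints B B) (hcc : c ∈ chartPoints P u v) : ¬ Covers u v x y c := by
  intro h
  rcases hxy with hxy | hxy
  · exact hB.not_interior_insert hP hy hc hc' (mem_interior_of_below (mem_chartPoints.1 hx).2 h.pos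
      (mem_chartPoints.1 hcc).2 h.lt_left h.lt_right h.below (by simp [hxy]) (by simp)
      (by simp [hB.right_mem]))
  · exact hB.not_interior_insert hP (mem_chartPoints.1 hx).1 hc hc'
      (mem_interior_of_below (mem_chartPoints.1 hx).2 h.pos
      (mem_chartPoints.1 hcc).2 h.lt_left h.lt_right h.below (by simp) (by simp [hxy])
      (by simp [hB.right_mem]))

variable {p q e : ℂ}

theorem Covers.mem_interior (hp : p ∈ chartPoints P u v) (he : e ∈ chartPoints P u v)
    (h : Covers u v p q e) {A : Set ℂ} (hpA : p ∈ A) (hqA : q ∈ A) (hvA : v ∈ A) :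
    e ∈ interior (convexHull ℝ A) :=
  mem_interior_of_below (mem_chartPoints.1 hp).2 h.pos (mem_chartPoints.1 he).2 h.lt_left
    h.lt_right h.below hpA hqA hvA

/-- The data of a segment `pq` covering a vertex `e` of the saturated set `B`. -/
structure IsCovering (P B : Finset ℂ) (u v p q e : ℂ) : Prop where
  left_mem : p ∈ chartPoints P u v
  right_mem : q ∈ chartPoints P u v
  mem : e ∈ chartPoints P u v
  vertex_mem : e ∈ B
  not_interior : e ∉ interiorPoints B B
  covers : Covers u v p q e

theorem IsCovering.ne (h : IsCovering P B u v p q e) : p ≠ q := by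
  rintro rfl
  exact lt_asymm h.covers.lt_left h.covers.lt_right

theorem IsCovering.left_notMem (hP : IsAnchored P u v) (hB : IsSaturated P u v B)
    (h : IsCovering P B u v p q e) : p ∉ B := fun hp =>
  hB.not_covers hP h.left_mem (mem_chartPoints.1 h.right_mem).1 (Or.inl hp) h.vertex_mem
    h.not_interior h.mem h.covers

theorem IsCovering.right_notMem (hP : IsAnchored P u v) (hB : IsSaturated P u v B)
    (h : IsCovering P B u v p q e) : q ∉ B := fun hq =>
  hB.not_covers hP h.left_mem (mem_chartPoints.1 h.right_mem).1 (Or.inr hq) h.vertex_mem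
    h.not_interior h.mem h.covers

theorem IsCovering.pair_subset (h : IsCovering P B u v p q e) : ({p, q} : Finset ℂ) ⊆ P := by
  simp [Finset.insert_subset_iff, (mem_chartPoints.1 h.left_mem).1,
    (mem_chartPoints.1 h.right_mem).1]

/-- Two added points allow only one new internal point, and `e` already is one. -/
theorem IsCovering.interiorPoints_eq (hP : IsAnchored P u v) (hB : IsSaturated P u v B)
    (h : IsCovering P B u v p q e) :
    interiorPoints (B ∪ {p, q}) (B ∪ {p, q}) = insert e (interiorPoints B B) ∧
      (B ∪ {p, q}).card = B.card + 2 := by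
  have hpq := h.ne
  have hc : (B ∪ {p, q}).card = B.card + 2 := by
    rw [Finset.card_union_of_disjoint, Finset.card_pair hpq]
    simp [h.left_notMem hP hB, h.right_notMem hP hB]
  refine ⟨?_, hc⟩
  symm
  apply Finset.eq_of_subset_of_card_le
  · intro z hz
    rw [Finset.mem_insert, mem_interiorPoints] at hz
    rw [mem_interiorPoints]
    rcases hz with rfl | hz
    · exact ⟨Finset.mem_union_left _ h.vertex_mem,
        h.covers.mem_interior h.left_mem h.mem (by simp) (by simp) (by simp [hB.right_mem])⟩
    · exact ⟨Finset.mem_union_left _ hz.1,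
        interior_convexHull_mono Finset.subset_union_left hz.2⟩
  · have h1 := hP.rel (B ∪ {p, q}) (Finset.union_subset hB.subset h.pair_subset)
      (Finset.mem_union_left _ hB.left_mem) (Finset.mem_union_left _ hB.right_mem)
    rw [Finset.card_insert_of_notMem h.not_interior]
    have := hB.card_eq
    omega

theorem IsCovering.isSaturated (hP : IsAnchored P u v) (hB : IsSaturated P u v B)
    (h : IsCovering P B u v p q e) : IsSaturated P u v (B ∪ {p, q}) := by
  obtain ⟨h1, h2⟩ := h.interiorPoints_eq hP hB
  refine ⟨Finset.union_subset hB.subset h.pair_subset,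
    Finset.mem_union_left _ hB.left_mem, Finset.mem_union_left _ hB.right_mem, ?_⟩
  rw [h1, h2, Finset.card_insert_of_notMem h.not_interior]
  have := hB.card_eq
  omega

theorem IsCovering.left_ne (hP : IsAnchored P u v) (hB : IsSaturated P u v B)
    (h : IsCovering P B u v p q e) : p ≠ e := fun h' => h.left_notMem hP hB (h' ▸ h.vertex_mem)

theorem IsCovering.right_ne (hP : IsAnchored P u v) (hB : IsSaturated P u v B)
    (h : IsCovering P B u v p q e) : q ≠ e := fun h' => h.right_notMem hP hB (h' ▸ h.vertex_mem)

theorem IsCovering.lt (h : IsCovering P B u v p q e) : absc u v p < absc u v q :=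
  h.covers.lt_left.trans h.covers.lt_right

/-- If a third point makes both an endpoint and `e` internal, it is a contradiction. -/
theorem IsCovering.not_interior_of_left (hP : IsAnchored P u v) (hB : IsSaturated P u v B)
    (h : IsCovering P B u v p q e) {z i : ℂ} (hz : z ∈ P) (hi : i = p ∨ i = q)
    (hii : i ∈ interior (convexHull ℝ ((B ∪ {z, p, q} : Finset ℂ) : Set ℂ))) : False := by
  have hiB : i ∉ B := by
    rcases hi with rfl | rfl
    exacts [h.left_notMem hP hB, h.right_notMem hP hB]
  refine hB.not_two_interior hP (T := {z, p, q}) ?_ Finset.card_le_three (i := i) (j := e) ?_ ?_ ?_ ?_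
    h.not_interior hii ?_
  · exact Finset.insert_subset hz h.pair_subset
  · rintro rfl
    exact hiB h.vertex_mem
  · rcases hi with rfl | rfl <;> simp
  · simp [h.vertex_mem]
  · exact fun h' => hiB (mem_interiorPoints.1 h').1
  · exact h.covers.mem_interior h.left_mem h.mem (by simp) (by simp) (by simp [hB.right_mem])

/-- If a point `z` above the line `pq` were to the left of `p`, then `p` would lie below the segment
`zq`, so adding `z`, `p`, `q` would make both `p` and `e` internal; the right side is symmetric. -/
theorem IsCovering.between_of_above (hP : IsAnchored P u v) (hB : IsSaturated P u v B)
    (h : IsCovering P B u v p q e) {z : ℂ} (hz : z ∈ chartPoints P u v)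
    (ha : 0 < orient p q z) : absc u v p < absc u v z ∧ absc u v z < absc u v q := by
  have hzp : z ≠ p := by rintro rfl; simp at ha
  have hzq : z ≠ q := by rintro rfl; simp at ha
  obtain ⟨hzP, hz0⟩ := mem_chartPoints.1 hz
  have hp0 := (mem_chartPoints.1 h.left_mem).2
  have hq0 := (mem_chartPoints.1 h.right_mem).2
  constructor
  · by_contra hlt
    have hlt : absc u v z < absc u v p :=
      lt_of_le_of_ne (not_lt.1 hlt) (hP.absc_ne hz h.left_mem hzp)
    refine h.not_interior_of_left hP hB hzP (Or.inl rfl)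
      (mem_interior_of_below hz0 hq0 hp0 hlt h.lt ?_ (by simp) (by simp)
        (by simp [hB.right_mem]))
    rw [← orient_rotate, orient_swap_left]; linarith
  · by_contra hlt
    have hlt : absc u v q < absc u v z :=
      lt_of_le_of_ne (not_lt.1 hlt) (hP.absc_ne hz h.right_mem hzq).symm
    refine h.not_interior_of_left hP hB hzP (Or.inr rfl)
      (mem_interior_of_below hp0 hz0 hq0 h.lt hlt ?_ (by simp) (by simp)
        (by simp [hB.right_mem]))
    rw [orient_swap_right]; linarith

/-- A point outside `B` below the segment would become internal together with `e`. -/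
theorem IsCovering.mem_of_below (hP : IsAnchored P u v) (hB : IsSaturated P u v B)
    (h : IsCovering P B u v p q e) {z : ℂ} (hz : z ∈ chartPoints P u v)
    (hb : orient p q z < 0) (h1 : absc u v p < absc u v z) (h2 : absc u v z < absc u v q) :
    z ∈ B := by
  by_contra hzB
  obtain ⟨hzP, hz0⟩ := mem_chartPoints.1 hz
  refine hB.not_two_interior hP (T := {z, p, q}) ?_ Finset.card_le_three (i := z) (j := e) ?_ ?_ ?_ ?_
    h.not_interior ?_ ?_
  · exact Finset.insert_subset hzP h.pair_subset
  · rintro rfl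
    exact hzB h.vertex_mem
  · simp
  · simp [h.vertex_mem]
  · exact fun h' => hzB (mem_interiorPoints.1 h').1
  · exact mem_interior_of_below (mem_chartPoints.1 h.left_mem).2 (mem_chartPoints.1 h.right_mem).2
      hz0 h1 h2 hb (by simp) (by simp) (by simp [hB.right_mem])
  · exact h.covers.mem_interior h.left_mem h.mem (by simp) (by simp) (by simp [hB.right_mem])

/-- If `b ∈ B` were above `pq`, then `e` would lie below `bq` or below `pb`, a segment with an end
in `B`, which saturation excludes. -/
theorem IsCovering.below_of_mem (hP : IsAnchored P u v) (hB : IsSaturated P u v B)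
    (h : IsCovering P B u v p q e) {b : ℂ} (hb : b ∈ B) (hb' : b ∈ chartPoints P u v) :
    orient p q b < 0 := by
  have hbp : b ≠ p := fun h' => h.left_notMem hP hB (h' ▸ hb)
  have hbq : b ≠ q := fun h' => h.right_notMem hP hB (h' ▸ hb)
  by_contra hneg
  have ha : 0 < orient p q b := lt_of_le_of_ne (not_lt.1 hneg)
    (hP.orient_ne_zero h.left_mem h.right_mem hb' h.ne hbp.symm hbq.symm).symm
  have hbe : b ≠ e := by
    rintro rfl
    exact absurd h.covers.below (not_lt.2 ha.le)
  obtain ⟨h1, h2⟩ := h.between_of_above hP hB hb' ha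
  have hb0 := (mem_chartPoints.1 hb').2
  have hp0 := (mem_chartPoints.1 h.left_mem).2
  have hq0 := (mem_chartPoints.1 h.right_mem).2
  have he0 := (mem_chartPoints.1 h.mem).2
  rcases lt_or_gt_of_ne (hP.absc_ne hb' h.mem hbe) with hlt | hlt
  · exact hB.not_covers hP hb' (mem_chartPoints.1 h.right_mem).1 (Or.inl hb) h.vertex_mem
      h.not_interior h.mem ⟨hq0, hlt, h.covers.lt_right,
        below_of_above_left hp0 hq0 hb0 he0 h.lt hlt h.covers.lt_right ha h.covers.below⟩
  · exact hB.not_covers hP h.left_mem (mem_chartPoints.1 hb').1 (Or.inr hb) h.vertex_mem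
      h.not_interior h.mem ⟨hb0, h.covers.lt_left, hlt,
        below_of_above_right hp0 hq0 hb0 he0 h.lt h.covers.lt_left hlt ha h.covers.below⟩

theorem IsCovering.below_anchor (h : IsCovering P B u v p q e) : orient p q v < 0 :=
  (orient_right_neg_iff (mem_chartPoints.1 h.left_mem).2 (mem_chartPoints.1 h.right_mem).2).2
    h.lt

end

end NCConfig

end

/-! ### Chains of pins and the gluing of two parts -/

noncomputable section

namespace NCConfig

/-- The points of `X` weakly to the left of the directed line through the pair `k`. -/
def upper (X : Finset ℂ) (k : ℂ × ℂ) : Finset ℂ := X.filter fun z => 0 ≤ orient k.1 k.2 z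

/-- The points of `X` strictly to the right of the directed line through the pair `k`. -/
def lower (X : Finset ℂ) (k : ℂ × ℂ) : Finset ℂ := X.filter fun z => orient k.1 k.2 z < 0

theorem mem_upper {X : Finset ℂ} {k : ℂ × ℂ} {z : ℂ} :
    z ∈ upper X k ↔ z ∈ X ∧ 0 ≤ orient k.1 k.2 z := by simp [upper]

theorem mem_lower {X : Finset ℂ} {k : ℂ × ℂ} {z : ℂ} :
    z ∈ lower X k ↔ z ∈ X ∧ orient k.1 k.2 z < 0 := by simp [lower]

theorem upper_union_lower (X : Finset ℂ) (k : ℂ × ℂ) : upper X k ∪ lower X k = X := by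
  ext z
  rw [Finset.mem_union, mem_upper, mem_lower, ← and_or_left]
  exact and_iff_left (le_or_gt _ _)

theorem disjoint_lower_upper (X : Finset ℂ) (k : ℂ × ℂ) : Disjoint (lower X k) (upper X k) := by
  rw [Finset.disjoint_left]
  intro z h1 h2
  exact absurd (mem_lower.1 h1).2 (not_lt.2 (mem_upper.1 h2).2)

theorem lower_subset (X : Finset ℂ) (k : ℂ × ℂ) : lower X k ⊆ X := Finset.filter_subset _ _

theorem upper_subset (X : Finset ℂ) (k : ℂ × ℂ) : upper X k ⊆ X := Finset.filter_subset _ _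

/-- The part of `X` above the pair `k` hangs off the vertex `k.1` of the saturated set `B`. -/
structure IsLink (P B : Finset ℂ) (u v : ℂ) (k : ℂ × ℂ) (X : Finset ℂ) : Prop where
  fst_mem : k.1 ∈ X
  fst_mem' : k.1 ∈ B
  snd_mem : k.2 ∈ X
  snd_mem' : k.2 ∈ B
  lt : absc u v k.1 < absc u v k.2
  not_interior : k.1 ∉ interiorPoints B B
  between : ∀ z ∈ upper X k, absc u v k.1 ≤ absc u v z ∧ absc u v z ≤ absc u v k.2
  eq_of_mem : ∀ z ∈ upper X k, z ∈ B → z = k.1 ∨ z = k.2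
  left : ∀ z ∈ lower X k, absc u v z < absc u v k.1 ∨ z ∈ B
  left_or_crosses : ∀ x ∈ lower X k, ∀ y ∈ upper X k, y ≠ k.1 → y ≠ k.2 →
    absc u v x < absc u v k.1 ∨ Crosses k.1 k.2 x y

/-- The set `X` is cut into parts by the successive pairs of the list. -/
def IsChain (P B : Finset ℂ) (u v : ℂ) : List (ℂ × ℂ) → Finset ℂ → Prop
  -- The last part must be nonempty for its partitions to be symmetric about its size plus one. A
  -- point of `B` guarantees this permanently, since points of `B` lie below every covering segment
  -- and so are never cut off.
  | [], X => X ⊆ chartPoints P u v ∧ ∃ x ∈ X, x ∈ B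
  | k :: K, X => X ⊆ chartPoints P u v ∧ IsLink P B u v k X ∧ IsChain P B u v K (lower X k)

section

variable {P B B' : Finset ℂ} {u v : ℂ}

theorem IsChain.subset {K : List (ℂ × ℂ)} {X : Finset ℂ} (h : IsChain P B u v K X) :
    X ⊆ chartPoints P u v := by
  cases K with
  | nil => exact h.1
  | cons k K => exact h.1

theorem IsChain.nonempty {K : List (ℂ × ℂ)} {X : Finset ℂ} (h : IsChain P B u v K X) :
    X.Nonempty := by
  cases K with
  | nil => exact h.2.imp fun x hx => hx.1
  | cons k K => exact ⟨_, h.2.1.fst_mem⟩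

theorem IsChain.mem {K : List (ℂ × ℂ)} {X : Finset ℂ} (h : IsChain P B u v K X) :
    ∀ k ∈ K, k.1 ∈ X ∧ k.2 ∈ X ∧ k.1 ∉ interiorPoints B B := by
  induction K generalizing X with
  | nil => simp
  | cons k K ih =>
    intro k' hk'
    rcases List.mem_cons.1 hk' with rfl | hk'
    · exact ⟨h.2.1.fst_mem, h.2.1.snd_mem, h.2.1.not_interior⟩
    · obtain ⟨h1, h2, h3⟩ := ih h.2.2 k' hk'
      exact ⟨lower_subset _ _ h1, lower_subset _ _ h2, h3⟩

/-- Used when a covering segment `pq` is split off: `X` shrinks to its points below `pq` and `B`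
grows to `B ∪ {p, q}`. The chain depends only on points of `B`, which all stay; what has to be
checked is that no first vertex of a pin has become internal. -/
theorem IsChain.mono {K : List (ℂ × ℂ)} {X X' : Finset ℂ} (h : IsChain P B u v K X)
    (hX : X' ⊆ X) (hXB : ∀ z ∈ X, z ∈ B → z ∈ X') (hBB : B ⊆ B') (hB' : ∀ z ∈ X', z ∈ B' → z ∈ B)
    (hK : ∀ k ∈ K, k.1 ∉ interiorPoints B' B') : IsChain P B' u v K X' := by
  induction K generalizing X X' with
  | nil =>
    obtain ⟨h1, x, h2, h3⟩ := h
    exact ⟨hX.trans h1, x, hXB x h2 h3, hBB h3⟩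
  | cons k K ih =>
    obtain ⟨h1, h2, h3⟩ := h
    have hl : lower X' k ⊆ lower X k := Finset.filter_subset_filter _ hX
    have hu : upper X' k ⊆ upper X k := Finset.filter_subset_filter _ hX
    refine ⟨hX.trans h1, ⟨hXB _ h2.fst_mem h2.fst_mem', hBB h2.fst_mem', hXB _ h2.snd_mem h2.snd_mem',
      hBB h2.snd_mem', h2.lt, hK k (by simp), fun z hz => h2.between z (hu hz),
      fun z hz hzB => h2.eq_of_mem z (hu hz) (hB' z (upper_subset _ _ hz) hzB),
      fun z hz => (h2.left z (hl hz)).imp_right fun h => hBB h,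
      fun x hx y hy => h2.left_or_crosses x (hl hx) y (hu hy)⟩, ?_⟩
    refine ih h3 hl (fun z hz hzB => ?_) (fun z hz => hB' z (lower_subset _ _ hz))
      fun k' hk' => hK k' (by simp [hk'])
    rw [mem_lower] at hz ⊢
    exact ⟨hXB z hz.1 hzB, hz.2⟩

end

/-- A chain `X` and a part `Z` pinned at `k`, which meet at the vertex `e` of `B`. -/
structure IsGlue (P B : Finset ℂ) (u v : ℂ) (X Z : Finset ℂ) (K : List (ℂ × ℂ)) (k : ℂ × ℂ)
    (e : ℂ) : Prop where
  chain : IsChain P B u v K X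
  subset : ∀ z ∈ Z, z ∈ chartPoints P u v ∨ z = v
  disj : Disjoint X Z
  fst_chart : k.1 ∈ chartPoints P u v
  fst_mem : k.1 ∈ Z
  fst_mem' : k.1 ∈ B
  snd_mem : k.2 ∈ Z
  snd_mem' : k.2 ∈ B
  ne : k.1 ≠ k.2
  nonneg : ∀ z ∈ Z, 0 ≤ orient k.1 k.2 z
  eq_of_mem : ∀ z ∈ Z, z ∈ B → z = k.1 ∨ z = k.2
  vertex_chart : e ∈ chartPoints P u v
  vertex_mem : e ∈ B
  not_interior : e ∉ interiorPoints B B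
  -- The next splitting makes `e` internal, so no pin may hang off `e`.
  vertex_ne : ∀ k' ∈ K, k'.1 ≠ e
  left : ∀ z ∈ X, absc u v z ≤ absc u v e ∨ z ∈ B
  right : ∀ z ∈ Z, z = k.1 ∨ z = k.2 ∨ absc u v e < absc u v z
  fst_le : absc u v k.1 ≤ absc u v e
  -- The lines from `k.1` to other points of `Z` pass weakly below `e`; so the block pinned at `k`
  -- cannot reach above a segment over `e` without crossing it.
  above : ∀ z ∈ Z, z ≠ k.1 → z ≠ k.2 → 0 ≤ orient k.1 z e
  -- This makes every admissible partition of `X` compatible with every partition of `Z`, although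
  -- the hulls of `X` and `Z` themselves may overlap.
  sep : ∀ π ∈ pinnedFamilies X K, ∀ E ∈ π,
    Disjoint (convexHull ℝ (E : Set ℂ)) (convexHull ℝ (Z : Set ℂ))

section

variable {P B : Finset ℂ} {u v : ℂ} {X Z : Finset ℂ} {K : List (ℂ × ℂ)} {k : ℂ × ℂ} {e p q : ℂ}

theorem IsGlue.mem_chart (hG : IsGlue P B u v X Z K k e) (hB : IsSaturated P u v B) {z : ℂ}
    (hz : z ∈ Z) (h1 : z ≠ k.1) (h2 : z ≠ k.2) : z ∈ chartPoints P u v := by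
  rcases hG.subset z hz with h | rfl
  · exact h
  · exact ((hG.eq_of_mem z hz hB.right_mem).elim h1 h2).elim

theorem IsGlue.isCovering (hG : IsGlue P B u v X Z K k e) (hp : p ∈ X) (hq : q ∈ Z)
    (h : Covers u v p q e) : IsCovering P B u v p q e := by
  refine ⟨hG.chain.subset hp, ?_, hG.vertex_chart, hG.vertex_mem, hG.not_interior, h⟩
  rcases hG.subset q hq with h' | rfl
  · exact h'
  · simpa using h.pos

theorem IsGlue.fst_below (hP : IsAnchored P u v) (hB : IsSaturated P u v B)
    (hG : IsGlue P B u v X Z K k e) (h : IsCovering P B u v p q e) : orient p q k.1 < 0 :=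
  h.below_of_mem hP hB hG.fst_mem' hG.fst_chart

theorem IsGlue.snd_below (hP : IsAnchored P u v) (hB : IsSaturated P u v B)
    (hG : IsGlue P B u v X Z K k e) (h : IsCovering P B u v p q e) : orient p q k.2 < 0 := by
  rcases hG.subset _ hG.snd_mem with h' | h'
  · exact h.below_of_mem hP hB hG.snd_mem' h'
  · rw [h']
    exact h.below_anchor

/-- Points of `Z` weakly above a covering segment lie in the chart, beyond `e`. -/
theorem IsGlue.of_above (hP : IsAnchored P u v) (hB : IsSaturated P u v B)
    (hG : IsGlue P B u v X Z K k e) (h : IsCovering P B u v p q e) {z : ℂ} (hz : z ∈ Z)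
    (ha : 0 ≤ orient p q z) : z ∈ chartPoints P u v ∧ absc u v e < absc u v z ∧ z ≠ k.1 ∧ z ≠ k.2 := by
  have h1 : z ≠ k.1 := by
    rintro rfl
    exact absurd (hG.fst_below hP hB h) (not_lt.2 ha)
  have h2 : z ≠ k.2 := by
    rintro rfl
    exact absurd (hG.snd_below hP hB h) (not_lt.2 ha)
  exact ⟨hG.mem_chart hB hz h1 h2, ((hG.right z hz).resolve_left h1).resolve_left h2, h1, h2⟩

/-- The point `y` lies over the interior of the segment `pq`. If `x` is also between `p` and `q`,
the segments cross. If `x` is to the right of `q`, it is beyond `e` and hence in `B`; if there were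
no crossing, the segment `yx` would cover `q`, a noninternal point of the saturated set `B ∪ {p,
q}`. -/
theorem IsGlue.left_or_crosses (hP : IsAnchored P u v) (hB : IsSaturated P u v B)
    (hG : IsGlue P B u v X Z K k e) (h : IsCovering P B u v p q e) {x y : ℂ} (hx : x ∈ X)
    (hbx : orient p q x < 0) (hy : y ∈ chartPoints P u v) (hay : 0 < orient p q y) :
    absc u v x < absc u v p ∨ Crosses p q x y := by
  obtain ⟨h1, h2⟩ := h.between_of_above hP hB hy hay
  have hx' := hG.chain.subset hx
  have hx0 := (mem_chartPoints.1 hx').2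
  have hy0 := (mem_chartPoints.1 hy).2
  have hp0 := (mem_chartPoints.1 h.left_mem).2
  have hq0 := (mem_chartPoints.1 h.right_mem).2
  have hxp : x ≠ p := by rintro rfl; simp at hbx
  have hxq : x ≠ q := by rintro rfl; simp at hbx
  have hyq : y ≠ q := by rintro rfl; simp at hay
  have hxy : x ≠ y := by rintro rfl; exact lt_asymm hbx hay
  rcases lt_or_gt_of_ne (hP.absc_ne hx' h.left_mem hxp) with h3 | h3
  · exact Or.inl h3
  right
  rcases lt_or_gt_of_ne (hP.absc_ne hx' h.right_mem hxq) with h4 | h4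
  · exact crosses_of_between hp0 hq0 hx0 hy0 h3 h4 h1 h2 (hP.absc_ne hx' hy hxy) hbx hay
  · have hxB : x ∈ B := (hG.left x hx).resolve_left
      (not_le.2 (h.covers.lt_right.trans h4))
    have hq' : q ∉ interiorPoints (B ∪ {p, q}) (B ∪ {p, q}) := by
      rw [(h.interiorPoints_eq hP hB).1, Finset.mem_insert, mem_interiorPoints]
      rintro (h' | h')
      exacts [h.right_ne hP hB h', h.right_notMem hP hB h'.1]
    refine crosses_of_right hp0 hq0 hx0 hy0 h1 h2 h4 hbx hay ?_
    by_contra hneg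
    refine (h.isSaturated hP hB).not_covers hP hy (mem_chartPoints.1 hx').1
      (Or.inr (Finset.mem_union_left _ hxB)) (c := q) (by simp) hq' h.right_mem
      ⟨hx0, h2, h4, ?_⟩
    exact lt_of_le_of_ne (not_lt.1 hneg) (hP.orient_ne_zero hy hx' h.right_mem hxy.symm hyq hxq)

/-- Without a crossing, `x` is to the left of `p` and the segment `xy` passes over `p`, hence also
over `e`; adding `x`, `y`, `p` would make both `p` and `e` internal. -/
theorem IsGlue.not_mixed (hP : IsAnchored P u v) (hB : IsSaturated P u v B)
    (hG : IsGlue P B u v X Z K k e) (h : IsCovering P B u v p q e) {Y : Finset ℂ}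
    {π : Finset (Finset ℂ)} (hπ : IsNCFamily Y π) {D E : Finset ℂ} (hD : D ∈ π) (hE : E ∈ π)
    (hDE : D ≠ E) (hpD : p ∈ D) (hqD : q ∈ D) {x y : ℂ} (hxE : x ∈ E) (hyE : y ∈ E) (hx : x ∈ X)
    (hy : y ∈ Z) (hbx : orient p q x < 0) (hay : 0 < orient p q y) : False := by
  obtain ⟨hy', hey, -, -⟩ := hG.of_above hP hB h hy hay.le
  have hnc := hπ.not_crosses hD hE hDE hpD hqD hxE hyE
  rcases hG.left_or_crosses hP hB h hx hbx hy' hay with h1 | h1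
  swap
  · exact hnc h1
  obtain ⟨h2, h3⟩ := h.between_of_above hP hB hy' hay
  have hx' := hG.chain.subset hx
  have hx0 := (mem_chartPoints.1 hx').2
  have hy0 := (mem_chartPoints.1 hy').2
  have hp0 := (mem_chartPoints.1 h.left_mem).2
  have hq0 := (mem_chartPoints.1 h.right_mem).2
  have he0 := (mem_chartPoints.1 h.mem).2
  have hxp : x ≠ p := by rintro rfl; simp at hbx
  have hyp : y ≠ p := by rintro rfl; simp at hay
  have hxy : x ≠ y := by rintro rfl; exact lt_asymm hbx hay
  rcases lt_or_gt_of_ne (hP.orient_ne_zero hx' hy' h.left_mem hxy hxp hyp) with h4 | h4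
  swap
  · exact hnc (crosses_of_left hp0 hq0 hx0 hy0 h1 h2 h3 hbx hay h4)
  have h5 := below_of_line_above hp0 hq0 hx0 hy0 he0 h1 h.covers.lt_left hey h.lt h4 hay
    h.covers.below
  have hpB := h.left_notMem hP hB
  refine hB.not_two_interior hP (T := {x, y, p}) ?_ Finset.card_le_three (h.left_ne hP hB)
    (by simp) (by simp [h.vertex_mem]) (fun h' => hpB (mem_interiorPoints.1 h').1) h.not_interior
    (mem_interior_of_below hx0 hy0 hp0 h1 h2 h4 (by simp) (by simp) (by simp [hB.right_mem]))
    (mem_interior_of_below hx0 hy0 he0 (h1.trans h.covers.lt_left) hey h5 (by simp) (by simp)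
      (by simp [hB.right_mem]))
  simp [Finset.insert_subset_iff, (mem_chartPoints.1 hx').1, (mem_chartPoints.1 hy').1,
    (mem_chartPoints.1 h.left_mem).1]

theorem trace_pinned {Y : Finset ℂ} {π : Finset (Finset ℂ)} {k : ℂ × ℂ} (h : Pinned π k)
    (h1 : k.1 ∈ Y) (h2 : k.2 ∈ Y) : Pinned (trace π Y) k := by
  obtain ⟨E, hE, hE1, hE2, hE3⟩ := h
  refine ⟨E ∩ Y, mem_trace.2 ⟨⟨k.1, by simp [hE1, h1]⟩, E, hE, rfl⟩, by simp [hE1, h1],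
    by simp [hE2, h2], fun z hz => hE3 z (Finset.mem_of_mem_inter_left hz)⟩

theorem trace_mem_pinnedFamilies {X Y : Finset ℂ} {π : Finset (Finset ℂ)} (hπ : IsNCFamily X π)
    (hYX : Y ⊆ X) {K : List (ℂ × ℂ)} (hK : ∀ k ∈ K, Pinned π k)
    (hKY : ∀ k ∈ K, k.1 ∈ Y ∧ k.2 ∈ Y) : trace π Y ∈ pinnedFamilies Y K :=
  mem_pinnedFamilies.2 ⟨hπ.trace hYX, fun k hk => trace_pinned (hK k hk) (hKY k hk).1 (hKY k hk).2⟩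

theorem lower_union_upper (X Z : Finset ℂ) (k : ℂ × ℂ) :
    lower (X ∪ upper Z k) k = lower X k := by
  ext z
  simp only [mem_lower, Finset.mem_union, mem_upper]
  constructor
  · rintro ⟨h1 | h1, h2⟩
    · exact ⟨h1, h2⟩
    · exact absurd h2 (not_lt.2 h1.2)
  · rintro ⟨h1, h2⟩
    exact ⟨Or.inl h1, h2⟩

/-- Splitting off the part of the configuration above a segment that covers `e`. -/
theorem IsGlue.step (hP : IsAnchored P u v) (hB : IsSaturated P u v B)
    (hG : IsGlue P B u v X Z K k e) (hp : p ∈ X) (hq : q ∈ Z) (hc : Covers u v p q e) :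
    IsGlue P (B ∪ {p, q}) u v (X ∪ upper Z (p, q)) (lower Z (p, q)) ((p, q) :: K) k q := by
  have h := hG.isCovering hp hq hc
  have hB' := h.isSaturated hP hB
  obtain ⟨hint, -⟩ := h.interiorPoints_eq hP hB
  have hp0 := (mem_chartPoints.1 h.left_mem).2
  have hq0 := (mem_chartPoints.1 h.right_mem).2
  have he0 := (mem_chartPoints.1 h.mem).2
  have hpB := h.left_notMem hP hB
  have hqB := h.right_notMem hP hB
  have hqX : q ∉ X := fun h' => Finset.disjoint_left.1 hG.disj h' hq
  have hpZ : p ∉ Z := fun h' => Finset.disjoint_left.1 hG.disj hp h'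
  have hqint : q ∉ interiorPoints (B ∪ {p, q}) (B ∪ {p, q}) := by
    rw [hint, Finset.mem_insert, mem_interiorPoints]
    rintro (h' | h')
    exacts [h.right_ne hP hB h', hqB h'.1]
  have hpint : p ∉ interiorPoints (B ∪ {p, q}) (B ∪ {p, q}) := by
    rw [hint, Finset.mem_insert, mem_interiorPoints]
    rintro (h' | h')
    exacts [h.left_ne hP hB h', hpB h'.1]
  have hBlow : ∀ z ∈ X, z ∈ B → orient p q z < 0 := fun z hz hzB =>
    h.below_of_mem hP hB hzB (hG.chain.subset hz)
  have hup : ∀ z ∈ X ∪ upper Z (p, q), 0 ≤ orient p q z → z ∈ chartPoints P u v ∧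
      absc u v p ≤ absc u v z ∧ absc u v z ≤ absc u v q ∧
        (z ∈ B ∪ {p, q} → z = p ∨ z = q) ∧ (z ≠ p → z ≠ q → 0 < orient p q z) := by
    intro z hz ha
    have hz' : z ∈ chartPoints P u v := by
      rcases Finset.mem_union.1 hz with hz | hz
      · exact hG.chain.subset hz
      · exact (hG.of_above hP hB h (upper_subset _ _ hz) ha).1
    have hpos : z ≠ p → z ≠ q → 0 < orient p q z := fun h1 h2 => lt_of_le_of_ne ha
      (hP.orient_ne_zero h.left_mem h.right_mem hz' h.ne h1.symm h2.symm).symm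
    refine ⟨hz', ?_, ?_, fun hzB => ?_, hpos⟩
    · by_cases h1 : z = p
      · rw [h1]
      by_cases h2 : z = q
      · rw [h2]
        exact h.lt.le
      exact (h.between_of_above hP hB hz' (hpos h1 h2)).1.le
    · by_cases h1 : z = p
      · rw [h1]
        exact h.lt.le
      by_cases h2 : z = q
      · rw [h2]
      exact (h.between_of_above hP hB hz' (hpos h1 h2)).2.le
    · rcases Finset.mem_union.1 hzB with hzB | hzB
      · exact absurd (h.below_of_mem hP hB hzB hz') (not_lt.2 ha)
      · simpa using hzB
  have hX1 : ∀ z ∈ lower X (p, q), z ∈ X ∧ orient p q z < 0 := fun z hz => mem_lower.1 hz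
  have hX1B : ∀ z ∈ lower X (p, q), z ∈ B ∪ {p, q} → z ∈ B := by
    intro z hz hzB
    rcases Finset.mem_union.1 hzB with hzB | hzB
    · exact hzB
    · have := (hX1 z hz).2
      rcases Finset.mem_insert.1 hzB with rfl | hzB
      · simp at this
      · rw [Finset.mem_singleton.1 hzB] at this
        simp at this
  refine
    { chain := ⟨?_, ⟨?_, ?_, ?_, ?_, h.lt, hpint, ?_, ?_, ?_, ?_⟩, ?_⟩
      subset := fun z hz => hG.subset z (lower_subset _ _ hz)
      disj := ?_
      fst_chart := hG.fst_chart
      fst_mem := mem_lower.2 ⟨hG.fst_mem, hG.fst_below hP hB h⟩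
      fst_mem' := Finset.mem_union_left _ hG.fst_mem'
      snd_mem := mem_lower.2 ⟨hG.snd_mem, hG.snd_below hP hB h⟩
      snd_mem' := Finset.mem_union_left _ hG.snd_mem'
      ne := hG.ne
      nonneg := fun z hz => hG.nonneg z (lower_subset _ _ hz)
      eq_of_mem := ?_
      vertex_chart := h.right_mem
      vertex_mem := by simp
      not_interior := hqint
      vertex_ne := ?_
      left := ?_
      right := ?_
      fst_le := hG.fst_le.trans h.covers.lt_right.le
      above := ?_
      sep := ?_ }
  · intro z hz
    rcases Finset.mem_union.1 hz with hz' | hz'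
    · exact hG.chain.subset hz'
    · exact (hup z hz (mem_upper.1 hz').2).1
  · exact Finset.mem_union_left _ hp
  · simp
  · exact Finset.mem_union_right _ (mem_upper.2 ⟨hq, by simp⟩)
  · simp
  · intro z hz
    have := hup z (mem_upper.1 hz).1 (mem_upper.1 hz).2
    exact ⟨this.2.1, this.2.2.1⟩
  · intro z hz
    exact (hup z (mem_upper.1 hz).1 (mem_upper.1 hz).2).2.2.2.1
  · intro z hz
    rw [lower_union_upper] at hz
    obtain ⟨hzX, hzb⟩ := hX1 z hz
    have hz' := hG.chain.subset hzX
    rcases hG.left z hzX with h1 | h1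
    · have hzp : z ≠ p := by rintro rfl; simp at hzb
      rcases lt_or_gt_of_ne (hP.absc_ne hz' h.left_mem hzp) with h2 | h2
      · exact Or.inl h2
      · exact Or.inr (Finset.mem_union_left _ (h.mem_of_below hP hB hz' hzb h2
          (h1.trans_lt h.covers.lt_right)))
    · exact Or.inr (Finset.mem_union_left _ h1)
  · intro x hx y hy hyp hyq
    rw [lower_union_upper] at hx
    obtain ⟨hy1, hy2⟩ := mem_upper.1 hy
    have := hup y hy1 hy2
    exact hG.left_or_crosses hP hB h (hX1 x hx).1 (hX1 x hx).2 this.1 (this.2.2.2.2 hyp hyq)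
  · rw [lower_union_upper]
    refine hG.chain.mono (lower_subset _ _) (fun z hz hzB => mem_lower.2 ⟨hz, hBlow z hz hzB⟩)
      Finset.subset_union_left hX1B fun k' hk' => ?_
    rw [hint, Finset.mem_insert]
    rintro (h' | h')
    exacts [hG.vertex_ne k' hk' h', (hG.chain.mem k' hk').2.2 h']
  · rw [Finset.disjoint_union_left]
    exact ⟨hG.disj.mono_right (lower_subset _ _), (disjoint_lower_upper _ _).symm⟩
  · intro z hz hzB
    obtain ⟨hzZ, hzb⟩ := mem_lower.1 hz
    rcases Finset.mem_union.1 hzB with hzB | hzB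
    · exact hG.eq_of_mem z hzZ hzB
    · rcases Finset.mem_insert.1 hzB with rfl | hzB
      · exact absurd hzZ hpZ
      · rw [Finset.mem_singleton.1 hzB] at hzb
        simp at hzb
  · intro k' hk'
    rcases List.mem_cons.1 hk' with rfl | hk'
    · exact h.ne
    · intro h'
      exact hqX (h' ▸ (hG.chain.mem k' hk').1)
  · intro z hz
    rcases Finset.mem_union.1 hz with hz' | hz'
    · exact (hG.left z hz').imp (fun h' => h'.trans h.covers.lt_right.le)
        fun h' => Finset.mem_union_left _ h'
    · exact Or.inl (hup z hz (mem_upper.1 hz').2).2.2.1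
  · intro z hz
    obtain ⟨hzZ, hzb⟩ := mem_lower.1 hz
    by_cases h1 : z = k.1
    · exact Or.inl h1
    by_cases h2 : z = k.2
    · exact Or.inr (Or.inl h2)
    right; right
    have hz' := hG.mem_chart hB hzZ h1 h2
    have h3 := ((hG.right z hzZ).resolve_left h1).resolve_left h2
    have hzq : z ≠ q := by rintro rfl; simp at hzb
    refine lt_of_le_of_ne (not_lt.1 fun h4 => ?_) (hP.absc_ne hz' h.right_mem hzq).symm
    exact (hG.eq_of_mem z hzZ (h.mem_of_below hP hB hz' hzb (h.covers.lt_left.trans h3) h4)).elim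
      h1 h2
  · intro z hz h1 h2
    obtain ⟨hzZ, hzb⟩ := mem_lower.1 hz
    have hz' := hG.mem_chart hB hzZ h1 h2
    have h3 := ((hG.right z hzZ).resolve_left h1).resolve_left h2
    have hzq : z ≠ q := by rintro rfl; simp at hzb
    have h5 : absc u v q < absc u v z := by
      refine lt_of_le_of_ne (not_lt.1 fun h4 => ?_) (hP.absc_ne hz' h.right_mem hzq).symm
      exact (hG.eq_of_mem z hzZ (h.mem_of_below hP hB hz' hzb (h.covers.lt_left.trans h3) h4)).elim
        h1 h2
    exact (above_of_line_below hp0 hq0 (mem_chartPoints.1 hG.fst_chart).2 (mem_chartPoints.1 hz').2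
      he0 h.covers.lt_left h.covers.lt_right h5 hG.fst_le (hG.above z hzZ h1 h2) h.covers.below
      hzb).le
  · intro π hπ E hE
    rw [mem_pinnedFamilies] at hπ
    obtain ⟨hπ, hpin⟩ := hπ
    -- A block inside `X` is separated from `Z` already, by the old condition applied to the trace
    -- on `X`. A block weakly above `pq` is separated from the rest of `Z` by that line. Any other
    -- block joins a point of `X` below `pq` to a point of `Z` above it, which `not_mixed` excludes.
    by_cases h1 : E ⊆ X
    · have htr := trace_mem_pinnedFamilies hπ (Finset.subset_union_left (s₂ := upper Z (p, q)))
        (fun k' hk' => hpin k' (List.mem_cons_of_mem _ hk'))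
        fun k' hk' => ⟨(hG.chain.mem k' hk').1, (hG.chain.mem k' hk').2.1⟩
      have hEt : E ∈ trace π X :=
        mem_trace.2 ⟨hπ.nonempty E hE, E, hE, Finset.inter_eq_left.2 h1⟩
      exact (hG.sep _ htr E hEt).mono_right (convexHull_mono (by exact_mod_cast lower_subset _ _))
    by_cases h2 : ∀ z ∈ E, 0 ≤ orient p q z
    · exact disjoint_convexHull_of_orient (p := p) (q := q) (fun z hz => h2 z (by simpa using hz))
        fun z hz => (mem_lower.1 (by simpa using hz)).2
    exfalso
    push Not at h2
    obtain ⟨x, hxE, hbx⟩ := h2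
    obtain ⟨y, hyE, hyX⟩ := Finset.not_subset.1 h1
    obtain ⟨D, hD, hpD, hqD, hD'⟩ := hpin (p, q) (by simp)
    have hDE : D ≠ E := by
      rintro rfl
      exact absurd hbx (not_lt.2 (hD' x hxE))
    have hxX : x ∈ X := by
      rcases Finset.mem_union.1 (hπ.subset E hE hxE) with h' | h'
      · exact h'
      · exact absurd hbx (not_lt.2 (mem_upper.1 h').2)
    have hyZ := (Finset.mem_union.1 (hπ.subset E hE hyE)).resolve_left hyX
    rw [mem_upper] at hyZ
    have hyq : y ≠ q := by
      rintro rfl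
      exact hDE (hπ.eq_of_mem hD hE hqD hyE)
    have hyp : y ≠ p := by
      rintro rfl
      exact hyX hp
    have hy := (hup y (hπ.subset E hE hyE) hyZ.2).2.2.2.2 hyp hyq
    exact hG.not_mixed hP hB h hπ hD hE hDE hpD hqD hxE hyE hxX hyZ.1 hbx hy

end

end NCConfig

end

/-! ### Splitting at the lowest connection -/

noncomputable section

namespace NCConfig

open Classical in
/-- The pinned noncrossing partitions of `X ∪ Z` in which all connections between `X` and `Z`
cover the point `e`. -/
def gluedFamilies (u v : ℂ) (X Z : Finset ℂ) (K : List (ℂ × ℂ)) (k : ℂ × ℂ) (e : ℂ) :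
    Finset (Finset (Finset ℂ)) :=
  (pinnedFamilies (X ∪ Z) (k :: K)).filter fun π =>
    ∀ E ∈ π, ∀ x ∈ E, x ∈ X → ∀ y ∈ E, y ∈ Z → Covers u v x y e

theorem mem_gluedFamilies {u v : ℂ} {X Z : Finset ℂ} {K : List (ℂ × ℂ)} {k : ℂ × ℂ} {e : ℂ}
    {π : Finset (Finset ℂ)} : π ∈ gluedFamilies u v X Z K k e ↔ IsNCFamily (X ∪ Z) π ∧
      (∀ k' ∈ k :: K, Pinned π k') ∧
        ∀ E ∈ π, ∀ x ∈ E, x ∈ X → ∀ y ∈ E, y ∈ Z → Covers u v x y e := by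
  simp only [gluedFamilies, Finset.mem_filter, mem_pinnedFamilies, and_assoc]

/-- The glued families after splitting off the part above the segment `pq`. -/
def splitFamilies (u v : ℂ) (X Z : Finset ℂ) (K : List (ℂ × ℂ)) (k x : ℂ × ℂ) :
    Finset (Finset (Finset ℂ)) :=
  gluedFamilies u v (X ∪ upper Z x) (lower Z x) (x :: K) k x.2

theorem union_upper_union_lower (X Z : Finset ℂ) (x : ℂ × ℂ) :
    X ∪ upper Z x ∪ lower Z x = X ∪ Z := by
  rw [Finset.union_assoc, upper_union_lower]

section

variable {P B : Finset ℂ} {u v : ℂ} {X Z : Finset ℂ} {K : List (ℂ × ℂ)} {k : ℂ × ℂ} {e p q : ℂ}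
  {π : Finset (Finset ℂ)}

theorem mem_splitFamilies : π ∈ splitFamilies u v X Z K k (p, q) ↔ IsNCFamily (X ∪ Z) π ∧
    (∀ k' ∈ k :: K, Pinned π k') ∧ Pinned π (p, q) ∧
      ∀ E ∈ π, ∀ x ∈ E, (x ∈ X ∨ x ∈ Z ∧ 0 ≤ orient p q x) → ∀ y ∈ E, y ∈ Z →
        orient p q y < 0 → Covers u v x y q := by
  rw [splitFamilies, mem_gluedFamilies, union_upper_union_lower]
  simp only [List.forall_mem_cons, Finset.mem_union, mem_upper, mem_lower, and_imp]
  tauto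

/-- A connection between a point weakly above a covering segment and a point of `Z` weakly above
it. -/
theorem IsGlue.covers_of_above (hP : IsAnchored P u v) (hB : IsSaturated P u v B)
    (hG : IsGlue P B u v X Z K k e) (h : IsCovering P B u v p q e) {x y : ℂ} (hx : x ∈ X)
    (hy : y ∈ Z) (hax : 0 ≤ orient p q x) (hay : 0 ≤ orient p q y) : Covers u v x y e := by
  obtain ⟨hy', hey, -, -⟩ := hG.of_above hP hB h hy hay
  have hx' := hG.chain.subset hx
  have hxB : x ∉ B := fun h' => absurd (h.below_of_mem hP hB h' hx') (not_lt.2 hax)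
  have hxe : absc u v x < absc u v e := lt_of_le_of_ne ((hG.left x hx).resolve_right hxB)
    (hP.absc_ne hx' h.mem fun h' => hxB (h' ▸ h.vertex_mem))
  exact ⟨(mem_chartPoints.1 hy').2, hxe, hey, below_of_ends_above (mem_chartPoints.1 h.left_mem).2
    (mem_chartPoints.1 h.right_mem).2 (mem_chartPoints.1 hx').2 (mem_chartPoints.1 hy').2
    (mem_chartPoints.1 h.mem).2 h.lt hxe hey hax hay h.covers.below⟩

/-- A connection with both ends weakly above `pq` passes over `e` because `pq` does. One that starts
weakly above `pq` and ends below it passes over `q`, and therefore over `e`. It cannot start below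
`pq`: if it also ended below, it could not pass over `q`, and the remaining case is `not_mixed`. -/
theorem IsGlue.splitFamilies_subset (hP : IsAnchored P u v) (hB : IsSaturated P u v B)
    (hG : IsGlue P B u v X Z K k e) (hp : p ∈ X) (hq : q ∈ Z) (hc : Covers u v p q e) :
    splitFamilies u v X Z K k (p, q) ⊆ gluedFamilies u v X Z K k e := by
  intro π hπ
  have h := hG.isCovering hp hq hc
  rw [mem_splitFamilies] at hπ
  obtain ⟨hπ, hpin, ⟨D, hD, hpD, hqD, hDa⟩, hcov⟩ := hπ
  simp only at hpD hqD hDa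
  refine mem_gluedFamilies.2 ⟨hπ, hpin, fun E hE x hxE hx y hyE hy => ?_⟩
  by_cases hax : 0 ≤ orient p q x
  · by_cases hay : 0 ≤ orient p q y
    · exact hG.covers_of_above hP hB h hx hy hax hay
    · push Not at hay
      obtain ⟨hy0, hxq, hqy, hbq⟩ := hcov E hE x hxE (Or.inl hx) y hyE hy hay
      have hx' := hG.chain.subset hx
      have hxB : x ∉ B := fun h' => absurd (h.below_of_mem hP hB h' hx') (not_lt.2 hax)
      have hxe : absc u v x < absc u v e := lt_of_le_of_ne ((hG.left x hx).resolve_right hxB)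
        (hP.absc_ne hx' h.mem fun h' => hxB (h' ▸ h.vertex_mem))
      exact ⟨hy0, hxe, h.covers.lt_right.trans hqy,
        below_of_left_above (mem_chartPoints.1 h.left_mem).2 (mem_chartPoints.1 h.right_mem).2
          (mem_chartPoints.1 hx').2 hy0 (mem_chartPoints.1 h.mem).2 h.lt hxe h.covers.lt_right hqy
          hax hbq h.covers.below⟩
  · push Not at hax
    exfalso
    have hDE : D ≠ E := by
      rintro rfl
      exact absurd hax (not_lt.2 (hDa x hxE))
    rcases lt_or_ge (orient p q y) 0 with hay | hay
    · obtain ⟨hy0, hxq, hqy, hbq⟩ := hcov E hE x hxE (Or.inl hx) y hyE hy hay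
      exact lt_asymm hay (above_of_left_below (mem_chartPoints.1 h.left_mem).2
        (mem_chartPoints.1 h.right_mem).2 (mem_chartPoints.1 (hG.chain.subset hx)).2 hy0 h.lt hxq
        hqy hax hbq)
    · have hyp : y ≠ p := by
        rintro rfl
        exact hDE (hπ.eq_of_mem hD hE hpD hyE)
      have hyq : y ≠ q := by
        rintro rfl
        exact hDE (hπ.eq_of_mem hD hE hqD hyE)
      have hy' := (hG.of_above hP hB h hy hay).1
      exact hG.not_mixed hP hB h hπ hD hE hDE hpD hqD hxE hyE hx hy hax (lt_of_le_of_ne hay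
        (hP.orient_ne_zero h.left_mem h.right_mem hy' h.ne hyp.symm hyq.symm).symm)

/-- Two covering pairs at which the same partition splits are equal. -/
theorem IsGlue.split_unique (hP : IsAnchored P u v) (hB : IsSaturated P u v B)
    (hG : IsGlue P B u v X Z K k e) {p' q' : ℂ} (hp : p ∈ X) (hq : q ∈ Z)
    (hc : Covers u v p q e) (hp' : p' ∈ X) (hq' : q' ∈ Z) (hc' : Covers u v p' q' e)
    (hπ : π ∈ splitFamilies u v X Z K k (p, q)) (hπ' : π ∈ splitFamilies u v X Z K k (p', q'))
    (hle : lineHeight u v p' q' (absc u v e) ≤ lineHeight u v p q (absc u v e)) :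
    p' = p ∧ q' = q := by
  have h := hG.isCovering hp hq hc
  have h' := hG.isCovering hp' hq' hc'
  rw [mem_splitFamilies] at hπ hπ'
  obtain ⟨hπ, -, ⟨D, hD, hpD, hqD, hDa⟩, hcov⟩ := hπ
  obtain ⟨-, -, ⟨D', hD', hpD', hqD', hDa'⟩, hcov'⟩ := hπ'
  simp only at hpD hqD hDa hpD' hqD' hDa'
  have hp0 := (mem_chartPoints.1 h.left_mem).2
  have hq0 := (mem_chartPoints.1 h.right_mem).2
  have hp0' := (mem_chartPoints.1 h'.left_mem).2
  have hq0' := (mem_chartPoints.1 h'.right_mem).2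
  have hpq' : p ≠ q' := fun hh => Finset.disjoint_left.1 hG.disj hp (hh ▸ hq')
  have hpq'' : p' ≠ q := fun hh => Finset.disjoint_left.1 hG.disj hp' (hh ▸ hq)
  -- If both pairs lie in the same block, that block is weakly above `pq`, so `p'q'` is strictly
  -- higher than `pq` over `e` unless the pairs agree.
  by_cases hDD : D = D'
  · subst hDD
    have a1 := hDa p' hpD'
    have a2 := hDa q' hqD'
    constructor
    · by_contra hne
      have := lineHeight_lt_left hp0 hq0 hp0' hq0' h.lt hc'.lt_left hc'.lt_right
        (lt_of_le_of_ne a1 (hP.orient_ne_zero h.left_mem h.right_mem h'.left_mem h.ne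
          (Ne.symm hne) hpq''.symm).symm) a2
      exact absurd this (not_lt.2 hle)
    · by_contra hne
      have := lineHeight_lt_right hp0 hq0 hp0' hq0' h.lt hc'.lt_left hc'.lt_right a1
        (lt_of_le_of_ne a2 (hP.orient_ne_zero h.left_mem h.right_mem h'.right_mem h.ne
          hpq' (Ne.symm hne)).symm)
      exact absurd this (not_lt.2 hle)
  · exfalso
    have hpp : p' ≠ p := fun hh => hDD (hπ.eq_of_mem hD hD' hpD (hh ▸ hpD'))
    have hqq : q' ≠ q := fun hh => hDD (hπ.eq_of_mem hD hD' hqD (hh ▸ hqD'))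
    have n1 := hP.orient_ne_zero h.left_mem h.right_mem h'.left_mem h.ne hpp.symm hpq''.symm
    have n2 := hP.orient_ne_zero h.left_mem h.right_mem h'.right_mem h.ne hpq' hqq.symm
    -- For different blocks: if `q'` is below `pq`, the segment `p'q'` must pass over `q`, which is
    -- impossible with `p'` below and makes it too high over `e` with `p'` above. If `q'` is above,
    -- then `p'` below is excluded by `not_mixed`, and `p'` above again makes `p'q'` too high.
    rcases lt_or_gt_of_ne n1 with a1 | a1 <;> rcases lt_or_gt_of_ne n2 with a2 | a2
    · have hcc := hcov D' hD' p' hpD' (Or.inl hp') q' hqD' hq' a2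
      exact lt_asymm a2 (above_of_left_below hp0 hq0 hp0' hq0' h.lt hcc.lt_left hcc.lt_right a1
        hcc.below)
    · exact hG.not_mixed hP hB h hπ hD hD' hDD hpD hqD hpD' hqD' hp' hq' a1 a2
    · have hcc := hcov D' hD' p' hpD' (Or.inl hp') q' hqD' hq' a2
      have := lineHeight_lt_of_below hp0 hq0 hp0' hq0' h.lt hc'.lt_left hc.lt_right hcc.lt_right a1
        hcc.below
      exact absurd this (not_lt.2 hle)
    · have := lineHeight_lt_left hp0 hq0 hp0' hq0' h.lt hc'.lt_left hc'.lt_right a1 a2.le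
      exact absurd this (not_lt.2 hle)

/-- A partition with a connection between `X` and `Z` splits at its lowest connection. -/
theorem IsGlue.exists_split (hP : IsAnchored P u v) (hB : IsSaturated P u v B)
    (hG : IsGlue P B u v X Z K k e) (hπ : π ∈ gluedFamilies u v X Z K k e)
    (hmix : ∃ E ∈ π, ∃ x ∈ E, x ∈ X ∧ ∃ y ∈ E, y ∈ Z) :
    ∃ p ∈ X, ∃ q ∈ Z, Covers u v p q e ∧ π ∈ splitFamilies u v X Z K k (p, q) := by
  classical
  rw [mem_gluedFamilies] at hπ
  obtain ⟨hπ, hpin, hcov⟩ := hπ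
  obtain ⟨E₀, hE₀, x₀, hx₀E, hx₀, y₀, hy₀E, hy₀⟩ := hmix
  -- Among all pairs in a common block, one from each part, take one whose line is lowest at the
  -- abscissa of `e`.
  obtain ⟨⟨p, q⟩, hm, hmin⟩ := Finset.exists_min_image
    ((X ×ˢ Z).filter fun x : ℂ × ℂ => ∃ E ∈ π, x.1 ∈ E ∧ x.2 ∈ E)
    (fun x => lineHeight u v x.1 x.2 (absc u v e))
    ⟨(x₀, y₀), by simp only [Finset.mem_filter, Finset.mem_product]; exact ⟨⟨hx₀, hy₀⟩, E₀, hE₀, hx₀E, hy₀E⟩⟩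
  simp only [Finset.mem_filter, Finset.mem_product] at hm
  obtain ⟨⟨hp, hq⟩, D, hD, hpD, hqD⟩ := hm
  replace hmin : ∀ E ∈ π, ∀ x ∈ E, x ∈ X → ∀ y ∈ E, y ∈ Z →
      lineHeight u v p q (absc u v e) ≤ lineHeight u v x y (absc u v e) := by
    intro E hE x hxE hx y hyE hy
    exact hmin (x, y) (by
      simp only [Finset.mem_filter, Finset.mem_product]
      exact ⟨⟨hx, hy⟩, E, hE, hxE, hyE⟩)
  have hc := hcov D hD p hpD hp q hqD hq
  have h := hG.isCovering hp hq hc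
  have hp0 := (mem_chartPoints.1 h.left_mem).2
  have hq0 := (mem_chartPoints.1 h.right_mem).2
  have he0 := (mem_chartPoints.1 h.mem).2
  -- A point of this block below `pq` could replace `p` or `q` and give a lower connection.
  have hDa : ∀ z ∈ D, 0 ≤ orient p q z := by
    intro z hzD
    by_contra hb
    push Not at hb
    rcases Finset.mem_union.1 (hπ.subset D hD hzD) with hz | hz
    · have hcz := hcov D hD z hzD hz q hqD hq
      have := lineHeight_lt_replace_left hp0 hq0 (mem_chartPoints.1 (hG.chain.subset hz)).2 h.lt
        hcz.lt_left hcz.lt_right hb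
      exact absurd this (not_lt.2 (hmin D hD z hzD hz q hqD hq))
    · have hcz := hcov D hD p hpD hp z hzD hz
      have := lineHeight_lt_replace_right hp0 hq0 hcz.pos h.lt hcz.lt_left hcz.lt_right hb
      exact absurd this (not_lt.2 (hmin D hD p hpD hp z hzD hz))
  refine ⟨p, hp, q, hq, hc, mem_splitFamilies.2 ⟨hπ, hpin, ⟨D, hD, hpD, hqD, hDa⟩, ?_⟩⟩
  intro E hE x hxE hx y hyE hy hby
  have hDE : D ≠ E := by
    rintro rfl
    exact absurd hby (not_lt.2 (hDa y hyE))
  have hyq : y ≠ q := by rintro rfl; simp at hby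
  have hyright : y ∈ chartPoints P u v → absc u v e < absc u v y → y ≠ k.1 → y ≠ k.2 →
      absc u v q < absc u v y := by
    intro hy' h1 h2 h3
    refine lt_of_le_of_ne (not_lt.1 fun h4 => ?_) (hP.absc_ne hy' h.right_mem hyq).symm
    exact (hG.eq_of_mem y hy (h.mem_of_below hP hB hy' hby (h.covers.lt_left.trans h1) h4)).elim h2 h3
  by_cases hxX : x ∈ X
  · have hcxy := hcov E hE x hxE hxX y hyE hy
    have hx' := hG.chain.subset hxX
    have hx0 := (mem_chartPoints.1 hx').2
    have hy' : y ∈ chartPoints P u v := by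
      rcases hG.subset y hy with h1 | rfl
      · exact h1
      · simpa using hcxy.pos
    have hyB : y ∉ B := fun hyB => hB.not_covers hP hx' (mem_chartPoints.1 hy').1 (Or.inr hyB)
      h.vertex_mem h.not_interior h.mem hcxy
    have hqy := hyright hy' hcxy.lt_right (fun h' => hyB (h' ▸ hG.fst_mem'))
      (fun h' => hyB (h' ▸ hG.snd_mem'))
    refine ⟨hcxy.pos, hcxy.lt_left.trans hc.lt_right, hqy, ?_⟩
    -- If `q` is not below the segment `xy`, then `xy`, which is not lower than `pq` over `e`, has
    -- to cross `pq`.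
    by_contra hneg
    have hxq : x ≠ q := fun h' => Finset.disjoint_left.1 hG.disj hxX (h' ▸ hq)
    have hxy : x ≠ y := fun h' => Finset.disjoint_left.1 hG.disj hxX (h' ▸ hy)
    have hpos := lt_of_le_of_ne (not_lt.1 hneg)
      (hP.orient_ne_zero hx' hy' h.right_mem hxy hxq hyq).symm
    exact hπ.not_crosses hD hE hDE hpD hqD hyE hxE (crosses_of_lineHeight_le hp0 hq0 hx0 hcxy.pos
      hc.lt_left hc.lt_right hcxy.lt_left hqy hby hpos (hmin E hE x hxE hxX y hyE hy))
  · obtain ⟨hxZ, hax⟩ := hx.resolve_left hxX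
    obtain ⟨hx', hex, -, -⟩ := hG.of_above hP hB h hxZ hax
    have hx0 := (mem_chartPoints.1 hx').2
    have hxp : x ≠ p := by
      rintro rfl
      exact hxX hp
    have hxq : x ≠ q := by
      rintro rfl
      exact hDE (hπ.eq_of_mem hD hE hqD hxE)
    have hax' := lt_of_le_of_ne hax
      (hP.orient_ne_zero h.left_mem h.right_mem hx' h.ne hxp.symm hxq.symm).symm
    obtain ⟨h1, h2⟩ := h.between_of_above hP hB hx' hax'
    -- If `y` is an end of the pin, the block contains `k.1`, and the segment from `k.1` to `x`
    -- passes under `e` and reaches above `pq`, hence crosses it.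
    by_cases hyk : y = k.1 ∨ y = k.2
    · exfalso
      obtain ⟨E', hE', hk1, hk2, -⟩ := hpin k (by simp)
      have hEE : E' = E := by
        rcases hyk with rfl | rfl
        · exact hπ.eq_of_mem hE' hE hk1 hyE
        · exact hπ.eq_of_mem hE' hE hk2 hyE
      subst hEE
      have hk := hG.fst_below hP hB h
      have hk' := hG.snd_below hP hB h
      have ha := hG.above x hxZ (by rintro rfl; exact lt_asymm hk hax')
        (by rintro rfl; exact lt_asymm hk' hax')
      exact hπ.not_crosses hD hE hDE hpD hqD hk1 hxE (crosses_of_above_vertex hp0 hq0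
        (mem_chartPoints.1 hG.fst_chart).2 hx0 he0 hc.lt_left hG.fst_le hex h2 ha hc.below hk hax')
    · push Not at hyk
      have hy' := hG.mem_chart hB hy hyk.1 hyk.2
      have hy0 := (mem_chartPoints.1 hy').2
      have hqy := hyright hy' (((hG.right y hy).resolve_left hyk.1).resolve_left hyk.2) hyk.1 hyk.2
      refine ⟨hy0, h2, hqy, ?_⟩
      by_contra hneg
      have hxy : x ≠ y := by
        rintro rfl
        exact lt_asymm hby hax'
      have hpos := lt_of_le_of_ne (not_lt.1 hneg)
        (hP.orient_ne_zero hx' hy' h.right_mem hxy hxq hyq).symm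
      exact hπ.not_crosses hD hE hDE hpD hqD hyE hxE
        (crosses_of_right hp0 hq0 hy0 hx0 h1 h2 hqy hby hax' hpos)

end

end NCConfig

end

/-! ### Symmetry of glued families -/

noncomputable section

namespace NCConfig

theorem notMem_interior_of_orient_nonneg {c d z : ℂ} (hcd : c ≠ d) {S : Set ℂ}
    (hS : ∀ y ∈ S, 0 ≤ orient c d y) (hz : orient c d z = 0) :
    z ∉ interior (convexHull ℝ S) := by
  intro h
  have hsub : convexHull ℝ S ⊆ {y | 0 ≤ orient c d y} :=
    convexHull_min hS (convex_orient_nonneg c d)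
  -- The normal to `cd` pointing to the right: a small move along it from `z` leaves the half-plane.
  let w : ℂ := ⟨d.im - c.im, -(d.re - c.re)⟩
  have hcont : Continuous fun t : ℝ => z + t • w := by fun_prop
  have hmem : (fun t : ℝ => z + t • w) ⁻¹' convexHull ℝ S ∈ nhds (0 : ℝ) := by
    apply hcont.continuousAt.preimage_mem_nhds
    simpa using mem_interior_iff_mem_nhds.1 h
  obtain ⟨ε, hε, hball⟩ := Metric.mem_nhds_iff.1 hmem
  have h1 : ε / 2 ∈ Metric.ball (0 : ℝ) ε := by
    simp [abs_of_pos hε]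
    linarith
  have h2 : 0 ≤ orient c d (z + (ε / 2) • w) := hsub (hball h1)
  have h3 : orient c d (z + (ε / 2) • w) =
      orient c d z - ε / 2 * ((d.re - c.re) ^ 2 + (d.im - c.im) ^ 2) := by
    simp only [orient, w, Complex.add_re, Complex.add_im, Complex.real_smul, Complex.mul_re,
      Complex.mul_im, Complex.ofReal_re, Complex.ofReal_im]
    ring
  have h4 : 0 < (d.re - c.re) ^ 2 + (d.im - c.im) ^ 2 := by
    by_contra hneg
    apply hcd
    apply Complex.ext <;> nlinarith [sq_nonneg (d.re - c.re), sq_nonneg (d.im - c.im)]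
  rw [h3, hz] at h2
  nlinarith

section

variable {P B : Finset ℂ} {u v : ℂ} {X Z : Finset ℂ} {K : List (ℂ × ℂ)} {k : ℂ × ℂ} {e : ℂ}
  {π : Finset (Finset ℂ)}

theorem IsGlue.right_ssubset (hP : IsAnchored P u v) (hG : IsGlue P B u v X Z K k e) : Z ⊂ P := by
  refine Finset.ssubset_iff_subset_ne.2 ⟨fun z hz => ?_, fun h => ?_⟩
  · rcases hG.subset z hz with h | rfl
    · exact (mem_chartPoints.1 h).1
    · exact hP.right_mem
  · rcases hG.subset u (h ▸ hP.left_mem) with h' | h'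
    · exact (ne_of_mem_chartPoints h').1 rfl
    · exact hP.ne h'

theorem IsGlue.left_ssubset (hP : IsAnchored P u v) (hG : IsGlue P B u v X Z K k e) : X ⊂ P := by
  refine Finset.ssubset_iff_subset_ne.2 ⟨fun z hz => ?_, fun h => ?_⟩
  · exact (mem_chartPoints.1 (hG.chain.subset hz)).1
  · exact (ne_of_mem_chartPoints (hG.chain.subset (h ▸ hP.left_mem))).1 rfl

/-- The pinned part of a configuration glued to a saturated set inherits Property `Δ₁` relative
to its pair. -/
theorem IsGlue.propertyDeltaOneRel (hP : IsAnchored P u v) (hB : IsSaturated P u v B)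
    (hG : IsGlue P B u v X Z K k e) : PropertyDeltaOneRel Z k.1 k.2 := by
  intro T hT h1 h2
  have hsub : T \ {k.1, k.2} ⊆ P :=
    Finset.sdiff_subset.trans (hT.trans (hG.right_ssubset hP).1)
  have hTB : T ⊆ B ∪ T \ {k.1, k.2} := by
    intro z hz
    by_cases h : z ∈ ({k.1, k.2} : Finset ℂ)
    · refine Finset.mem_union_left _ ?_
      rcases Finset.mem_insert.1 h with rfl | h
      · exact hG.fst_mem'
      · rw [Finset.mem_singleton.1 h]
        exact hG.snd_mem'
    · exact Finset.mem_union_right _ (Finset.mem_sdiff.2 ⟨hz, h⟩)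
  have hnn : ∀ y ∈ (T : Set ℂ), 0 ≤ orient k.1 k.2 y := fun y hy => hG.nonneg y (hT hy)
  -- The only points of `T` in `B` are the ends of the pin. They lie on a supporting line of `T`, so
  -- every internal point of `T` is new for `B`, at the cost of the other `|T| - 2` points.
  have key := hB.two_mul_card_le hP (T := T \ {k.1, k.2}) (I := interiorPoints T T) hsub
    (fun z hz => hTB (mem_interiorPoints.1 hz).1)
    (fun z hz => interior_convexHull_mono hTB (mem_interiorPoints.1 hz).2)
    (fun z hz hzB => by
      obtain ⟨hzT, hzi⟩ := mem_interiorPoints.1 hz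
      rcases hG.eq_of_mem z (hT hzT) (mem_interiorPoints.1 hzB).1 with rfl | rfl
      · exact notMem_interior_of_orient_nonneg hG.ne hnn (by simp) hzi
      · exact notMem_interior_of_orient_nonneg hG.ne hnn (by simp) hzi)
  have hc : (T \ {k.1, k.2}).card = T.card - 2 := by
    rw [Finset.card_sdiff_of_subset (by simp [Finset.insert_subset_iff, h1, h2]),
      Finset.card_pair hG.ne]
  have hc' := Finset.card_le_card (Finset.sdiff_subset (s := T \ {k.1, k.2}) (t := B))
  rw [Nat.le_div_iff_mul_le (by norm_num)]
  omega

/-- Cutting at the first pin of the list makes its left vertex the meeting point `e`; the line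
through the pin separates the two parts. -/
theorem IsChain.isGlue (hP : IsAnchored P u v) (h : IsChain P B u v (k :: K) X) :
    IsGlue P B u v (lower X k) (upper X k) K k k.1 := by
  obtain ⟨hX, hL, hK⟩ := h
  have hup : ∀ z ∈ upper X k, z ∈ chartPoints P u v := fun z hz => hX (upper_subset _ _ hz)
  refine
    { chain := hK
      subset := fun z hz => Or.inl (hup z hz)
      disj := disjoint_lower_upper X k
      fst_chart := hX hL.fst_mem
      fst_mem := mem_upper.2 ⟨hL.fst_mem, by simp⟩
      fst_mem' := hL.fst_mem'
      snd_mem := mem_upper.2 ⟨hL.snd_mem, by simp⟩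
      snd_mem' := hL.snd_mem'
      ne := fun h => hL.lt.ne (by rw [h])
      nonneg := fun z hz => (mem_upper.1 hz).2
      eq_of_mem := hL.eq_of_mem
      vertex_chart := hX hL.fst_mem
      vertex_mem := hL.fst_mem'
      not_interior := hL.not_interior
      vertex_ne := ?_
      left := fun z hz => (hL.left z hz).imp_left le_of_lt
      right := ?_
      fst_le := le_rfl
      above := fun z _ _ _ => by simp
      sep := ?_ }
  · intro k' hk' he
    have h1 := (hK.mem k' hk').1
    rw [he] at h1
    simpa using (mem_lower.1 h1).2
  · intro z hz
    by_cases h1 : z = k.1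
    · exact Or.inl h1
    · exact Or.inr (Or.inr (lt_of_le_of_ne (hL.between z hz).1
        (hP.absc_ne (hX hL.fst_mem) (hup z hz) (Ne.symm h1))))
  · intro π hπ E hE
    have hπ' := (mem_pinnedFamilies.1 hπ).1
    refine (disjoint_convexHull_of_orient (p := k.1) (q := k.2) (fun z hz => ?_)
      fun z hz => ?_).symm
    · exact (mem_upper.1 hz).2
    · exact (mem_lower.1 (hπ'.subset E hE hz)).2

/-- A block reaching both sides of the line through the pin `k` cannot cross the segment of the pin,
so it starts to the left of `k.1` and passes over it. The covering condition is thus automatic. -/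
theorem IsChain.pinnedFamilies_eq (hP : IsAnchored P u v) (h : IsChain P B u v (k :: K) X) :
    pinnedFamilies X (k :: K) = gluedFamilies u v (lower X k) (upper X k) K k k.1 := by
  obtain ⟨hX, hL, hK⟩ := h
  ext π
  rw [mem_pinnedFamilies, mem_gluedFamilies, Finset.union_comm, upper_union_lower, ← and_assoc]
  refine (and_iff_left_of_imp ?_).symm
  rintro ⟨hπ, hpin⟩ E hE x hxE hx y hyE hy
  obtain ⟨D, hD, h1, h2, hDa⟩ := hpin k (by simp)
  have hDE : D ≠ E := by
    rintro rfl
    exact absurd (mem_lower.1 hx).2 (not_lt.2 (hDa x hxE))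
  have hy1 : y ≠ k.1 := by
    rintro rfl
    exact hDE (hπ.eq_of_mem hD hE h1 hyE)
  have hy2 : y ≠ k.2 := by
    rintro rfl
    exact hDE (hπ.eq_of_mem hD hE h2 hyE)
  have hnc := hπ.not_crosses hD hE hDE h1 h2 hxE hyE
  have hxk := (hL.left_or_crosses x hx y hy hy1 hy2).resolve_right hnc
  have hx' := hX (lower_subset _ _ hx)
  have hy' := hX (upper_subset _ _ hy)
  have hk1 := hX hL.fst_mem
  have hk2 := hX hL.snd_mem
  have hx0 := (mem_chartPoints.1 hx').2
  have hy0 := (mem_chartPoints.1 hy').2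
  have hne : k.1 ≠ k.2 := fun h => hL.lt.ne (by rw [h])
  obtain ⟨h3, h4⟩ := hL.between y hy
  have h3 := lt_of_le_of_ne h3 (hP.absc_ne hk1 hy' hy1.symm)
  have h4 := lt_of_le_of_ne h4 (hP.absc_ne hy' hk2 hy2)
  have hxk' : x ≠ k.1 := by rintro rfl; exact lt_irrefl _ hxk
  have hxy : x ≠ y := by rintro rfl; exact lt_asymm hxk h3
  refine ⟨hy0, hxk, h3, ?_⟩
  by_contra hneg
  have hpos := lt_of_le_of_ne (not_lt.1 hneg) (hP.orient_ne_zero hx' hy' hk1 hxy hxk' hy1).symm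
  refine hnc (crosses_of_left (mem_chartPoints.1 hk1).2 (mem_chartPoints.1 hk2).2 hx0 hy0 hxk h3 h4
    (mem_lower.1 hx).2 ?_ hpos)
  exact lt_of_le_of_ne (mem_upper.1 hy).2 (hP.orient_ne_zero hk1 hk2 hy' hne hy1.symm hy2.symm).symm

/-- The partitions without connections between `X` and `Z` are unions of partitions of the two. -/
theorem IsGlue.mem_unmixed_iff (hG : IsGlue P B u v X Z K k e) :
    (π ∈ gluedFamilies u v X Z K k e ∧ ¬ ∃ E ∈ π, ∃ x ∈ E, x ∈ X ∧ ∃ y ∈ E, y ∈ Z) ↔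
      ∃ α ∈ pinnedFamilies X K, ∃ β ∈ pinnedFamilies Z [k], π = α ∪ β := by
  classical
  constructor
  · rintro ⟨hπ, hmix⟩
    obtain ⟨hπ, hpin, -⟩ := mem_gluedFamilies.1 hπ
    have hXE : ∀ E ∈ π, ∀ x ∈ E, x ∈ X → E ⊆ X := fun E hE x hxE hx y hy =>
      (Finset.mem_union.1 (hπ.subset E hE hy)).resolve_right
        fun hyZ => hmix ⟨E, hE, x, hxE, hx, y, hy, hyZ⟩
    have hZE : ∀ E ∈ π, ∀ x ∈ E, x ∈ Z → E ⊆ Z := fun E hE x hxE hx y hy =>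
      (Finset.mem_union.1 (hπ.subset E hE hy)).resolve_left
        fun hyX => hmix ⟨E, hE, y, hy, hyX, x, hxE, hx⟩
    have hNC : ∀ Y : Finset ℂ, (∀ E ∈ π, ∀ x ∈ E, x ∈ Y → E ⊆ Y) → Y ⊆ X ∪ Z →
        IsNCFamily Y (π.filter (· ⊆ Y)) := by
      intro Y hY hYXZ
      refine ⟨fun E hE => hπ.nonempty E (Finset.mem_filter.1 hE).1,
        fun E hE => (Finset.mem_filter.1 hE).2, fun z hz => ?_, fun E hE E' hE' => ?_⟩
      · obtain ⟨E, hE, hzE⟩ := hπ.cover z (hYXZ hz)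
        exact ⟨E, Finset.mem_filter.2 ⟨hE, hY E hE z hzE hz⟩, hzE⟩
      · exact hπ.disjoint E (Finset.mem_filter.1 hE).1 E' (Finset.mem_filter.1 hE').1
    refine ⟨π.filter (· ⊆ X), mem_pinnedFamilies.2 ⟨hNC X hXE Finset.subset_union_left, ?_⟩,
      π.filter (· ⊆ Z), mem_pinnedFamilies.2 ⟨hNC Z hZE Finset.subset_union_right, ?_⟩, ?_⟩
    · intro k' hk'
      obtain ⟨E, hE, h1, h2⟩ := hpin k' (List.mem_cons_of_mem _ hk')
      exact ⟨E, Finset.mem_filter.2 ⟨hE, hXE E hE _ h1 (hG.chain.mem k' hk').1⟩, h1, h2⟩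
    · intro k' hk'
      rw [List.mem_singleton.1 hk']
      obtain ⟨E, hE, h1, h2⟩ := hpin k (by simp)
      exact ⟨E, Finset.mem_filter.2 ⟨hE, hZE E hE _ h1 hG.fst_mem⟩, h1, h2⟩
    · ext E
      simp only [Finset.mem_union, Finset.mem_filter, ← and_or_left]
      refine ⟨fun hE => ⟨hE, ?_⟩, fun hE => hE.1⟩
      obtain ⟨z, hz⟩ := hπ.nonempty E hE
      exact (Finset.mem_union.1 (hπ.subset E hE hz)).imp (hXE E hE z hz) (hZE E hE z hz)
  · rintro ⟨α, hα, β, hβ, rfl⟩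
    obtain ⟨hα', hαK⟩ := mem_pinnedFamilies.1 hα
    obtain ⟨hβ', hβK⟩ := mem_pinnedFamilies.1 hβ
    have hno : ∀ E ∈ α ∪ β, ∀ x ∈ E, x ∈ X → ∀ y ∈ E, y ∈ Z → False := by
      intro E hE x hxE hx y hyE hy
      rcases Finset.mem_union.1 hE with hE | hE
      · exact Finset.disjoint_left.1 hG.disj (hα'.subset E hE hyE) hy
      · exact Finset.disjoint_left.1 hG.disj hx (hβ'.subset E hE hxE)
    have hsep : ∀ E ∈ α, ∀ E' ∈ β,
        Disjoint (convexHull ℝ (E : Set ℂ)) (convexHull ℝ (E' : Set ℂ)) := fun E hE E' hE' =>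
      (hG.sep α hα E hE).mono_right (convexHull_mono (by exact_mod_cast hβ'.subset E' hE'))
    refine ⟨mem_gluedFamilies.2 ⟨⟨?_, ?_, ?_, ?_⟩, ?_, ?_⟩, ?_⟩
    · intro E hE
      exact (Finset.mem_union.1 hE).elim (hα'.nonempty E) (hβ'.nonempty E)
    · intro E hE
      exact (Finset.mem_union.1 hE).elim
        (fun h => (hα'.subset E h).trans Finset.subset_union_left)
        (fun h => (hβ'.subset E h).trans Finset.subset_union_right)
    · intro z hz
      rcases Finset.mem_union.1 hz with hz | hz
      · obtain ⟨E, hE, h⟩ := hα'.cover z hz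
        exact ⟨E, Finset.mem_union_left _ hE, h⟩
      · obtain ⟨E, hE, h⟩ := hβ'.cover z hz
        exact ⟨E, Finset.mem_union_right _ hE, h⟩
    · intro E hE E' hE' hne
      rcases Finset.mem_union.1 hE with hE | hE <;> rcases Finset.mem_union.1 hE' with hE' | hE'
      · exact hα'.disjoint E hE E' hE' hne
      · exact hsep E hE E' hE'
      · exact (hsep E' hE' E hE).symm
      · exact hβ'.disjoint E hE E' hE' hne
    · intro k' hk'
      rcases List.mem_cons.1 hk' with rfl | hk'
      · obtain ⟨E, hE, h⟩ := hβK k' (by simp)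
        exact ⟨E, Finset.mem_union_right _ hE, h⟩
      · obtain ⟨E, hE, h⟩ := hαK k' hk'
        exact ⟨E, Finset.mem_union_left _ hE, h⟩
    · intro E hE x hxE hx y hyE hy
      exact (hno E hE x hxE hx y hyE hy).elim
    · rintro ⟨E, hE, x, hxE, hx, y, hyE, hy⟩
      exact hno E hE x hxE hx y hyE hy

theorem card_upper_add_card_lower (X : Finset ℂ) (k : ℂ × ℂ) :
    (upper X k).card + (lower X k).card = X.card := by
  rw [← Finset.card_union_of_disjoint (disjoint_lower_upper X k).symm, upper_union_lower]

/-- Gluing preserves block symmetry. -/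
theorem blockSymmetric_gluedFamilies (hP : IsAnchored P u v)
    (hnc : ∀ Y ⊂ P, Y.Nonempty → BlockSymmetric (ncFamilies Y) (Y.card + 1))
    (hpin : ∀ Y ⊂ P, ∀ c ∈ Y, ∀ d ∈ Y, c ≠ d → (∀ z ∈ Y, 0 ≤ orient c d z) →
      PropertyDeltaOneRel Y c d → BlockSymmetric (pinnedFamilies Y [(c, d)]) Y.card)
    (n : ℕ) : ∀ (B X Z : Finset ℂ) (K : List (ℂ × ℂ)) (k : ℂ × ℂ) (e : ℂ), X.card + Z.card = n →
      IsSaturated P u v B → IsGlue P B u v X Z K k e →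
      BlockSymmetric (gluedFamilies u v X Z K k e) (n + 1) := by
  classical
  -- The outer induction handles the part `X`, a glued family on fewer points when its chain is not
  -- empty; the inner one handles the splittings, which keep `|X| + |Z|` and decrease `|Z|`.
  induction n using Nat.strong_induction_on with
  | _ n ihn =>
  intro B X Z
  induction hz : Z.card using Nat.strong_induction_on generalizing B X Z with
  | _ m ihm =>
  intro K k e hn hB hG
  subst hz
  have hXsym : BlockSymmetric (pinnedFamilies X K) (X.card + 1) := by
    have hch := hG.chain
    cases K with
    | nil =>
      rw [pinnedFamilies_nil]
      exact hnc X (hG.left_ssubset hP) hch.nonempty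
    | cons k' K =>
      rw [hch.pinnedFamilies_eq hP]
      have hZ := Finset.card_pos.2 ⟨_, hG.fst_mem⟩
      exact ihn X.card (by omega) B _ _ K k' _ (by rw [add_comm, card_upper_add_card_lower]) hB
        (hch.isGlue hP)
  have hZsym : BlockSymmetric (pinnedFamilies Z [k]) Z.card :=
    hpin Z (hG.right_ssubset hP) k.1 hG.fst_mem k.2 hG.snd_mem hG.ne hG.nonneg
      (hG.propertyDeltaOneRel hP hB)
  -- Partitions without connections: centre `(|X| + 1) + |Z|`.
  have h0 := BlockSymmetric.product hG.disj hXsym hZsym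
    (𝒞 := (gluedFamilies u v X Z K k e).filter fun π =>
      ¬ ∃ E ∈ π, ∃ x ∈ E, x ∈ X ∧ ∃ y ∈ E, y ∈ Z)
    (fun π hπ => (mem_pinnedFamilies.1 hπ).1) (fun π hπ => (mem_pinnedFamilies.1 hπ).1)
    (fun π => by rw [Finset.mem_filter]; exact hG.mem_unmixed_iff)
  rw [show ((X.card : ℤ) + 1 + Z.card) = n + 1 by omega] at h0
  set I := (X ×ˢ Z).filter fun x : ℂ × ℂ => Covers u v x.1 x.2 e with hI
  have hmemI : ∀ x, x ∈ I ↔ (x.1 ∈ X ∧ x.2 ∈ Z) ∧ Covers u v x.1 x.2 e := fun x => by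
    rw [hI, Finset.mem_filter, Finset.mem_product]
  have h1 : BlockSymmetric (I.biUnion (splitFamilies u v X Z K k)) (n + 1) := by
    apply BlockSymmetric.biUnion
    · rintro ⟨p, q⟩ hx
      obtain ⟨⟨hp, hq⟩, hc⟩ := (hmemI _).1 hx
      simp only at hp hq hc
      have hc1 : (X ∪ upper Z (p, q)).card = X.card + (upper Z (p, q)).card :=
        Finset.card_union_of_disjoint (hG.disj.mono_right (upper_subset _ _))
      have hc2 := card_upper_add_card_lower Z (p, q)
      -- The point `q` itself leaves `Z`, so the inner induction applies.
      have hc3 : 0 < (upper Z (p, q)).card :=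
        Finset.card_pos.2 ⟨q, mem_upper.2 ⟨hq, by simp⟩⟩
      exact ihm (lower Z (p, q)).card (by omega) (B ∪ {p, q}) _ _ rfl _ _ _ (by omega)
        ((hG.isCovering hp hq hc).isSaturated hP hB) (hG.step hP hB hp hq hc)
    · rintro ⟨p, q⟩ hx ⟨p', q'⟩ hx' hne
      obtain ⟨⟨hp, hq⟩, hc⟩ := (hmemI _).1 hx
      obtain ⟨⟨hp', hq'⟩, hc'⟩ := (hmemI _).1 hx'
      simp only at hp hq hc hp' hq' hc'
      rw [Function.onFun, Finset.disjoint_left]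
      intro π hπ hπ'
      apply hne
      rcases le_total (lineHeight u v p' q' (absc u v e)) (lineHeight u v p q (absc u v e))
        with hle | hle
      · obtain ⟨rfl, rfl⟩ := hG.split_unique hP hB hp hq hc hp' hq' hc' hπ hπ' hle
        rfl
      · obtain ⟨rfl, rfl⟩ := hG.split_unique hP hB hp' hq' hc' hp hq hc hπ' hπ hle
        rfl
  have hmixed : ∀ x ∈ I, ∀ π ∈ splitFamilies u v X Z K k x,
      ∃ E ∈ π, ∃ x ∈ E, x ∈ X ∧ ∃ y ∈ E, y ∈ Z := by
    rintro ⟨p, q⟩ hx π hπ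
    obtain ⟨⟨hp, hq⟩, -⟩ := (hmemI _).1 hx
    obtain ⟨-, -, ⟨D, hD, hpD, hqD, -⟩, -⟩ := mem_splitFamilies.1 hπ
    exact ⟨D, hD, p, hpD, hp, q, hqD, hq⟩
  have hdisj : Disjoint ((gluedFamilies u v X Z K k e).filter fun π =>
      ¬ ∃ E ∈ π, ∃ x ∈ E, x ∈ X ∧ ∃ y ∈ E, y ∈ Z) (I.biUnion (splitFamilies u v X Z K k)) := by
    rw [Finset.disjoint_left]
    intro π hπ hπ'
    obtain ⟨x, hx, hπx⟩ := Finset.mem_biUnion.1 hπ'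
    exact (Finset.mem_filter.1 hπ).2 (hmixed x hx π hπx)
  have := h0.union h1 hdisj
  convert this using 1
  ext π
  rw [Finset.mem_union, Finset.mem_filter, Finset.mem_biUnion]
  constructor
  · intro hπ
    by_cases hmix : ∃ E ∈ π, ∃ x ∈ E, x ∈ X ∧ ∃ y ∈ E, y ∈ Z
    · obtain ⟨p, hp, q, hq, hc, hπ'⟩ := hG.exists_split hP hB hπ hmix
      exact Or.inr ⟨(p, q), (hmemI _).2 ⟨⟨hp, hq⟩, hc⟩, hπ'⟩
    · exact Or.inl ⟨hπ, hmix⟩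
  · rintro (⟨hπ, -⟩ | ⟨⟨p, q⟩, hx, hπ⟩)
    · exact hπ
    · obtain ⟨⟨hp, hq⟩, hc⟩ := (hmemI _).1 hx
      exact hG.splitFamilies_subset hP hB hp hq hc hπ

end

end NCConfig

end

/-! ### The partitions of `P \ u` to which `u` cannot be restored -/

noncomputable section

namespace NCConfig

open Classical in
/-- The points `w` for which the triangle `u, v, w` has a point of `P` in its interior. -/
def apexes (P : Finset ℂ) (u v : ℂ) : Finset ℂ :=
  (chartPoints P u v).filter fun w => ∃ x ∈ P, 0 < orient u v x ∧ 0 < orient v w x ∧ 0 < orient w u x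

section

variable {P : Finset ℂ} {u v w x : ℂ}

theorem mem_apexes : w ∈ apexes P u v ↔ w ∈ chartPoints P u v ∧
    ∃ x ∈ P, 0 < orient u v x ∧ 0 < orient v w x ∧ 0 < orient w u x := by
  simp [apexes]

theorem IsAnchored.isSaturated_pair (hP : IsAnchored P u v) : IsSaturated P u v {u, v} := by
  have hs : ({u, v} : Finset ℂ) ⊆ P := by
    simp [Finset.insert_subset_iff, hP.left_mem, hP.right_mem]
  have h := hP.rel {u, v} hs (by simp) (by simp)
  rw [Finset.card_pair hP.ne] at h
  refine ⟨hs, by simp, by simp, ?_⟩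
  rw [Finset.card_pair hP.ne]
  omega

/-- Four points containing `u` and `v` may have one internal point, and `x` is one. This is the
initial saturated set. -/
theorem IsAnchored.interiorPoints_triangle (hP : IsAnchored P u v) (hw : w ∈ chartPoints P u v)
    (hx : x ∈ P) (h1 : 0 < orient u v x) (h2 : 0 < orient v w x) (h3 : 0 < orient w u x) :
    IsSaturated P u v {u, v, w, x} ∧ interiorPoints {u, v, w, x} {u, v, w, x} = {x} := by
  have hwn := ne_of_mem_chartPoints hw
  have hxn := ne_of_mem_chartPoints (mem_chartPoints.2 ⟨hx, h1⟩)
  have hwx : w ≠ x := by rintro rfl; simp at h2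
  have hs : ({u, v, w, x} : Finset ℂ) ⊆ P := by
    simp [Finset.insert_subset_iff, hP.left_mem, hP.right_mem, (mem_chartPoints.1 hw).1, hx]
  have hc : ({u, v, w, x} : Finset ℂ).card = 4 := by
    rw [Finset.card_insert_of_notMem, Finset.card_insert_of_notMem, Finset.card_pair hwx]
    · simp [hwn.2.symm, hxn.2.symm]
    · simp [hP.ne, hwn.1.symm, hxn.1.symm]
  have h := hP.rel _ hs (by simp) (by simp)
  rw [hc] at h
  have hxi : {x} ⊆ interiorPoints {u, v, w, x} {u, v, w, x} := by
    rw [Finset.singleton_subset_iff, mem_interiorPoints]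
    exact ⟨by simp, mem_interior_triangle (by simp) (by simp) (by simp) h1 h2 h3⟩
  have he := Finset.eq_of_subset_of_card_le hxi (by simpa using h)
  refine ⟨⟨hs, by simp, by simp, ?_⟩, he.symm⟩
  rw [← he, hc]
  simp

/-- The start of the recursion: the pin `(w, v)` runs from `w` to the point `v` at infinity, no pins
lie in the left part, and `x` is the point of `B` that the chain needs there. -/
theorem IsAnchored.isGlue (hP : IsAnchored P u v) (hw : w ∈ chartPoints P u v)
    (hx : x ∈ P) (h1 : 0 < orient u v x) (h2 : 0 < orient v w x) (h3 : 0 < orient w u x) :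
    IsGlue P {u, v, w, x} u v (lower (P.erase u) (w, v)) (upper (P.erase u) (w, v)) [] (w, v) w := by
  have hwn := ne_of_mem_chartPoints hw
  have hxc := mem_chartPoints.2 ⟨hx, h1⟩
  have hxn := ne_of_mem_chartPoints hxc
  have hwx : w ≠ x := by rintro rfl; simp at h2
  have hw0 := (mem_chartPoints.1 hw).2
  have hxl : orient w v x < 0 := by rw [orient_swap_left]; linarith
  have hch : ∀ z ∈ P.erase u, z ≠ v → z ∈ chartPoints P u v := fun z hz hzv =>
    hP.mem_chart (Finset.mem_of_mem_erase hz) (Finset.ne_of_mem_erase hz) hzv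
  have hlow : ∀ z ∈ lower (P.erase u) (w, v), z ∈ chartPoints P u v := fun z hz => by
    obtain ⟨hz, ho⟩ := mem_lower.1 hz
    refine hch z hz ?_
    rintro rfl
    simp at ho
  refine
    { chain := ⟨hlow, x, mem_lower.2 ⟨by simp [hx, hxn.1], hxl⟩, by simp⟩
      subset := fun z hz => (em (z = v)).symm.imp_left (hch z (mem_upper.1 hz).1)
      disj := disjoint_lower_upper _ _
      fst_chart := hw
      fst_mem := mem_upper.2 ⟨by simp [(mem_chartPoints.1 hw).1, hwn.1], by simp⟩
      fst_mem' := by simp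
      snd_mem := mem_upper.2 ⟨by simp [hP.right_mem, hP.ne.symm], by simp⟩
      snd_mem' := by simp
      ne := hwn.2
      nonneg := fun z hz => (mem_upper.1 hz).2
      eq_of_mem := ?_
      vertex_chart := hw
      vertex_mem := by simp
      not_interior := ?_
      vertex_ne := by simp
      left := fun z hz => Or.inl ?_
      right := ?_
      fst_le := le_rfl
      above := fun z _ _ _ => by simp
      sep := ?_ }
  · intro z hz hzB
    obtain ⟨hz, ho⟩ := mem_upper.1 hz
    simp only [Finset.mem_insert, Finset.mem_singleton] at hzB
    rcases hzB with rfl | rfl | rfl | rfl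
    · simp at hz
    · exact Or.inr rfl
    · exact Or.inl rfl
    · exact absurd hxl (not_lt.2 ho)
  · rw [(hP.interiorPoints_triangle hw hx h1 h2 h3).2]
    simpa using hwx
  · refine ((orient_right_neg_iff (mem_chartPoints.1 (hlow z hz)).2 hw0).1 ?_).le
    rw [← orient_rotate]
    exact (mem_lower.1 hz).2
  · intro z hz
    by_cases hzw : z = w
    · exact Or.inl hzw
    by_cases hzv : z = v
    · exact Or.inr (Or.inl hzv)
    obtain ⟨hz, ho⟩ := mem_upper.1 hz
    have hzc := hch z hz hzv
    refine Or.inr (Or.inr ((orient_right_neg_iff hw0 (mem_chartPoints.1 hzc).2).1 ?_))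
    have := hP.gp.orient_ne_zero (mem_chartPoints.1 hw).1 hP.right_mem (mem_chartPoints.1 hzc).1
      hwn.2 (Ne.symm hzw) (Ne.symm hzv)
    rw [orient_swap_right]
    exact neg_neg_of_pos (lt_of_le_of_ne ho this.symm)
  · intro π hπ E hE
    refine (disjoint_convexHull_of_orient (p := w) (q := v) (fun z hz => (mem_upper.1 hz).2)
      fun z hz => ?_).symm
    exact (mem_lower.1 ((mem_pinnedFamilies.1 hπ).1.subset E hE hz)).2

/-- In the chart the segment `wv` is the downward ray from `w`; a connection between its two sides
that avoids it passes over `w`. -/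
theorem IsAnchored.pinnedFamilies_eq (hP : IsAnchored P u v) (hw : w ∈ chartPoints P u v) :
    pinnedFamilies (P.erase u) [(w, v)] =
      gluedFamilies u v (lower (P.erase u) (w, v)) (upper (P.erase u) (w, v)) [] (w, v) w := by
  have hw0 := (mem_chartPoints.1 hw).2
  have hwn := ne_of_mem_chartPoints hw
  ext π
  rw [mem_pinnedFamilies, mem_gluedFamilies, Finset.union_comm, upper_union_lower, ← and_assoc]
  refine (and_iff_left_of_imp ?_).symm
  rintro ⟨hπ, hpin⟩ E hE x hxE hx y hyE hy
  obtain ⟨D, hD, hwD, hvD, hDa⟩ := hpin (w, v) (by simp)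
  simp only at hwD hvD hDa
  obtain ⟨hxP, hxo⟩ := mem_lower.1 hx
  obtain ⟨hyP, hyo⟩ := mem_upper.1 hy
  simp only at hxo hyo
  have hDE : D ≠ E := by
    rintro rfl
    exact absurd hxo (not_lt.2 (hDa x hxE))
  have hyw : y ≠ w := by
    rintro rfl
    exact hDE (hπ.eq_of_mem hD hE hwD hyE)
  have hyv : y ≠ v := by
    rintro rfl
    exact hDE (hπ.eq_of_mem hD hE hvD hyE)
  have hxv : x ≠ v := by rintro rfl; simp at hxo
  have hxw : x ≠ w := by rintro rfl; simp at hxo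
  have hxy : x ≠ y := by rintro rfl; exact absurd hxo (not_lt.2 hyo)
  have hxc := hP.mem_chart (Finset.mem_of_mem_erase hxP) (Finset.ne_of_mem_erase hxP) hxv
  have hyc := hP.mem_chart (Finset.mem_of_mem_erase hyP) (Finset.ne_of_mem_erase hyP) hyv
  have hx0 := (mem_chartPoints.1 hxc).2
  have hy0 := (mem_chartPoints.1 hyc).2
  have hyo' : 0 < orient w v y := lt_of_le_of_ne hyo (hP.gp.orient_ne_zero
    (mem_chartPoints.1 hw).1 hP.right_mem (mem_chartPoints.1 hyc).1 hwn.2 hyw.symm hyv.symm).symm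
  have hxl : absc u v x < absc u v w := by
    rw [← orient_right_neg_iff hx0 hw0, ← orient_rotate]
    exact hxo
  have hyl : absc u v w < absc u v y := by
    rw [← orient_right_neg_iff hw0 hy0, orient_swap_right]
    linarith
  refine ⟨hy0, hxl, hyl, ?_⟩
  by_contra hneg
  have hpos := lt_of_le_of_ne (not_lt.1 hneg) (hP.orient_ne_zero hxc hyc hw hxy hxw hyw).symm
  exact hπ.not_crosses hD hE hDE hwD hvD hxE hyE ⟨hxo, hyo', mul_neg_of_pos_of_neg hpos
    ((orient_right_neg_iff hx0 hy0).2 (hxl.trans hyl))⟩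

/-- The block of `v` determines `w` as its extreme point in angle about `v`. -/
theorem IsAnchored.disjoint_pinnedFamilies (hP : IsAnchored P u v) {w' : ℂ}
    (hw : w ∈ chartPoints P u v) (hw' : w' ∈ chartPoints P u v) (hne : w ≠ w') {X : Finset ℂ} :
    Disjoint (pinnedFamilies X [(w, v)]) (pinnedFamilies X [(w', v)]) := by
  rw [Finset.disjoint_left]
  intro π hπ hπ'
  obtain ⟨hπ, hp⟩ := mem_pinnedFamilies.1 hπ
  obtain ⟨-, hp'⟩ := mem_pinnedFamilies.1 hπ'
  obtain ⟨D, hD, hwD, hvD, hDa⟩ := hp (w, v) (by simp)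
  obtain ⟨D', hD', hwD', hvD', hDa'⟩ := hp' (w', v) (by simp)
  obtain rfl := hπ.eq_of_mem hD hD' hvD hvD'
  have h1 := hDa _ hwD'
  have h2 := hDa' _ hwD
  simp only at h1 h2
  rw [← orient_rotate, ← orient_rotate, orient_swap_right, orient_rotate] at h2
  refine hP.gp.orient_ne_zero (mem_chartPoints.1 hw).1 hP.right_mem (mem_chartPoints.1 hw').1
    (ne_of_mem_chartPoints hw).2 hne (ne_of_mem_chartPoints hw').2.symm ?_
  have h3 : orient w' w v = orient w v w' := by unfold orient; ring
  linarith

end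

/-! ### Adding an end of the boundary edge to the block of the other end -/

theorem normSq_mul_orient_left {u v p q : ℂ} (hp : 0 < orient u v p) (hq : 0 < orient u v q) :
    ((v.re - u.re) ^ 2 + (v.im - u.im) ^ 2) * orient p q u =
      orient u v p * orient u v q * (absc v u p - absc v u q) := by
  unfold absc
  rw [orient_swap_left u v p, orient_swap_left u v q]
  field_simp
  unfold orient
  ring

/-- The three orientations on the right are the barycentric coordinates of `z` multiplied by `orient
p q r`, applied to the affine function `f - c`. -/
theorem barycentric_identity (f : ℂ →ₗ[ℝ] ℝ) (c : ℝ) (p q r z : ℂ) :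
    orient p q r * (f z - c) = orient z q r * (f p - c) + orient p z r * (f q - c) +
      orient p q z * (f r - c) := by
  have hf : ∀ z, f z = z.re * f 1 + z.im * f Complex.I := fun z => by
    have : z = z.re • (1 : ℂ) + z.im • Complex.I := by
      apply Complex.ext <;> simp
    conv_lhs => rw [this]
    simp only [map_add, map_smul, smul_eq_mul]
  rw [hf z, hf p, hf q, hf r]
  unfold orient
  ring

section

variable {P : Finset ℂ} {u v : ℂ} {σ : Finset (Finset ℂ)}

/-- Let `w` and `t` be the first points of the block of `v` in angle about `v` and about `u`. If
restoring `u` creates an overlap with `C`, some `z ∈ C` lies in the triangle `u v t`. For `w = t`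
this makes `w` a pinned apex; for `w ≠ t` both `w` and `z` are internal to five points containing
`u` and `v`, against `Δ₁`. -/
theorem IsAnchored.disjoint_insert (hP : IsAnchored P u v) (hσ : IsNCFamily (P.erase u) σ)
    (hbad : ∀ w ∈ apexes P u v, ¬ Pinned σ (w, v)) {F C : Finset ℂ} (hF : F ∈ σ) (hC : C ∈ σ)
    (hvF : v ∈ F) (hFC : F ≠ C) :
    Disjoint (convexHull ℝ ((insert u F : Finset ℂ) : Set ℂ)) (convexHull ℝ (C : Set ℂ)) := by
  have hCc : ∀ z ∈ C, z ∈ chartPoints P u v := fun z hz => by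
    have h := hσ.subset C hC hz
    refine hP.mem_chart (Finset.mem_of_mem_erase h) (Finset.ne_of_mem_erase h) ?_
    rintro rfl
    exact hFC (hσ.eq_of_mem hF hC hvF hz)
  have hFc : ∀ z ∈ F.erase v, z ∈ chartPoints P u v := fun z hz => by
    have h := hσ.subset F hF (Finset.mem_of_mem_erase hz)
    exact hP.mem_chart (Finset.mem_of_mem_erase h) (Finset.ne_of_mem_erase h)
      (Finset.ne_of_mem_erase hz)
  have hpos : ∀ z ∈ chartPoints P u v, 0 < orient u v z := fun z hz => (mem_chartPoints.1 hz).2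
  rcases (F.erase v).eq_empty_or_nonempty with hFv | hFv
  · refine disjoint_convexHull_of_orient (p := v) (q := u) (fun z hz => ?_) fun z hz => ?_
    · rcases Finset.mem_insert.1 (Finset.mem_coe.1 hz) with rfl | hz
      · simp
      · by_cases h : z = v
        · simp [h]
        · have : z ∈ F.erase v := Finset.mem_erase.2 ⟨h, hz⟩
          rw [hFv] at this
          simp at this
    · rw [orient_swap_left]
      linarith [hpos z (hCc z hz)]
  obtain ⟨w, hw, hwmin⟩ := Finset.exists_min_image (F.erase v) (absc u v) hFv
  obtain ⟨t, ht, htmin⟩ := Finset.exists_min_image (F.erase v) (absc v u) hFv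
  have hwc := hFc w hw
  have htc := hFc t ht
  have hN := normSq_pos_of_orient (hpos w hwc)
  have hwl : ∀ z ∈ F, 0 ≤ orient w v z := fun z hz => by
    by_cases h : z = v
    · simp [h]
    have hz' : z ∈ F.erase v := Finset.mem_erase.2 ⟨h, hz⟩
    have h0 := (orient_right_neg_iff (hpos z (hFc z hz')) (hpos w hwc)).not.2
      (not_lt.2 (hwmin z hz'))
    rw [← orient_rotate] at h0
    exact not_lt.1 h0
  have htl : ∀ z ∈ insert u F, 0 ≤ orient t u z := fun z hz => by
    by_cases h : z = v
    · rw [h, ← orient_rotate]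
      exact (hpos t htc).le
    rcases Finset.mem_insert.1 hz with rfl | hz
    · simp
    have hz' : z ∈ F.erase v := Finset.mem_erase.2 ⟨h, hz⟩
    have h0 := normSq_mul_orient_left (hpos z (hFc z hz')) (hpos t htc)
    rw [← orient_rotate] at h0
    have h1 : 0 ≤ orient u v z * orient u v t * (absc v u z - absc v u t) :=
      mul_nonneg (mul_pos (hpos z (hFc z hz')) (hpos t htc)).le (sub_nonneg.2 (htmin z hz'))
    rw [← h0] at h1
    exact nonneg_of_mul_nonneg_right h1 hN
  by_cases hall : ∀ z ∈ C, orient t u z < 0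
  · exact disjoint_convexHull_of_orient htl hall
  push Not at hall
  obtain ⟨z, hz, hzo⟩ := hall
  have hzF : z ∉ F := fun h => hFC (hσ.eq_of_mem hF hC h hz)
  have hzc := hCc z hz
  have htF := Finset.mem_of_mem_erase ht
  have hwF := Finset.mem_of_mem_erase hw
  have hzt : t ≠ z := by rintro rfl; exact hzF htF
  have hzw : w ≠ z := by rintro rfl; exact hzF hwF
  have hzo : 0 < orient t u z := lt_of_le_of_ne hzo (hP.gp.orient_ne_zero (mem_chartPoints.1 htc).1
    hP.left_mem (mem_chartPoints.1 hzc).1 (ne_of_mem_chartPoints htc).1 hzt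
      (ne_of_mem_chartPoints hzc).1.symm).symm
  -- A functional separating `F` from `C` still does so after adding `u`, unless `f u > a`; in that
  -- case the barycentric identity puts `z` on the inner side of `vt`.
  obtain ⟨f, a, b, ha, hab, hb⟩ := geometric_hahn_banach_compact_closed
    (convex_convexHull ℝ (F : Set ℂ))
    (F.finite_toSet.isCompact_convexHull (𝕜 := ℝ)) (convex_convexHull ℝ (C : Set ℂ))
    (C.finite_toSet.isClosed_convexHull (𝕜 := ℝ)) (hσ.disjoint F hF C hC hFC)
  have ha' : ∀ y ∈ F, f y < a := fun y hy => ha y (subset_convexHull ℝ _ hy)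
  rcases le_or_gt (f u) a with hu | hu
  · have h1 : convexHull ℝ ((insert u F : Finset ℂ) : Set ℂ) ⊆ {y | f y ≤ a} :=
      convexHull_min (fun y hy => by
        rcases Finset.mem_insert.1 (Finset.mem_coe.1 hy) with rfl | hy
        · exact hu
        · exact (ha' y hy).le) (convex_halfSpace_le f.toLinearMap.isLinear a)
    rw [Set.disjoint_left]
    intro y hy hyC
    have := h1 hy
    have h2 := hb y hyC
    simp only [Set.mem_ofPred_eq] at this
    linarith
  exfalso
  have hid := barycentric_identity f.toLinearMap a u v t z
  simp only [ContinuousLinearMap.coe_coe] at hid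
  have hfz : 0 < f z - a := by linarith [hb z (subset_convexHull ℝ _ hz)]
  have hzv : 0 < orient v t z := by
    have h1 := mul_pos (hpos t htc) hfz
    have h2 : orient u z t * (f v - a) < 0 := by
      rw [← orient_rotate t u z] at hzo
      exact mul_neg_of_pos_of_neg hzo (by linarith [ha' v hvF])
    have h3 : orient u v z * (f t - a) < 0 :=
      mul_neg_of_pos_of_neg (hpos z hzc) (by linarith [ha' t htF])
    rw [orient_rotate z v t]
    exact pos_of_mul_pos_left (by linarith : 0 < orient z v t * (f u - a)) (by linarith)
  by_cases hwt : w = t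
  · subst hwt
    exact hbad w (mem_apexes.2 ⟨hwc, z, (mem_chartPoints.1 hzc).1, hpos z hzc, hzv, hzo⟩)
      ⟨F, hF, hwF, hvF, hwl⟩
  · have h1 : 0 < orient v t w := by
      rw [orient_rotate w v t]
      exact lt_of_le_of_ne (hwl t htF) (hP.gp.orient_ne_zero (mem_chartPoints.1 hwc).1 hP.right_mem
        (mem_chartPoints.1 htc).1 (ne_of_mem_chartPoints hwc).2 hwt
        (ne_of_mem_chartPoints htc).2.symm).symm
    have h2 : 0 < orient t u w :=
      lt_of_le_of_ne (htl w (Finset.mem_insert_of_mem hwF)) (hP.gp.orient_ne_zero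
        (mem_chartPoints.1 htc).1 hP.left_mem (mem_chartPoints.1 hwc).1
        (ne_of_mem_chartPoints htc).1 (Ne.symm hwt) (ne_of_mem_chartPoints hwc).1.symm).symm
    have hnot : ∀ y ∈ chartPoints P u v, y ∉ interiorPoints {u, v} {u, v} := fun y hy h => by
      have := (mem_interiorPoints.1 h).1
      have hn := ne_of_mem_chartPoints hy
      simp [hn.1, hn.2] at this
    refine hP.isSaturated_pair.not_two_interior hP (T := {t, w, z}) ?_ Finset.card_le_three hzw
      (by simp) (by simp) (hnot w hwc) (hnot z hzc)
      (mem_interior_triangle (by simp) (by simp) (by simp) (hpos w hwc) h1 h2)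
      (mem_interior_triangle (by simp) (by simp) (by simp) (hpos z hzc) hzv hzo)
    simp [Finset.insert_subset_iff, (mem_chartPoints.1 htc).1, (mem_chartPoints.1 hwc).1,
      (mem_chartPoints.1 hzc).1]

theorem IsAnchored.pinned_iff (hP : IsAnchored P u v) (hσ : IsNCFamily P σ) :
    Pinned σ (u, v) ↔ ∃ E ∈ σ, u ∈ E ∧ v ∈ E := by
  refine ⟨fun ⟨E, hE, h1, h2, _⟩ => ⟨E, hE, h1, h2⟩, fun ⟨E, hE, h1, h2⟩ =>
    ⟨E, hE, h1, h2, fun z hz => ?_⟩⟩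
  by_cases hu : z = u
  · simp [hu]
  by_cases hv : z = v
  · simp [hv]
  exact (hP.pos z (hσ.subset E hE hz) hu hv).le

/-- The inverse adds `u` to the block containing `v`. A pin at an apex `w` cannot occur in the
image: the point in the triangle `u v w` is to the right of `w → v`, hence in another block, yet
inside the hull of the block of `u`, `v`, `w`. -/
theorem IsAnchored.bijOn_erase (hP : IsAnchored P u v) :
    Set.BijOn (Finset.image fun E : Finset ℂ => E.erase u)
      (pinnedFamilies P [(u, v)] : Set (Finset (Finset ℂ)))
      (ncFamilies (P.erase u) \
        (apexes P u v).biUnion fun w => pinnedFamilies (P.erase u) [(w, v)]) := by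
  classical
  let j : Finset (Finset ℂ) → Finset (Finset ℂ) :=
    Finset.image fun F : Finset ℂ => if v ∈ F then insert u F else F
  have hA : ∀ {π}, π ∈ pinnedFamilies P [(u, v)] ↔ IsNCFamily P π ∧ ∃ E ∈ π, u ∈ E ∧ v ∈ E := by
    intro π
    rw [mem_pinnedFamilies, List.forall_mem_singleton]
    exact and_congr_right hP.pinned_iff
  have hC : ∀ {σ}, σ ∈ ncFamilies (P.erase u) \
      ((apexes P u v).biUnion fun w => pinnedFamilies (P.erase u) [(w, v)]) ↔
      IsNCFamily (P.erase u) σ ∧ ∀ w ∈ apexes P u v, ¬ Pinned σ (w, v) := by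
    intro σ
    simp only [Finset.mem_sdiff, mem_ncFamilies, Finset.mem_biUnion, mem_pinnedFamilies,
      List.forall_mem_singleton]
    grind
  have huv : ∀ π, IsNCFamily P π → (∃ E ∈ π, u ∈ E ∧ v ∈ E) → ∀ E ∈ π, (v ∈ E ↔ u ∈ E) := by
    rintro π hπ ⟨D, hD, hu, hv⟩ E hE
    constructor <;> intro h
    · rwa [hπ.eq_of_mem hE hD h hv]
    · rwa [hπ.eq_of_mem hE hD h hu]
  have hvu := hP.ne.symm
  rw [← Finset.coe_sdiff]
  refine Set.InvOn.bijOn (f' := j) ⟨fun π hπ => ?_, fun σ hσ => ?_⟩ (fun π hπ => ?_) fun σ hσ => ?_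
  · obtain ⟨hπ, hE⟩ := hA.1 hπ
    have := huv π hπ hE
    simp only [j, Finset.image_image]
    refine (Finset.image_congr fun E hE => ?_).trans Finset.image_id
    simp only [Function.comp, Finset.mem_erase, hvu, ne_eq, not_false_eq_true, true_and, this E hE,
      id]
    split_ifs with h
    · exact Finset.insert_erase h
    · exact Finset.erase_eq_of_notMem h
  · obtain ⟨hσ, -⟩ := hC.1 hσ
    simp only [j, Finset.image_image]
    refine (Finset.image_congr fun F hF => ?_).trans Finset.image_id
    have hu : u ∉ F := fun h => by simpa using hσ.subset F hF h
    simp only [Function.comp, id]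
    split_ifs
    · exact Finset.erase_insert hu
    · exact Finset.erase_eq_of_notMem hu
  · obtain ⟨hπ, hE⟩ := hA.1 hπ
    have hiff := huv π hπ hE
    refine hC.2 ⟨⟨?_, ?_, ?_, ?_⟩, ?_⟩
    · intro F hF
      obtain ⟨E, hE, rfl⟩ := Finset.mem_image.1 hF
      by_cases h : u ∈ E
      · exact ⟨v, Finset.mem_erase.2 ⟨hvu, (hiff E hE).2 h⟩⟩
      · rw [Finset.erase_eq_of_notMem h]
        exact hπ.nonempty E hE
    · intro F hF
      obtain ⟨E, hE, rfl⟩ := Finset.mem_image.1 hF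
      exact Finset.erase_subset_erase u (hπ.subset E hE)
    · intro z hz
      obtain ⟨E, hE, h⟩ := hπ.cover z (Finset.mem_of_mem_erase hz)
      exact ⟨_, Finset.mem_image_of_mem _ hE, Finset.mem_erase.2 ⟨Finset.ne_of_mem_erase hz, h⟩⟩
    · intro F hF F' hF' hne
      obtain ⟨E, hE, rfl⟩ := Finset.mem_image.1 hF
      obtain ⟨E', hE', rfl⟩ := Finset.mem_image.1 hF'
      refine (hπ.disjoint E hE E' hE' fun h => hne (by rw [h])).mono
        (convexHull_mono ?_) (convexHull_mono ?_) <;> exact_mod_cast Finset.erase_subset _ _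
    · rintro w hw ⟨F, hF, hwF, hvF, hFa⟩
      obtain ⟨hwc, x, hx, h1, h2, h3⟩ := mem_apexes.1 hw
      obtain ⟨E, hE, rfl⟩ := Finset.mem_image.1 hF
      simp only [Finset.mem_erase] at hwF hvF hFa
      have hxE : x ∉ E := fun h => by
        have h0 := hFa x ⟨(ne_of_mem_chartPoints (mem_chartPoints.2 ⟨hx, h1⟩)).1, h⟩
        rw [orient_swap_left] at h0
        linarith
      obtain ⟨E', hE', hxE'⟩ := hπ.cover x hx
      refine Set.disjoint_left.1 (hπ.disjoint E hE E' hE' fun h => hxE (h ▸ hxE'))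
        (interior_subset (mem_interior_triangle ?_ hvF.2 hwF.2 h1 h2 h3))
        (subset_convexHull ℝ _ hxE')
      exact (hiff E hE).1 hvF.2
  · obtain ⟨hσ, hbad⟩ := hC.1 hσ
    refine hA.2 ⟨⟨?_, ?_, ?_, ?_⟩, ?_⟩
    · intro E hE
      obtain ⟨F, hF, rfl⟩ := Finset.mem_image.1 hE
      split_ifs
      · exact Finset.insert_nonempty _ _
      · exact hσ.nonempty F hF
    · intro E hE
      obtain ⟨F, hF, rfl⟩ := Finset.mem_image.1 hE
      have := (hσ.subset F hF).trans (Finset.erase_subset u P)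
      split_ifs
      · exact Finset.insert_subset hP.left_mem this
      · exact this
    · intro z hz
      by_cases hzu : z = u
      · obtain ⟨F, hF, h⟩ := hσ.cover v (Finset.mem_erase.2 ⟨hvu, hP.right_mem⟩)
        exact ⟨_, Finset.mem_image_of_mem _ hF, by simp [h, hzu]⟩
      · obtain ⟨F, hF, h⟩ := hσ.cover z (Finset.mem_erase.2 ⟨hzu, hz⟩)
        refine ⟨_, Finset.mem_image_of_mem _ hF, ?_⟩
        split_ifs
        · exact Finset.mem_insert_of_mem h
        · exact h
    · intro E hE E' hE' hne
      obtain ⟨F, hF, rfl⟩ := Finset.mem_image.1 hE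
      obtain ⟨F', hF', rfl⟩ := Finset.mem_image.1 hE'
      have hFF : F ≠ F' := fun h => hne (by rw [h])
      split_ifs with h1 h2 h2
      · exact absurd (hσ.eq_of_mem hF hF' h1 h2) hFF
      · exact hP.disjoint_insert hσ hbad hF hF' h1 hFF
      · exact (hP.disjoint_insert hσ hbad hF' hF h2 hFF.symm).symm
      · exact hσ.disjoint F hF F' hF' hFF
    · obtain ⟨F, hF, h⟩ := hσ.cover v (Finset.mem_erase.2 ⟨hvu, hP.right_mem⟩)
      exact ⟨_, Finset.mem_image_of_mem _ hF, by simp [h], by simp [h]⟩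

theorem IsAnchored.card_image_erase (hP : IsAnchored P u v) (hσ : σ ∈ pinnedFamilies P [(u, v)]) :
    (σ.image fun E : Finset ℂ => E.erase u).card = σ.card := by
  obtain ⟨hσ, h⟩ := mem_pinnedFamilies.1 hσ
  obtain ⟨D, hD, hu, hv, -⟩ := h (u, v) (by simp)
  have hne : ∀ E ∈ σ, (E.erase u).Nonempty := fun E hE => by
    by_cases h : u ∈ E
    · exact ⟨v, Finset.mem_erase.2 ⟨hP.ne.symm, by rwa [hσ.eq_of_mem hE hD h hu]⟩⟩
    · rw [Finset.erase_eq_of_notMem h]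
      exact hσ.nonempty E hE
  refine Finset.card_image_of_injOn fun E hE E' hE' h => ?_
  obtain ⟨z, hz⟩ := hne E hE
  have hz' : z ∈ E'.erase u := by
    have h' : E.erase u = E'.erase u := h
    rwa [← h']
  exact hσ.eq_of_mem hE hE' (Finset.mem_of_mem_erase hz) (Finset.mem_of_mem_erase hz')

/-- The partitions joining the ends of the anchoring edge are block symmetric. -/
theorem IsAnchored.blockSymmetric {n : ℕ} : ∀ {P : Finset ℂ} {u v : ℂ}, P.card = n →
    IsAnchored P u v → (∀ Q ⊂ P, NCRankSymmetric Q) →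
      BlockSymmetric (pinnedFamilies P [(u, v)]) P.card := by
  classical
  induction n using Nat.strong_induction_on with
  | _ n ih =>
  intro P u v hn hP hsub
  subst hn
  have hnc : ∀ Y ⊂ P, Y.Nonempty → BlockSymmetric (ncFamilies Y) (Y.card + 1) :=
    fun Y hY hne => (hsub Y hY).blockSymmetric hne
  -- The induction hypothesis for a smaller configuration anchored at a different edge `cd`; this is
  -- why the anchoring edge varies in the induction.
  have hpin : ∀ Y ⊂ P, ∀ c ∈ Y, ∀ d ∈ Y, c ≠ d → (∀ z ∈ Y, 0 ≤ orient c d z) →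
      PropertyDeltaOneRel Y c d → BlockSymmetric (pinnedFamilies Y [(c, d)]) Y.card := by
    intro Y hY c hc d hd hcd hnn hrel
    have hgp := hP.gp.mono hY.1
    refine ih Y.card (Finset.card_lt_card hY) rfl ⟨hgp, hc, hd, hcd, fun z hz hzc hzd => ?_, hrel⟩
      fun Q hQ => hsub Q (hQ.trans hY)
    exact lt_of_le_of_ne (hnn z hz) (hgp.orient_ne_zero hc hd hz hcd hzc.symm hzd.symm).symm
  have hcard : (P.erase u).card + 1 = P.card := Finset.card_erase_add_one hP.left_mem
  have h1 := hnc (P.erase u) (Finset.erase_ssubset hP.left_mem)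
    ⟨v, Finset.mem_erase.2 ⟨hP.ne.symm, hP.right_mem⟩⟩
  have h2 : BlockSymmetric
      ((apexes P u v).biUnion fun w => pinnedFamilies (P.erase u) [(w, v)])
      ((P.erase u).card + 1) := by
    refine BlockSymmetric.biUnion (fun w hw => ?_) fun w hw w' hw' hne =>
      hP.disjoint_pinnedFamilies (mem_apexes.1 hw).1 (mem_apexes.1 hw').1 hne
    obtain ⟨hwc, x, hx, h1, h2, h3⟩ := mem_apexes.1 hw
    rw [hP.pinnedFamilies_eq hwc]
    exact blockSymmetric_gluedFamilies hP hnc hpin (P.erase u).card _ _ _ _ _ _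
      (by rw [add_comm, card_upper_add_card_lower]) (hP.interiorPoints_triangle hwc hx h1 h2 h3).1
      (hP.isGlue hwc hx h1 h2 h3)
  -- All partitions of `P \ u` and the bad ones have the same centre `|P \ u| + 1 = |P|`, so the
  -- difference has it too.
  have h3 := h1.sdiff h2 fun σ hσ => by
    obtain ⟨w, -, hσ⟩ := Finset.mem_biUnion.1 hσ
    exact mem_ncFamilies.2 (mem_pinnedFamilies.1 hσ).1
  rw [← hcard]
  push_cast
  refine h3.of_bijOn _ ?_ fun π hπ => hP.card_image_erase hπ
  rw [Finset.coe_sdiff]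
  exact hP.bijOn_erase

end

end NCConfig

end

/-! ### Boundary edges as supporting lines, and the conclusion -/

noncomputable section

namespace NCConfig

/-- The points off an edge of the boundary lie on one side of it. -/
theorem IsBoundaryLine.not_separated {P : Finset ℂ} {u v y z : ℂ} (h : IsBoundaryLine P u v)
    (hy : y ∈ P) (hz : z ∈ P) (hy0 : 0 < orient u v y) (hz0 : orient u v z < 0) : False := by
  set H := convexHull ℝ (P : Set ℂ) with hH
  have hsub : ∀ x ∈ P, x ∈ H := fun x hx => subset_convexHull ℝ _ hx
  have hconv : Convex ℝ H := convex_convexHull ℝ _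
  -- The centroid of `u`, `v`, `y` shows that the hull has interior. The midpoint of the edge is not
  -- interior, so a functional `f` supports the hull there.
  let g : ℂ := (1 / 3 : ℝ) • (u + v + y)
  have hg : g ∈ interior H := by
    have h1 : orient u v g = orient u v y / 3 := by
      simp only [g, orient, Complex.add_re, Complex.add_im, Complex.real_smul, Complex.mul_re,
        Complex.mul_im, Complex.ofReal_re, Complex.ofReal_im]
      ring
    have h2 : orient v y g = orient u v y / 3 := by
      simp only [g, orient, Complex.add_re, Complex.add_im, Complex.real_smul, Complex.mul_re,
        Complex.mul_im, Complex.ofReal_re, Complex.ofReal_im]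
      ring
    have h3 : orient y u g = orient u v y / 3 := by
      simp only [g, orient, Complex.add_re, Complex.add_im, Complex.real_smul, Complex.mul_re,
        Complex.mul_im, Complex.ofReal_re, Complex.ofReal_im]
      ring
    exact mem_interior_triangle (Finset.mem_coe.2 h.left_mem) (Finset.mem_coe.2 h.right_mem)
      (Finset.mem_coe.2 hy) (by linarith) (by linarith) (by linarith)
  let m : ℂ := (1 / 2 : ℝ) • u + (1 / 2 : ℝ) • v
  have hm : m ∉ interior H := (h.edge ⟨1 / 2, 1 / 2, by norm_num, by norm_num, by norm_num, rfl⟩).2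
  obtain ⟨f, hf⟩ := geometric_hahn_banach_open_point hconv.interior isOpen_interior hm
  have hle : ∀ x ∈ P, f x ≤ f m := fun x hx => by
    have h1 : x ∈ closure (interior H) := by
      rw [hconv.closure_interior_eq_closure_of_nonempty_interior ⟨g, hg⟩]
      exact subset_closure (hsub x hx)
    exact closure_minimal (t := {x | f x ≤ f m}) (fun a ha => (hf a ha).le)
      (isClosed_le f.continuous continuous_const) h1
  have hmf : f m = 1 / 2 * f u + 1 / 2 * f v := by
    simp only [m, map_add, map_smul, smul_eq_mul]
  have hgf : f g = 1 / 3 * (f u + f v + f y) := by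
    simp only [g, map_add, map_smul, smul_eq_mul]
  have hu := hle u h.left_mem
  have hv := hle v h.right_mem
  -- The value at the midpoint is the mean of two values not exceeding it, so `f` is constant on the
  -- edge; points on opposite sides of the edge would then lie on opposite sides of the supporting
  -- line.
  have hu' : f u = f m := by linarith
  have hv' : f v = f m := by linarith
  have hid := barycentric_identity f.toLinearMap (f m) u v y z
  simp only [ContinuousLinearMap.coe_coe, hu', hv', sub_self, mul_zero, zero_add] at hid
  have h1 : f y < f m := by
    have := hf g hg
    linarith
  nlinarith [mul_pos_of_neg_of_neg hz0 (sub_neg.2 h1),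
    mul_nonneg hy0.le (sub_nonneg.2 (hle z hz))]

theorem PropertyDeltaOneRel.symm {P : Finset ℂ} {u v : ℂ} (h : PropertyDeltaOneRel P u v) :
    PropertyDeltaOneRel P v u := fun B hB hv hu => h B hB hu hv

end NCConfig

end

theorem lemma5p2 (P : Finset ℂ) (u v : ℂ)
    (hP : NCConfig.PropertyDelta 2 P)
    (hl : NCConfig.IsBoundaryLine P u v)
    (hrel : NCConfig.PropertyDeltaOneRel P u v)
    (hsub : ∀ Q : Finset ℂ, Q ⊂ P → NCConfig.NCRankSymmetric Q) :
    NCConfig.IntervalRankSymmetric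
      (NCConfig.linePartition hl.left_mem hl.right_mem) (⊤ : Finpartition P) := by
  -- If no point lies to the left of `u → v`, the roles of `u` and `v` are exchanged; this includes
  -- the case without further points.
  by_cases hpos : ∃ y ∈ P, 0 < NCConfig.orient u v y
  · obtain ⟨y, hy, hy0⟩ := hpos
    have hA : NCConfig.IsAnchored P u v :=
      { gp := hP.1
        left_mem := hl.left_mem
        right_mem := hl.right_mem
        ne := hl.ne
        pos := fun z hz hzu hzv => lt_of_le_of_ne (not_lt.1 (hl.not_separated hy hz hy0))
          (hP.1.orient_ne_zero hl.left_mem hl.right_mem hz hl.ne hzu.symm hzv.symm).symm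
        rel := hrel }
    refine NCConfig.intervalRankSymmetric_of_blockSymmetric hl.left_mem hl.right_mem hl.ne
      (fun σ => ?_) (hA.blockSymmetric rfl hsub)
    rw [NCConfig.mem_pinnedFamilies, List.forall_mem_singleton]
    exact and_congr_right hA.pinned_iff
  · push Not at hpos
    have hA : NCConfig.IsAnchored P v u :=
      { gp := hP.1
        left_mem := hl.right_mem
        right_mem := hl.left_mem
        ne := hl.ne.symm
        pos := fun z hz hzv hzu => by
          rw [NCConfig.orient_swap_left, neg_pos]
          exact lt_of_le_of_ne (hpos z hz)
            (hP.1.orient_ne_zero hl.left_mem hl.right_mem hz hl.ne hzu.symm hzv.symm)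
        rel := hrel.symm }
    refine NCConfig.intervalRankSymmetric_of_blockSymmetric hl.left_mem hl.right_mem hl.ne
      (fun σ => ?_) (hA.blockSymmetric rfl hsub)
    rw [NCConfig.mem_pinnedFamilies, List.forall_mem_singleton]
    refine and_congr_right fun hσ => (hA.pinned_iff hσ).trans ?_
    simp only [and_comm]
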